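/- Let $k$ be a field and let $A$ be a finite-dimensional Hopf algebra over $k$, with antipode $S$ (which is then bijective). The dual $A^*$ carries the product $(pq)(x)=\sum p(x_1)q(x_2)$, the unit $\varepsilon$, the coproduct with $\sum p_1(x)p_2(y)=p(xy)$ and the counit $p\mapsto p(1)$; write $(a\rightharpoonup p)(x)=p(xa)$, $(p\leftharpoonup a)(x)=p(ax)$, $p\rightharpoonup a=\sum p(a_2)a_1$ and $a\leftharpoonup p=\sum p(a_1)a_2$ for $a,x\in A$, $p\in A^*$. Let $(e_i)$ be a basis of $A$ and $(e^i)$ the dual basis of $A^*$. The Drinfel'd double $D(A)$ is $A^{*\,cop}\otimes A$ as a coalgebra, with the product $(p\otimes a)(q\otimes b)=\sum p(a_1\rightharpoonup q\leftharpoonup S^{-1}(a_3))\otimes a_2b$ and $R=\sum_i(\varepsilon\otimes e_i)\otimes(e^i\otimes 1)\in D(A)\otimes D(A)$. The Heisenberg double $\mathcal H(A)=A\#A^*$ is $A\otimes A^*$ with the product $(a\#p)(b\#q)=\sum a(p_1\rightharpoonup b)\#p_2q$; it is identified with the linear dual of $D(A)$ by $\langle a\#f,p\otimes x\rangle=p(a)f(x)$.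 The algebra $E=D(A)\otimes D(A)^{op\,cop}$ acts on $\mathcal H(A)$ by $\langle (h\otimes h')\cdot\varphi,x\rangle=\langle\varphi,h'xh\rangle$ for $h,h',x\in D(A)$. If $R$ is invertible with inverse $U$, put $\mathcal R=\sum(R^1\otimes U^2)\otimes(R^2\otimes U^1)\in E\otimes E$. An element $Q=\sum Q^1\otimes Q^2\in H\otimes H$, $H$ a bialgebra, is called an $R$-matrix if it is invertible, $(\Delta\otimes \mathrm{id})(Q)=Q_{13}Q_{23}$, $(\mathrm{id}\otimes\Delta)(Q)=Q_{13}Q_{12}$ and $\Delta^{cop}(h)Q=Q\Delta(h)$ for all $h\in H$. A left $H$-module algebra $V$ is quantum commutative with respect to $Q$ if $vw=\sum(Q^2\cdot w)(Q^1\cdot v)$ for all $v,w\in V$. **Bialgebroids and Hopf algebroids.** Let $B,T$ be $k$-algebras. A bialgebroid with total algebra $T$ and base $B$ consists of an algebra map $\alpha:B\to T$ and an algebra anti-homomorphism $\beta:B\to T$ with commuting images, and of linear maps $\Delta:T\to T\otimes_BT$ and $\varepsilon:T\to B$ of $B$-bimodules; here $T$ is a $B$-bimodule by $b\cdot t=\alpha(b)t$,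 $t\cdot b=\beta(b)t$. It is required that $\Delta(1)=1\otimes1$, that $\Delta$ is coassociative, that the kernel of $T\otimes T\otimes T\to T\otimes_BT$, $t\otimes t'\otimes t''\mapsto\Delta(t)(t'\otimes t'')$, is a left ideal of $T\otimes T^{op}\otimes T^{op}$, that $\varepsilon(1)=1$, that $\sum\alpha(\varepsilon(t_1))t_2=t=\sum\beta(\varepsilon(t_2))t_1$ for all $t\in T$, and that $\ker\varepsilon$ is a left ideal of $T$. It is a Hopf algebroid (quantum groupoid) if moreover it is equipped with a linear map $\tau:T\to T$ (the antipode) which is an algebra anti-isomorphism such that $\tau\beta=\alpha$, $m_T(\tau\otimes\mathrm{id})\Delta=\beta\varepsilon\tau$, and there is a linear section $\gamma$ of the projection $T\otimes T\to T\otimes_BT$ with $m_T(\mathrm{id}\otimes\tau)\gamma\Delta=\alpha\varepsilon$. **Claim.** (1) $R$ is an $R$-matrix of $D(A)$, $\mathcal R$ is an $R$-matrix of $E=D(A)\otimes D(A)^{op\,cop}$, and $\mathcal H(A)$ is a left $E$-module algebra that is quantum commutative with respect to $\mathcal R$. (2) The map $\iota:A\otimes A^{*op}\to E$, $\iota(a\otimes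 p)=(\varepsilon\otimes a)\otimes(p\otimes1)$, is an injective map of bialgebras with image $\mathcal R_{(l)}=\{(\mathrm{id}\otimes f)(\mathcal R):f\in E^*\}$, and the action of $A\otimes A^{*op}$ on $\mathcal H(A)$ induced by $\iota$ is $(a\otimes p)\cdot(b\#q)=(b\leftharpoonup p)\#(a\rightharpoonup q)$. (3) The smash product algebra $\mathcal H(A)\#(A\otimes A^{*op})$ for this action, with the product $(v\#l)(v'\#l')=\sum v(l_1\cdot v')\#l_2l'$, is the total algebra of a Hopf algebroid with base $\mathcal H(A)$, whose structure maps satisfy, for $v\in\mathcal H(A)$ and $l\in A\otimes A^{*op}$: $\alpha(v)=v\#1$; $(\mathrm{id}\otimes\iota)(\beta(v))=\sum\mathcal R^2\cdot v\otimes\mathcal R^1$; $\Delta(v\#l)=\sum(v\#l_1)\otimes_{\mathcal H(A)}(1\#l_2)$; $\varepsilon(v\#l)=\varepsilon(l)v$; and $\tau\big((1\#\bar S(l))\,\beta(v)\big)=v\#l$, where $\bar S(a\otimes p)=S^{-1}(a)\otimes (p\circ S)$ is the inverse of the antipode of $A\otimes A^{*op}$. -/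

import Mathlib

open scoped TensorProduct

noncomputable section

namespace HopfDouble

open TensorProduct Coalgebra Bialgebra HopfAlgebra WithConv

section Shortcuts

variable {R M N : Type*} [CommSemiring R] [AddCommMonoid M] [AddCommMonoid N] [Module R M]
  [Module R N]

instance instZeroHomClassLinearMap : ZeroHomClass (M →ₗ[R] N) M N := inferInstance
instance instAddHomClassLinearMap : AddHomClass (M →ₗ[R] N) M N := inferInstance
instance instAddMonoidHomClassLinearMap : AddMonoidHomClass (M →ₗ[R] N) M N := inferInstance
instance instLinearMapClassLinearMap : LinearMapClass (M →ₗ[R] N) R M N := inferInstance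
instance instMulActionHomClassLinearMap : MulActionHomClass (M →ₗ[R] N) R M N := inferInstance
instance instMulActionHomClassLinearEquiv : MulActionHomClass (M ≃ₗ[R] N) R M N := inferInstance
instance instZeroHomClassLinearEquiv : ZeroHomClass (M ≃ₗ[R] N) M N := inferInstance
instance instAddHomClassLinearEquiv : AddHomClass (M ≃ₗ[R] N) M N := inferInstance
instance instAddMonoidHomClassLinearEquiv : AddMonoidHomClass (M ≃ₗ[R] N) M N := inferInstance

end Shortcuts

section Antipode

variable (k : Type*) {A : Type*} [Field k] [Ring A] [HopfAlgebra k A]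

/-- The antipode reverses the comultiplication. -/
lemma comul_antipode (a : A) :
    comul (R := k) (antipode k a)
      = map (antipode k) (antipode k) (TensorProduct.comm k A A (comul a)) := by
  let i1 : A →ₐ[k] A ⊗[k] A := Algebra.TensorProduct.includeLeft
  let i2 : A →ₐ[k] A ⊗[k] A := Algebra.TensorProduct.includeRight
  let I1 : WithConv (A →ₗ[k] A ⊗[k] A) := toConv i1.toLinearMap
  let I2 : WithConv (A →ₗ[k] A ⊗[k] A) := toConv i2.toLinearMap
  let J1 : WithConv (A →ₗ[k] A ⊗[k] A) := toConv (i1.toLinearMap ∘ₗ antipode k)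
  let J2 : WithConv (A →ₗ[k] A ⊗[k] A) := toConv (i2.toLinearMap ∘ₗ antipode k)
  have key : ∀ i : A →ₐ[k] A ⊗[k] A,
      (toConv (i.toLinearMap ∘ₗ antipode k) : WithConv (A →ₗ[k] A ⊗[k] A))
        * toConv i.toLinearMap = 1 := by
    intro i
    have h := LinearMap.algHom_comp_convMul_distrib (R := k) i
      (toConv (antipode k (A := A))) (toConv LinearMap.id)
    rw [LinearMap.antipode_mul_id] at h
    apply WithConv.ext
    refine (Eq.symm h).trans ?_
    ext x
    simp [LinearMap.convOne_def]
  have h1 : I1 * I2 = toConv (comul (R := k) (A := A)) := by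
    ext x
    rw [(ℛ k x).convMul_apply]
    simp [I1, I2, i1, i2, (ℛ k x).eq]
  have h2 : (J2 * J1) * (I1 * I2) = 1 := by
    calc (J2 * J1) * (I1 * I2) = J2 * (J1 * I1) * I2 := by simp only [mul_assoc]
      _ = 1 := by rw [key i1, mul_one, key i2]
  have h3 := left_inv_eq_right_inv h2 (h1 ▸ LinearMap.comul_right_inv (R := k) (C := A))
  have h4 := congr($(h3) a)
  rw [(ℛ k a).convMul_apply] at h4
  simp only [J1, J2, i1, i2, LinearMap.comp_apply, AlgHom.toLinearMap_apply,
    Algebra.TensorProduct.includeLeft_apply, Algebra.TensorProduct.includeRight_apply,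
    Algebra.TensorProduct.tmul_mul_tmul, one_mul, mul_one] at h4
  rw [← (ℛ k a).eq]
  simpa using h4.symm

lemma antipode_pow_eq_algHom (n : ℕ) :
    (∃ g : A →ₐ[k] A, ∀ x, g x = (antipode k ^ n : Module.End k A) x) ∨
    (∃ g : A →ₐ[k] Aᵐᵒᵖ, ∀ x, g x = MulOpposite.op ((antipode k ^ n : Module.End k A) x)) := by
  induction n with
  | zero => exact Or.inl ⟨AlgHom.id k A, fun x => by simp⟩
  | succ n ih =>
    rcases ih with ⟨g, hg⟩ | ⟨g, hg⟩
    · refine Or.inr ⟨(antipodeAlgHomOp k A).comp g, fun x => ?_⟩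
      simp [hg, pow_succ']
    · refine Or.inl ⟨AlgHom.ofLinearMap (antipode k ^ (n + 1) : Module.End k A) ?_ ?_, fun x => rfl⟩
      · have := congrArg MulOpposite.unop (map_one g)
        rw [hg] at this
        simp only [MulOpposite.unop_op, MulOpposite.unop_one] at this
        simp [pow_succ', this]
      · intro x y
        have := congrArg MulOpposite.unop (map_mul g x y)
        simp only [hg, MulOpposite.unop_op, MulOpposite.unop_mul] at this
        simp [pow_succ', this, antipode_mul_antidistrib]

/-- An algebra map composed with the antipode is its convolution inverse, hence a coalgebra
endomorphism `p` that fixes `g ∘ S` fixes `g`. -/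
lemma algHom_comp_eq_of_antipode_comp_eq {B : Type*} [Ring B] [Algebra k B]
    (g : A →ₐ[k] B) (p : A →ₗc[k] A)
    (h : (g.toLinearMap ∘ₗ antipode k) ∘ₗ p.toLinearMap = g.toLinearMap ∘ₗ antipode k) :
    g.toLinearMap ∘ₗ p.toLinearMap = g.toLinearMap := by
  let G : WithConv (A →ₗ[k] B) := toConv g.toLinearMap
  let G' : WithConv (A →ₗ[k] B) := toConv (g.toLinearMap ∘ₗ antipode k)
  have e1 : G * G' = 1 := by
    have h := LinearMap.algHom_comp_convMul_distrib (R := k) g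
      (toConv LinearMap.id) (toConv (antipode k (A := A)))
    rw [LinearMap.id_mul_antipode] at h
    apply WithConv.ext
    refine (Eq.symm h).trans ?_
    ext x
    simp [LinearMap.convOne_def]
  have e2 : G' * G = 1 := by
    have h := LinearMap.algHom_comp_convMul_distrib (R := k) g
      (toConv (antipode k (A := A))) (toConv LinearMap.id)
    rw [LinearMap.antipode_mul_id] at h
    apply WithConv.ext
    refine (Eq.symm h).trans ?_
    ext x
    simp [LinearMap.convOne_def]
  have e3 : (toConv (g.toLinearMap ∘ₗ p.toLinearMap) : WithConv (A →ₗ[k] B)) * G' = 1 := by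
    have h' := LinearMap.convMul_comp_coalgHom_distrib (R := k) G G' p
    rw [e1] at h'
    apply WithConv.ext
    have h'' : G'.ofConv ∘ₗ p.toLinearMap = G'.ofConv := h
    rw [h''] at h'
    refine (Eq.symm h').trans ?_
    ext x
    have := congr($(p.counit_comp) x)
    simp only [LinearMap.comp_apply] at this
    simp [LinearMap.convOne_def]
  exact congrArg WithConv.ofConv (left_inv_eq_right_inv e3 e2)

lemma comul_antipode_pow_even (m : ℕ) (a : A) :
    comul (R := k) ((antipode k ^ (2 * m) : Module.End k A) a)
      = map (antipode k ^ (2 * m) : Module.End k A) (antipode k ^ (2 * m) : Module.End k A)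
          (comul a) := by
  induction m generalizing a with
  | zero => simp
  | succ m ih =>
    have e : ∀ x : A, (antipode k ^ (2 * (m + 1)) : Module.End k A) x
        = (antipode k ^ (2 * m) : Module.End k A) (antipode k (antipode k x)) := by
      intro x
      rw [show 2 * (m + 1) = 2 * m + 1 + 1 by ring, pow_succ, pow_succ]
      rfl
    rw [e, ih, comul_antipode, comul_antipode, ← (ℛ k a).eq]
    simp [e]

lemma counit_antipode_pow (n : ℕ) (a : A) :
    counit (R := k) ((antipode k ^ n : Module.End k A) a) = counit (R := k) a := by
  induction n generalizing a with
  | zero => rfl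
  | succ n ih => rw [pow_succ', Module.End.mul_apply, counit_antipode, ih]

lemma exists_pow_quasi_inverse {V : Type*} [AddCommGroup V] [Module k V] [Module.Finite k V]
    (T : Module.End k V) :
    ∃ (m : ℕ) (ρ : Module.End k V), 0 < m ∧ T ^ m * T ^ m * ρ = T ^ m ∧ ρ * (T ^ m * T ^ m) = T ^ m := by
  classical
  have hint : IsIntegral k T := Algebra.IsIntegral.isIntegral T
  obtain ⟨q, hq, hnd⟩ := Polynomial.exists_eq_pow_rootMultiplicity_mul_and_not_dvd
    (minpoly k T) (minpoly.ne_zero hint) 0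
  set m := (minpoly k T).rootMultiplicity 0 + 1 with hm
  have h0 : q.coeff 0 ≠ 0 := by
    intro h
    exact hnd (by simpa using Polynomial.X_dvd_iff.mpr h)
  have hT : T ^ m * Polynomial.aeval T q = 0 := by
    have := minpoly.aeval k T
    rw [hq] at this
    rw [hm, pow_succ', mul_assoc]
    have h' : T ^ (minpoly k T).rootMultiplicity 0 * Polynomial.aeval T q = 0 := by
      simpa using this
    rw [h', mul_zero]
  set r : Module.End k V := -((q.coeff 0)⁻¹ • Polynomial.aeval T q.divX) with hr
  have hc : Commute T r := by
    have h1 : Commute T (Polynomial.aeval T q.divX) := by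
      have := Polynomial.aeval_X (R := k) T
      have h2 := (Commute.all (Polynomial.X : Polynomial k) q.divX).map (Polynomial.aeval T)
      simpa using h2
    exact ((h1.smul_right _)).neg_right
  have h1 : T ^ m = T ^ m * (T * r) := by
    have e := Polynomial.divX_mul_X_add q
    rw [← e] at hT
    simp only [map_add, map_mul, Polynomial.aeval_X, Polynomial.aeval_C, mul_add] at hT
    have e2 : T ^ m * algebraMap k (Module.End k V) (q.coeff 0) = (q.coeff 0) • T ^ m := by
      rw [Algebra.algebraMap_eq_smul_one]; simp
    rw [e2] at hT
    have e3 : T * Polynomial.aeval T q.divX = Polynomial.aeval T q.divX * T := by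
      have h2 := (Commute.all (Polynomial.X : Polynomial k) q.divX).map (Polynomial.aeval T)
      simpa using h2.eq
    have e4 : T ^ m = -((q.coeff 0)⁻¹ • (T ^ m * (T * Polynomial.aeval T q.divX))) := by
      rw [e3, eq_neg_iff_add_eq_zero]
      have := congrArg (fun z => (q.coeff 0)⁻¹ • z) hT
      simp only [smul_add, smul_smul, inv_mul_cancel₀ h0, one_smul, smul_zero] at this
      rw [add_comm]; exact this
    rw [hr]
    simpa using e4
  have h2 : ∀ j : ℕ, T ^ m = T ^ m * (T * r) ^ j := by
    intro j
    induction j with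
    | zero => simp
    | succ j ih => rw [pow_succ (T * r), ← mul_assoc, ← ih, ← h1]
  refine ⟨m, r ^ m, Nat.succ_pos _, ?_, ?_⟩
  · rw [mul_assoc, ← hc.mul_pow, ← h2]
  · have hcm : Commute (r ^ m) (T ^ m * T ^ m) :=
      ((hc.symm.pow_pow m m).mul_right (hc.symm.pow_pow m m))
    rw [hcm.eq, mul_assoc, ← hc.mul_pow, ← h2]

variable (A) in
/-- The antipode of a finite-dimensional Hopf algebra is bijective. -/
theorem antipode_bijective [Module.Finite k A] :
    Function.Bijective (antipode k : A →ₗ[k] A) := by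
  obtain ⟨m, ρ, hm, h1, h2⟩ := exists_pow_quasi_inverse k
    ((antipode k : Module.End k A) ^ 2)
  rw [← pow_mul] at h1 h2
  set φ : Module.End k A := antipode k ^ (2 * m) with hφ
  have hΔ : ∀ a, comul (R := k) (φ a) = map φ φ (comul a) := comul_antipode_pow_even k m
  have hε : ∀ a, counit (R := k) (φ a) = counit (R := k) a := counit_antipode_pow k _
  have h1' : ∀ a, φ (φ (ρ a)) = φ a := fun a => congr($h1 a)
  have h2' : ∀ a, ρ (φ (φ a)) = φ a := fun a => congr($h2 a)
  have hinj : ∀ s t : A ⊗[k] A, map φ φ (map φ φ s) = map φ φ (map φ φ t) →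
      map φ φ s = map φ φ t := by
    have : ∀ s : A ⊗[k] A, map ρ ρ (map φ φ (map φ φ s)) = map φ φ s := by
      intro s
      induction s with
      | zero => simp
      | add x y hx hy => simp only [map_add, hx, hy]
      | tmul x y => simp [h2']
    intro s t h
    rw [← this s, h, this t]
  let p : A →ₗc[k] A :=
    { toLinearMap := φ ∘ₗ ρ
      counit_comp := by
        ext a
        simp only [LinearMap.comp_apply]
        rw [← hε, h1', hε]
      map_comp_comul := by
        ext a
        simp only [LinearMap.comp_apply]
        rw [hΔ, show (map (φ ∘ₗ ρ) (φ ∘ₗ ρ)) (comul (R := k) a)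
          = map φ φ (map ρ ρ (comul a)) from congr($(TensorProduct.map_comp φ φ ρ ρ) (comul a))]
        apply hinj
        rw [← hΔ, ← hΔ, h1', hΔ]
        generalize comul (R := k) a = s
        induction s with
        | zero => simp
        | add x y hx hy => simp only [map_add, hx, hy]
        | tmul x y => simp [h1'] }
  have hp : ∀ a, p a = φ (ρ a) := fun a => rfl
  have hstep : ∀ n : ℕ, (∀ a, (antipode k ^ (n + 1) : Module.End k A) (p a)
      = (antipode k ^ (n + 1) : Module.End k A) a) →
      ∀ a, (antipode k ^ n : Module.End k A) (p a) = (antipode k ^ n : Module.End k A) a := by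
    intro n hn a
    rcases antipode_pow_eq_algHom k (A := A) n with ⟨g, hg⟩ | ⟨g, hg⟩
    · have := algHom_comp_eq_of_antipode_comp_eq k g p (by
        ext x
        have := hn x
        simpa [hg, pow_succ] using this)
      have := congr($this a)
      simpa [hg] using this
    · have := algHom_comp_eq_of_antipode_comp_eq k g p (by
        ext x
        have := hn x
        simpa [hg, pow_succ] using this)
      have := congr($this a)
      simpa [hg] using this
  have hall : ∀ n : ℕ, (∀ a, (antipode k ^ n : Module.End k A) (p a)
      = (antipode k ^ n : Module.End k A) a) → ∀ a, p a = a := by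
    intro n
    induction n with
    | zero => intro h a; simpa using h a
    | succ n ih => intro h; exact ih (hstep n h)
  have hid : ∀ a, φ (ρ a) = a := hall (2 * m) (fun a => h1' a)
  have hsurj : Function.Surjective (antipode k : A →ₗ[k] A) := by
    intro a
    refine ⟨(antipode k ^ (2 * m - 1) : Module.End k A) (ρ a), ?_⟩
    have : (antipode k : Module.End k A) * antipode k ^ (2 * m - 1) = φ := by
      rw [hφ, ← pow_succ']; congr 1; omega
    rw [← Module.End.mul_apply, this, hid]
  exact ⟨LinearMap.injective_iff_surjective.mpr hsurj, hsurj⟩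

end Antipode

section AntipodeInv

variable (k : Type*) (A : Type*) [Field k] [Ring A] [HopfAlgebra k A] [Module.Finite k A]

/-- The inverse `S⁻¹` of the antipode of a finite-dimensional Hopf algebra. -/
def antipodeInv : A →ₗ[k] A :=
  (LinearEquiv.ofBijective (antipode k) (antipode_bijective k A)).symm.toLinearMap

variable {A}

@[simp] lemma antipode_antipodeInv (a : A) : antipode k (antipodeInv k A a) = a :=
  (LinearEquiv.ofBijective (antipode k) (antipode_bijective k A)).apply_symm_apply a

@[simp] lemma antipodeInv_antipode (a : A) : antipodeInv k A (antipode k a) = a :=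
  (LinearEquiv.ofBijective (antipode k) (antipode_bijective k A)).symm_apply_apply a

lemma antipodeInv_one : antipodeInv k A 1 = 1 := by
  rw [← antipode_one (R := k) (A := A), antipodeInv_antipode]
  exact (antipode_one (R := k)).symm

lemma antipodeInv_mul (a b : A) :
    antipodeInv k A (a * b) = antipodeInv k A b * antipodeInv k A a := by
  apply (antipode_bijective k A).1
  simp [antipode_mul_antidistrib]

lemma comul_antipodeInv (a : A) :
    comul (R := k) (antipodeInv k A a)
      = map (antipodeInv k A) (antipodeInv k A) (TensorProduct.comm k A A (comul a)) := by
  have h := comul_antipode k (antipodeInv k A a)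
  rw [antipode_antipodeInv] at h
  rw [h]
  generalize comul (R := k) (antipodeInv k A a) = s
  induction s with
  | zero => simp
  | add x y hx hy => simp only [map_add, ← hx, ← hy]
  | tmul x y => simp

lemma counit_antipodeInv (a : A) : counit (R := k) (antipodeInv k A a) = counit (R := k) a := by
  rw [← counit_antipode, antipode_antipodeInv]

/-- `∑ S⁻¹(a₂) a₁ = ε(a) 1`. -/
lemma mul_antipodeInv_comm_comul (a : A) :
    LinearMap.mul' k A ((antipodeInv k A).rTensor A (TensorProduct.comm k A A (comul a)))
      = algebraMap k A (counit a) := by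
  apply (antipode_bijective k A).1
  have h := mul_antipode_rTensor_comul_apply (R := k) a
  have e : antipode k (algebraMap k A (counit a)) = algebraMap k A (counit a) := by
    rw [Algebra.algebraMap_eq_smul_one, map_smul, antipode_one]
  rw [e, ← h]
  generalize comul (R := k) a = s
  induction s with
  | zero => simp
  | add x y hx hy => simp only [map_add, ← hx, ← hy]
  | tmul x y => simp [antipode_mul_antidistrib]

/-- `∑ a₂ S⁻¹(a₁) = ε(a) 1`. -/
lemma mul_lTensor_antipodeInv_comm_comul (a : A) :
    LinearMap.mul' k A ((antipodeInv k A).lTensor A (TensorProduct.comm k A A (comul a)))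
      = algebraMap k A (counit a) := by
  apply (antipode_bijective k A).1
  have h := mul_antipode_lTensor_comul_apply (R := k) a
  have e : antipode k (algebraMap k A (counit a)) = algebraMap k A (counit a) := by
    rw [Algebra.algebraMap_eq_smul_one, map_smul, antipode_one]
  rw [e, ← h]
  generalize comul (R := k) a = s
  induction s with
  | zero => simp
  | add x y hx hy => simp only [map_add, ← hx, ← hy]
  | tmul x y => simp [antipode_mul_antidistrib]

/-- `S⁻¹` as an algebra map `A → Aᵒᵖ`. -/
def antipodeInvOp : A →ₐ[k] Aᵐᵒᵖ := AlgHom.ofLinearMap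
  ((MulOpposite.opLinearEquiv k).toLinearMap ∘ₗ antipodeInv k A)
  (MulOpposite.unop_injective (by simp [antipodeInv_one]))
  (fun x y => MulOpposite.unop_injective (by simp [antipodeInv_mul]))

@[simp] lemma antipodeInvOp_apply (a : A) :
    antipodeInvOp k a = MulOpposite.op (antipodeInv k A a) := rfl

end AntipodeInv

section Opposites

variable (k : Type*) (H : Type*) [CommRing k] [Ring H] [Bialgebra k H]

/-- The opposite `Hᵒᵖ` of a bialgebra: opposite multiplication, same comultiplication. -/
instance instBialgebraOp : Bialgebra k Hᵐᵒᵖ := Bialgebra.mk' k Hᵐᵒᵖ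
  (by simp [MulOpposite.counit_def])
  (by intro a b; simp [MulOpposite.counit_def, mul_comm])
  (by simp [MulOpposite.comul_def, Algebra.TensorProduct.one_def])
  (by
    intro a b
    simp only [MulOpposite.comul_def, LinearMap.comp_apply, LinearEquiv.coe_coe,
      MulOpposite.coe_opLinearEquiv_symm,
      MulOpposite.unop_mul, Bialgebra.comul_mul]
    generalize comul (R := k) a.unop = s
    generalize comul (R := k) b.unop = t
    induction s with
    | zero => simp
    | add x y hx hy => simp only [mul_add, add_mul, map_add, hx, hy]
    | tmul x y =>
      induction t with
      | zero => simp
      | add x y hx hy => simp only [mul_add, add_mul, map_add, hx, hy]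
      | tmul z w => simp)

/-- The co-opposite of a coalgebra `C`: the same space with the flipped comultiplication. -/
def Cop (C : Type*) : Type _ := C

namespace Cop

section Coalgebra

variable {C : Type*} [AddCommGroup C] [Module k C]

instance : AddCommGroup (Cop C) := inferInstanceAs (AddCommGroup C)
instance : Module k (Cop C) := inferInstanceAs (Module k C)
instance [Module.Finite k C] : Module.Finite k (Cop C) := inferInstanceAs (Module.Finite k C)

variable (C) in
/-- The identity map `C → C^cop`. -/
def toCop : C ≃ₗ[k] Cop C := LinearEquiv.refl k C

variable [Coalgebra k C]

instance : CoalgebraStruct k (Cop C) where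
  comul := map (toCop k C).toLinearMap (toCop k C).toLinearMap ∘ₗ
    (TensorProduct.comm k C C).toLinearMap ∘ₗ comul ∘ₗ (toCop k C).symm.toLinearMap
  counit := counit ∘ₗ (toCop k C).symm.toLinearMap

lemma comul_toCop (c : C) : comul (R := k) (toCop k C c)
    = map (toCop k C).toLinearMap (toCop k C).toLinearMap
        (TensorProduct.comm k C C (comul c)) := rfl

lemma counit_toCop (c : C) : counit (R := k) (toCop k C c) = counit (R := k) c := rfl

instance : Coalgebra k (Cop C) where
  coassoc := by
    apply LinearMap.ext
    intro x
    obtain ⟨c, rfl⟩ := (toCop k C).surjective x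
    have h := Coalgebra.coassoc_apply (R := k) c
    let F : C ⊗[k] (C ⊗[k] C) →ₗ[k] Cop C ⊗[k] (Cop C ⊗[k] Cop C) :=
      (TensorProduct.assoc k (Cop C) (Cop C) (Cop C)).toLinearMap ∘ₗ
      map (map (toCop k C).toLinearMap (toCop k C).toLinearMap ∘ₗ
        (TensorProduct.comm k C C).toLinearMap) (toCop k C).toLinearMap ∘ₗ
      (TensorProduct.comm k C (C ⊗[k] C)).toLinearMap
    have h1 : ∀ s : C ⊗[k] C, F (comul.lTensor C s) =
        TensorProduct.assoc k (Cop C) (Cop C) (Cop C) (comul.rTensor (Cop C)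
          (map (toCop k C).toLinearMap (toCop k C).toLinearMap (TensorProduct.comm k C C s))) := by
      intro s
      induction s with
      | zero => simp
      | add x y hx hy => simp only [map_add, hx, hy]
      | tmul x y => simp [F, comul_toCop]
    have h2 : ∀ s : C ⊗[k] C, F (TensorProduct.assoc k C C C (comul.rTensor C s)) =
        (comul.lTensor (Cop C)
          (map (toCop k C).toLinearMap (toCop k C).toLinearMap (TensorProduct.comm k C C s))) := by
      intro s
      induction s with
      | zero => simp
      | add x y hx hy => simp only [map_add, hx, hy]
      | tmul x y =>
        simp only [LinearMap.rTensor_tmul, TensorProduct.comm_tmul, map_tmul,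
          LinearMap.lTensor_tmul, LinearEquiv.coe_coe, comul_toCop]
        generalize comul (R := k) x = t
        induction t with
        | zero => simp
        | add x y hx hy => simp only [map_add, tmul_add, add_tmul, hx, hy]
        | tmul x y => simp [F]
    simp only [LinearMap.comp_apply, LinearEquiv.coe_coe]
    rw [comul_toCop, ← h1, ← h2, h]
  rTensor_counit_comp_comul := by
    apply LinearMap.ext
    intro x
    obtain ⟨c, rfl⟩ := (toCop k C).surjective x
    have h := congrArg (fun t => map LinearMap.id (toCop k C).toLinearMap
      (TensorProduct.comm k C k t)) (Coalgebra.lTensor_counit_comul (R := k) c)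
    simp only [LinearMap.comp_apply, comul_toCop]
    refine Eq.trans ?_ (h.trans (by simp))
    generalize comul (R := k) c = t
    induction t with
    | zero => simp
    | add x y hx hy => simp only [map_add, hx, hy]
    | tmul x y => simp [counit_toCop]
  lTensor_counit_comp_comul := by
    apply LinearMap.ext
    intro x
    obtain ⟨c, rfl⟩ := (toCop k C).surjective x
    have h := congrArg (fun t => map (toCop k C).toLinearMap LinearMap.id
      (TensorProduct.comm k k C t)) (Coalgebra.rTensor_counit_comul (R := k) c)
    simp only [LinearMap.comp_apply, comul_toCop]
    refine Eq.trans ?_ (h.trans (by simp))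
    generalize comul (R := k) c = t
    induction t with
    | zero => simp
    | add x y hx hy => simp only [map_add, hx, hy]
    | tmul x y => simp [counit_toCop]

end Coalgebra

instance : Ring (Cop H) := inferInstanceAs (Ring H)
instance : Algebra k (Cop H) := inferInstanceAs (Algebra k H)

lemma toCop_mul (x y : H) : toCop k H (x * y) = toCop k H x * toCop k H y := rfl
lemma toCop_one : toCop k H 1 = 1 := rfl

instance : Bialgebra k (Cop H) := Bialgebra.mk' k (Cop H)
  (by rw [← toCop_one k H, counit_toCop, counit_one])
  (by
    intro a b
    obtain ⟨a, rfl⟩ := (toCop k H).surjective a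
    obtain ⟨b, rfl⟩ := (toCop k H).surjective b
    rw [← toCop_mul, counit_toCop, counit_toCop, counit_toCop, counit_mul])
  (by
    rw [← toCop_one k H, comul_toCop, comul_one]
    rfl)
  (by
    intro a b
    obtain ⟨a, rfl⟩ := (toCop k H).surjective a
    obtain ⟨b, rfl⟩ := (toCop k H).surjective b
    rw [← toCop_mul, comul_toCop, comul_toCop, comul_toCop, comul_mul]
    generalize comul (R := k) a = s
    generalize comul (R := k) b = t
    induction s with
    | zero => simp
    | add x y hx hy => simp only [add_mul, map_add, hx, hy]
    | tmul x y =>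
      induction t with
      | zero => simp
      | add x y hx hy => simp only [mul_add, map_add, hx, hy]
      | tmul z w => simp [toCop_mul])

end Cop

end Opposites

section Dual

variable (k : Type*) (A : Type*) [Field k] [Ring A] [Bialgebra k A]

/-- The dual `A*` of a finite-dimensional bialgebra; its algebra structure is the convolution
product `(pq)(x) = ∑ p(x₁) q(x₂)` with unit `ε`. -/
def HDual : Type _ := WithConv (A →ₗ[k] k)

namespace HDual

instance : Ring (HDual k A) := inferInstanceAs (Ring (WithConv (A →ₗ[k] k)))
instance : Algebra k (HDual k A) := inferInstanceAs (Algebra k (WithConv (A →ₗ[k] k)))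

/-- The identification of `A*` with the space of linear forms. -/
def toDual : HDual k A ≃ₗ[k] Module.Dual k A where
  toFun p := p.ofConv
  invFun f := WithConv.toConv f
  left_inv _ := rfl
  right_inv _ := rfl
  map_add' _ _ := rfl
  map_smul' _ _ := rfl

instance : FunLike (HDual k A) A k where
  coe p := toDual k A p
  coe_injective _ _ h := (toDual k A).injective (DFunLike.coe_injective h)

variable {k A}

@[ext] lemma ext {p q : HDual k A} (h : ∀ x, p x = q x) : p = q := DFunLike.ext _ _ h

lemma toDual_apply (p : HDual k A) (x : A) : toDual k A p x = p x := rfl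
@[simp] lemma toDual_symm_apply (f : Module.Dual k A) (x : A) : (toDual k A).symm f x = f x := rfl
@[simp] lemma add_apply (p q : HDual k A) (x : A) : (p + q) x = p x + q x := rfl
@[simp] lemma smul_apply (c : k) (p : HDual k A) (x : A) : (c • p) x = c * p x := rfl
@[simp] lemma zero_apply (x : A) : (0 : HDual k A) x = 0 := rfl
@[simp] lemma one_apply (x : A) : (1 : HDual k A) x = counit (R := k) x := rfl
@[simp] lemma map_add_apply (p : HDual k A) (x y : A) : p (x + y) = p x + p y :=
  map_add (toDual k A p) x y
@[simp] lemma map_smul_apply (p : HDual k A) (c : k) (x : A) : p (c • x) = c * p x :=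
  map_smul (toDual k A p) c x
@[simp] lemma map_zero_apply (p : HDual k A) : p 0 = 0 := map_zero (toDual k A p)

lemma mul_apply (p q : HDual k A) (x : A) :
    (p * q) x = LinearMap.mul' k k (map (toDual k A p) (toDual k A q) (comul x)) := rfl

lemma mul_apply_repr {ι : Type*} (p q : HDual k A) {x : A} (r : Coalgebra.Repr k x ι) :
    (p * q) x = ∑ i ∈ r.index, p (r.left i) * q (r.right i) := by
  rw [mul_apply, ← r.eq]
  simp [toDual_apply]

variable (k A)

instance [Module.Finite k A] : Module.Finite k (HDual k A) :=
  Module.Finite.equiv (toDual k A).symm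

/-- Evaluation `A* → k` at `x ∈ A`. -/
def ev (x : A) : HDual k A →ₗ[k] k := (Module.Dual.eval k A x) ∘ₗ (toDual k A).toLinearMap

@[simp] lemma ev_apply (x : A) (p : HDual k A) : ev k A x p = p x := rfl

variable [Module.Finite k A]

variable {k A} in
/-- Elements of `A* ⊗ V` are separated by evaluation of the first factor. -/
lemma ext_tensor {V : Type*} [AddCommGroup V] [Module k V] {s t : HDual k A ⊗[k] V}
    (h : ∀ x : A, TensorProduct.lid k V ((ev k A x).rTensor V s)
      = TensorProduct.lid k V ((ev k A x).rTensor V t)) : s = t := by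
  have hinj : Function.Injective
      ((dualTensorHom k A V) ∘ₗ (toDual k A).toLinearMap.rTensor V) := by
    have h1 := (dualTensorHomEquiv k A V).injective
    have h2 := ((TensorProduct.congr (toDual k A) (LinearEquiv.refl k V))).injective
    exact h1.comp h2
  apply hinj
  apply LinearMap.ext
  intro x
  have e : ∀ s : HDual k A ⊗[k] V, ((dualTensorHom k A V) ∘ₗ
      (toDual k A).toLinearMap.rTensor V) s x
        = TensorProduct.lid k V ((ev k A x).rTensor V s) := by
    intro s
    induction s with
    | zero => simp
    | add a b ha hb => rw [map_add (_ ∘ₗ _), LinearMap.add_apply, ha, hb]; simp only [map_add]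
    | tmul p v => simp [toDual_apply]
  rw [e, e, h x]

/-- The coalgebra structure of `A*`: `Δ(p) = ∑ p₁ ⊗ p₂` with `∑ p₁(x) p₂(y) = p(xy)`, and
`ε(p) = p(1)`. -/
instance : CoalgebraStruct k (HDual k A) where
  comul := (TensorProduct.congr (toDual k A) (toDual k A)).symm.toLinearMap ∘ₗ
    (dualDistribEquiv k A A).symm.toLinearMap ∘ₗ (LinearMap.mul' k A).dualMap ∘ₗ
    (toDual k A).toLinearMap
  counit := ev k A 1

lemma counit_apply (p : HDual k A) : counit (R := k) p = p 1 := rfl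

/-- Evaluation `A* ⊗ A* → k` at `x, y`. -/
def ev₂ (x y : A) : HDual k A ⊗[k] HDual k A →ₗ[k] k :=
  LinearMap.mul' k k ∘ₗ map (ev k A x) (ev k A y)

@[simp] lemma ev₂_tmul (x y : A) (p q : HDual k A) : ev₂ k A x y (p ⊗ₜ q) = p x * q y := rfl

lemma ev₂_comul (x y : A) (p : HDual k A) : ev₂ k A x y (comul p) = p (x * y) := by
  have h : ∀ s : HDual k A ⊗[k] HDual k A, ev₂ k A x y s
      = (dualDistribEquiv k A A) (TensorProduct.congr (toDual k A) (toDual k A) s) (x ⊗ₜ y) := by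
    intro s
    induction s with
    | zero => simp
    | add a b ha hb => rw [map_add, map_add, map_add, ha, hb]; rfl
    | tmul p q => rfl
  rw [h]
  show (dualDistribEquiv k A A) (TensorProduct.congr (toDual k A) (toDual k A)
    ((TensorProduct.congr (toDual k A) (toDual k A)).symm ((dualDistribEquiv k A A).symm
      ((LinearMap.mul' k A).dualMap (toDual k A p))))) (x ⊗ₜ y) = _
  rw [LinearEquiv.apply_symm_apply, LinearEquiv.apply_symm_apply]
  rfl

variable {k A} in
lemma ext₂ {s t : HDual k A ⊗[k] HDual k A} (h : ∀ x y, ev₂ k A x y s = ev₂ k A x y t) :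
    s = t := by
  apply ext_tensor
  intro x
  apply HDual.ext
  intro y
  have e : ∀ s : HDual k A ⊗[k] HDual k A,
      (TensorProduct.lid k (HDual k A) ((ev k A x).rTensor (HDual k A) s)) y
        = ev₂ k A x y s := by
    intro s
    induction s with
    | zero => simp
    | add a b ha hb => simp only [map_add, HDual.add_apply, ha, hb]
    | tmul p q => simp
  rw [e, e, h]

instance : Coalgebra k (HDual k A) where
  coassoc := by
    apply LinearMap.ext
    intro p
    apply ext_tensor
    intro x
    apply ext₂
    intro y z
    have e1 : ∀ s : HDual k A ⊗[k] HDual k A,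
        ev₂ k A y z (TensorProduct.lid k _ ((ev k A x).rTensor _
          (TensorProduct.assoc k _ _ _ (comul.rTensor (HDual k A) s)))) = ev₂ k A (x * y) z s := by
      intro s
      induction s with
      | zero => simp
      | add a b ha hb => simp only [map_add, ha, hb]
      | tmul p q =>
        rw [LinearMap.rTensor_tmul, ev₂_tmul, ← ev₂_comul]
        generalize comul (R := k) p = t
        induction t with
        | zero => simp
        | add a b ha hb => simp only [map_add, add_tmul, ha, hb, add_mul]
        | tmul p' q' => simp [mul_assoc]
    have e2 : ∀ s : HDual k A ⊗[k] HDual k A,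
        ev₂ k A y z (TensorProduct.lid k _ ((ev k A x).rTensor _
          (comul.lTensor (HDual k A) s))) = ev₂ k A x (y * z) s := by
      intro s
      induction s with
      | zero => simp
      | add a b ha hb => simp only [map_add, ha, hb]
      | tmul p q => simp [ev₂_comul]
    simp only [LinearMap.comp_apply, LinearEquiv.coe_coe]
    rw [e1, e2, ev₂_comul, ev₂_comul, mul_assoc]
  rTensor_counit_comp_comul := by
    apply LinearMap.ext
    intro p
    apply (TensorProduct.lid k (HDual k A)).injective
    apply HDual.ext
    intro x
    have e : ∀ s : HDual k A ⊗[k] HDual k A,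
        (TensorProduct.lid k (HDual k A) (counit.rTensor (HDual k A) s))  x
          = ev₂ k A 1 x s := by
      intro s
      induction s with
      | zero => simp
      | add a b ha hb => simp only [map_add, HDual.add_apply, ha, hb]
      | tmul p q => simp [counit_apply]
    rw [LinearMap.comp_apply, e, ev₂_comul]
    simp
  lTensor_counit_comp_comul := by
    apply LinearMap.ext
    intro p
    apply (TensorProduct.rid k (HDual k A)).injective
    apply HDual.ext
    intro x
    have e : ∀ s : HDual k A ⊗[k] HDual k A,
        (TensorProduct.rid k (HDual k A) (counit.lTensor (HDual k A) s))  x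
          = ev₂ k A x 1 s := by
      intro s
      induction s with
      | zero => simp
      | add a b ha hb => simp only [map_add, HDual.add_apply, ha, hb]
      | tmul p q => simp [counit_apply, mul_comm]
    rw [LinearMap.comp_apply, e, ev₂_comul]
    simp

instance : Bialgebra k (HDual k A) := Bialgebra.mk' k (HDual k A)
  (by simp [counit_apply])
  (by
    intro p q
    simp [counit_apply, mul_apply, toDual_apply, Algebra.TensorProduct.one_def])
  (by
    apply ext₂
    intro x y
    rw [ev₂_comul, Algebra.TensorProduct.one_def]
    simp)
  (by
    intro p q
    apply ext₂
    intro x y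
    rw [ev₂_comul]
    have e : ∀ s t : HDual k A ⊗[k] HDual k A, ev₂ k A x y (s * t)
        = ∑ i ∈ (ℛ k x).index, ∑ j ∈ (ℛ k y).index,
          ev₂ k A ((ℛ k x).left i) ((ℛ k y).left j) s *
          ev₂ k A ((ℛ k x).right i) ((ℛ k y).right j) t := by
      intro s t
      induction s with
      | zero => simp
      | add a b ha hb => simp only [add_mul, map_add, ha, hb, Finset.sum_add_distrib]
      | tmul p p' =>
        induction t with
        | zero => simp
        | add a b ha hb => simp only [mul_add, map_add, ha, hb, Finset.sum_add_distrib]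
        | tmul q q' =>
          simp only [Algebra.TensorProduct.tmul_mul_tmul, ev₂_tmul,
            mul_apply_repr _ _ (ℛ k x), mul_apply_repr _ _ (ℛ k y), Finset.sum_mul_sum]
          refine Finset.sum_congr rfl fun i _ => Finset.sum_congr rfl fun j _ => ?_
          ring
    rw [e]
    simp only [ev₂_comul]
    rw [mul_apply_repr p q ((ℛ k x).mul (ℛ k y))]
    simp [Finset.sum_product])

end HDual

end Dual

section ModuleAlgebra

variable (k : Type*) {H V : Type*} [CommRing k] [Ring H] [Ring V] [Algebra k V]

section
variable [Algebra k H] [Module H V] [IsScalarTower k H V]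

/-- The orbit map `h ↦ h • v` as a `k`-linear map. -/
def smulAt (v : V) : H →ₗ[k] V := (LinearMap.toSpanSingleton H V v).restrictScalars k

@[simp] lemma smulAt_apply (v : V) (h : H) : smulAt k v h = h • v := rfl

/-- The linear map `h ⊗ g ↦ (h • v) (g • w)`. -/
def smulMul (v w : V) : H ⊗[k] H →ₗ[k] V := LinearMap.mul' k V ∘ₗ map (smulAt k v) (smulAt k w)

@[simp] lemma smulMul_tmul (v w : V) (h g : H) :
    smulMul k v w (h ⊗ₜ[k] g) = (h • v) * (g • w) := rfl

end

variable (H V) in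
/-- `V` is a left `H`-module algebra: `h • 1 = ε(h) 1` and `h • (vw) = ∑ (h₁ • v)(h₂ • w)`. -/
class IsModuleAlgebra [Bialgebra k H] [Module H V] [IsScalarTower k H V] : Prop where
  smul_one' : ∀ h : H, h • (1 : V) = algebraMap k V (counit h)
  smul_mul' : ∀ (h : H) (v w : V), h • (v * w) = smulMul k v w (comul h)

end ModuleAlgebra

section Left

variable (k V H : Type*) [CommRing k] [Ring H] [Ring V] [Algebra k V] [Algebra k H]

namespace SmashProduct

/-- Left multiplication by `V` on the first factor of `V ⊗ H`. -/
def left : V →ₐ[k] Module.End k (V ⊗[k] H) :=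
  (Module.endTensorEndAlgHom (R := k) (S := k) (A := k) (M := V) (N := H)).comp
    (Algebra.TensorProduct.includeLeft.comp (Algebra.lmul k V))

@[simp] lemma left_tmul (v w : V) (g : H) : left k V H v (w ⊗ₜ g) = (v * w) ⊗ₜ g := by
  simp [left, Module.endTensorEndAlgHom_apply]

end SmashProduct

end Left

section Smash

variable (k V H : Type*) [CommRing k] [Ring H] [Ring V] [Algebra k V]
  [Bialgebra k H] [Module H V] [IsScalarTower k H V]

/-- The space `V ⊗ H` underlying the smash product `V # H`. -/
@[nolint unusedArguments]
def SmashProduct [IsModuleAlgebra k H V] : Type _ := V ⊗[k] H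

namespace SmashProduct

instance : SMulCommClass H k V := IsScalarTower.to_smulCommClass'

/-- The diagonal action of `H` on `V ⊗ H`: `h · (w ⊗ g) = ∑ (h₁ • w) ⊗ h₂ g`. -/
def act : H →ₐ[k] Module.End k (V ⊗[k] H) :=
  (Module.endTensorEndAlgHom (R := k) (S := k) (A := k) (M := V) (N := H)).comp
    ((Algebra.TensorProduct.map (Algebra.lsmul k k V) (Algebra.lmul k H)).comp
      (comulAlgHom k H))

/-- The smash product multiplication `(v # h)(w # g) = ∑ v (h₁ • w) # h₂ g`. -/
def mulMap : V ⊗[k] H →ₗ[k] Module.End k (V ⊗[k] H) :=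
  TensorProduct.lift ((LinearMap.mul k (Module.End k (V ⊗[k] H))).compl₁₂
    (left k V H).toLinearMap (act k V H).toLinearMap)

lemma mulMap_tmul (v : V) (h : H) : mulMap k V H (v ⊗ₜ h) = left k V H v * act k V H h := rfl

variable {k V H} in
/-- The map `a ⊗ b ↦ (a • w) ⊗ b g`. -/
def actAux (w : V) (g : H) : H ⊗[k] H →ₗ[k] V ⊗[k] H :=
  map (smulAt k w) (LinearMap.mulRight k g)

lemma act_tmul (h : H) (w : V) (g : H) :
    act k V H h (w ⊗ₜ g) = actAux w g (comul h) := by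
  show (Module.endTensorEndAlgHom (R := k) (S := k) (A := k) (M := V) (N := H))
    (Algebra.TensorProduct.map (Algebra.lsmul k k V) (Algebra.lmul k H) (comul h)) (w ⊗ₜ g) = _
  generalize comul (R := k) h = s
  induction s with
  | zero => simp
  | add x y hx hy => simp only [map_add, LinearMap.add_apply, hx, hy]
  | tmul x y => simp [actAux, Module.endTensorEndAlgHom_apply]

lemma act_mul_left [IsModuleAlgebra k H V] (h : H) (w : V) :
    act k V H h * left k V H w = mulMap k V H (act k V H h (w ⊗ₜ 1)) := by
  apply TensorProduct.ext'
  intro u f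
  let F : H ⊗[k] (H ⊗[k] H) →ₗ[k] V ⊗[k] H :=
    (map (LinearMap.mul' k V) LinearMap.id) ∘ₗ
    (TensorProduct.assoc k V V H).symm.toLinearMap ∘ₗ map (smulAt k w) (actAux u f)
  have e1 : ∀ s : H ⊗[k] H, actAux (w * u) f s
      = F (TensorProduct.assoc k H H H (comul.rTensor H s)) := by
    intro s
    induction s with
    | zero => simp
    | add x y hx hy => simp only [map_add, hx, hy]
    | tmul a c =>
      simp only [actAux, map_tmul, smulAt_apply, IsModuleAlgebra.smul_mul' (k := k) a w u, LinearMap.rTensor_tmul,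
        LinearMap.mulRight_apply]
      generalize comul (R := k) a = t
      induction t with
      | zero => simp
      | add x y hx hy => simp only [map_add, add_tmul, hx, hy]
      | tmul a b => simp [F, actAux]
  have e2 : ∀ s : H ⊗[k] H, mulMap k V H (actAux w 1 s) (u ⊗ₜ f)
      = F (comul.lTensor H s) := by
    intro s
    induction s with
    | zero => simp
    | add x y hx hy => simp only [map_add, LinearMap.add_apply, hx, hy]
    | tmul a c =>
      simp only [actAux, map_tmul, smulAt_apply, LinearMap.lTensor_tmul,
        LinearMap.mulRight_apply, mul_one, mulMap_tmul, Module.End.mul_apply, act_tmul]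
      generalize comul (R := k) c = t
      induction t with
      | zero => simp
      | add x y hx hy => simp only [map_add, tmul_add, hx, hy]
      | tmul a b => simp [F, actAux]
  rw [Module.End.mul_apply, left_tmul, act_tmul, act_tmul, e1, e2, coassoc_apply]

lemma mulMap_mulMap [IsModuleAlgebra k H V] (x y : V ⊗[k] H) :
    mulMap k V H (mulMap k V H x y) = mulMap k V H x * mulMap k V H y := by
  have h1 : ∀ (v : V) (y : V ⊗[k] H),
      mulMap k V H (left k V H v y) = left k V H v * mulMap k V H y := by
    intro v y
    induction y with
    | zero => simp
    | add x y hx hy => simp only [map_add, mul_add, hx, hy]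
    | tmul w g => rw [left_tmul, mulMap_tmul, mulMap_tmul, map_mul, mul_assoc]
  have h2 : ∀ (g : H) (y : V ⊗[k] H),
      mulMap k V H ((LinearMap.mulRight k g).lTensor V y) = mulMap k V H y * act k V H g := by
    intro g y
    induction y with
    | zero => simp
    | add x y hx hy => simp only [map_add, add_mul, hx, hy]
    | tmul w f =>
      rw [LinearMap.lTensor_tmul, LinearMap.mulRight_apply, mulMap_tmul, mulMap_tmul, map_mul,
        mul_assoc]
  have h3 : ∀ (h : H) (w : V) (g : H), act k V H h (w ⊗ₜ g)
      = (LinearMap.mulRight k g).lTensor V (act k V H h (w ⊗ₜ 1)) := by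
    intro h w g
    rw [act_tmul, act_tmul]
    generalize comul (R := k) h = s
    induction s with
    | zero => simp
    | add x y hx hy => simp only [map_add, hx, hy]
    | tmul a b => simp [actAux]
  induction x with
  | zero => simp
  | add x y hx hy => simp only [map_add, add_mul, LinearMap.add_apply, hx, hy]
  | tmul v h =>
    induction y with
    | zero => simp
    | add x y hx hy => simp only [map_add, mul_add, hx, hy]
    | tmul w g =>
      rw [mulMap_tmul k V H v h, Module.End.mul_apply, h3, h1, h2, ← act_mul_left, mulMap_tmul]
      simp only [mul_assoc]

variable [IsModuleAlgebra k H V]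

instance : AddCommGroup (SmashProduct k V H) := inferInstanceAs (AddCommGroup (V ⊗[k] H))
instance : Module k (SmashProduct k V H) := inferInstanceAs (Module k (V ⊗[k] H))

/-- The identification of `V # H` with `V ⊗ H` as vector spaces. -/
def ofTensor : V ⊗[k] H ≃ₗ[k] SmashProduct k V H := LinearEquiv.refl k (V ⊗[k] H)

instance : Ring (SmashProduct k V H) where
  __ := (inferInstance : AddCommGroup (SmashProduct k V H))
  mul x y := ofTensor k V H (mulMap k V H ((ofTensor k V H).symm x) ((ofTensor k V H).symm y))
  one := ofTensor k V H (1 ⊗ₜ 1)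
  mul_assoc x y z := congr($(mulMap_mulMap k V H x y) z)
  one_mul x := by
    show mulMap k V H (1 ⊗ₜ 1) x = x
    rw [mulMap_tmul, map_one, map_one]
    rfl
  mul_one x := by
    show mulMap k V H x (1 ⊗ₜ 1) = x
    have : ∀ y : V ⊗[k] H, mulMap k V H y (1 ⊗ₜ 1) = y := by
      intro y
      induction y with
      | zero => simp
      | add x y hx hy => simp only [map_add, LinearMap.add_apply, hx, hy]
      | tmul v h =>
        rw [mulMap_tmul, Module.End.mul_apply, act_tmul]
        have e : ∀ s : H ⊗[k] H, left k V H v (actAux 1 1 s)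
            = v ⊗ₜ (TensorProduct.lid k H (counit.rTensor H s)) := by
          intro s
          induction s with
          | zero => simp
          | add x y hx hy => simp only [map_add, tmul_add, hx, hy]
          | tmul a b =>
            simp only [actAux, map_tmul, smulAt_apply, IsModuleAlgebra.smul_one' (k := k) (V := V) a, left_tmul,
              LinearMap.mulRight_apply, mul_one, LinearMap.rTensor_tmul, lid_tmul, tmul_smul,
              smul_tmul', Algebra.algebraMap_eq_smul_one, mul_smul_comm]
        rw [e]
        simp
    exact this x
  left_distrib x y z := map_add (mulMap k V H x) y z
  right_distrib x y z := congr($(map_add (mulMap k V H) x y) z)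
  zero_mul x := congr($(map_zero (mulMap k V H)) x)
  mul_zero x := map_zero (mulMap k V H x)

instance : Algebra k (SmashProduct k V H) := Algebra.ofModule
  (fun r x y => congr($(map_smul (mulMap k V H) r x) y))
  (fun r x y => map_smul (mulMap k V H x) r y)

variable {k V H}

/-- The element `v # h`. -/
def mk (v : V) (h : H) : SmashProduct k V H := ofTensor k V H (v ⊗ₜ h)

/-- The linear map `h ↦ v # h`. -/
def mkHom (v : V) : H →ₗ[k] SmashProduct k V H :=
  (ofTensor k V H).toLinearMap ∘ₗ TensorProduct.mk k V H v

lemma mkHom_apply (v : V) (h : H) : mkHom v h = (mk v h : SmashProduct k V H) := rfl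

lemma one_def : (1 : SmashProduct k V H) = mk 1 1 := rfl

lemma mk_mul_mk_one (v : V) (h g : H) : (mk v h : SmashProduct k V H) * mk 1 g = mk v (h * g) := by
  show mulMap k V H (v ⊗ₜ h) (1 ⊗ₜ g) = v ⊗ₜ (h * g)
  rw [mulMap_tmul, Module.End.mul_apply, act_tmul]
  have e : ∀ s : H ⊗[k] H, left k V H v (actAux 1 g s)
      = v ⊗ₜ (TensorProduct.lid k H (counit.rTensor H s) * g) := by
    intro s
    induction s with
    | zero => simp
    | add x y hx hy => simp only [map_add, tmul_add, add_mul, hx, hy]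
    | tmul a b =>
      simp only [actAux, map_tmul, smulAt_apply, IsModuleAlgebra.smul_one' (k := k) (V := V) a,
        left_tmul, LinearMap.mulRight_apply, LinearMap.rTensor_tmul, lid_tmul, tmul_smul,
        smul_tmul', Algebra.algebraMap_eq_smul_one, mul_smul_comm, mul_one, smul_mul_assoc]
  rw [e]
  simp

lemma mk_one_mul_mk (v w : V) (g : H) : (mk v 1 : SmashProduct k V H) * mk w g = mk (v * w) g := by
  show mulMap k V H (v ⊗ₜ 1) (w ⊗ₜ g) = (v * w) ⊗ₜ g
  rw [mulMap_tmul, map_one, mul_one, left_tmul]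

lemma mk_mul_mk {ι : Type*} (v w : V) (h g : H) (r : Coalgebra.Repr k h ι) :
    (mk v h : SmashProduct k V H) * mk w g
      = ∑ i ∈ r.index, mk (v * (r.left i • w)) (r.right i * g) := by
  show mulMap k V H (v ⊗ₜ h) (w ⊗ₜ g) = ∑ i ∈ r.index, (v * (r.left i • w)) ⊗ₜ (r.right i * g)
  rw [mulMap_tmul, Module.End.mul_apply, act_tmul, ← r.eq]
  simp [actAux]

end SmashProduct

end Smash

section Regular

variable (k B : Type*) [CommRing k] [Ring B] [Algebra k B]

/-- The left and right regular actions of an algebra `B` on its linear dual,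
`(b ⇀ f ↼ c)(x) = f (c x b)`, as an action of `B ⊗ Bᵒᵖ`. -/
def regularRep : B ⊗[k] Bᵐᵒᵖ →ₐ[k] Module.End k (Module.Dual k B) :=
  Algebra.TensorProduct.lift
    (AlgHom.ofLinearMap
      { toFun := fun b => (LinearMap.mulRight k b).dualMap
        map_add' := fun _ _ => by ext; simp [mul_add]
        map_smul' := fun _ _ => by ext; simp }
      (by ext; simp) (fun _ _ => by ext; simp))
    (AlgHom.ofLinearMap
      { toFun := fun c => (LinearMap.mulLeft k c.unop).dualMap
        map_add' := fun _ _ => by ext; simp [add_mul]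
        map_smul' := fun _ _ => by ext; simp }
      (by ext; simp) (fun _ _ => by ext; simp [mul_assoc]))
    (fun _ _ => (commute_iff_eq _ _).2 (by ext; simp [mul_assoc]))

lemma regularRep_tmul (b : B) (c : Bᵐᵒᵖ) (f : Module.Dual k B) (x : B) :
    regularRep k B (b ⊗ₜ c) f x = f (c.unop * x * b) := by
  rw [regularRep, Algebra.TensorProduct.lift_tmul]
  simp [mul_assoc]

end Regular

section DualModule

variable (k A : Type*) [Field k] [Ring A] [Bialgebra k A]

namespace HDual

/-- The left and right regular actions of `A` on `A*` as an action of `A ⊗ Aᵒᵖ`. -/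
def regular : A ⊗[k] Aᵐᵒᵖ →ₐ[k] Module.End k (HDual k A) :=
  ((toDual k A).symm.conjAlgEquiv k).toAlgHom.comp (regularRep k A)

instance : Module (A ⊗[k] Aᵐᵒᵖ) (HDual k A) :=
  Module.compHom (HDual k A) (regular k A).toRingHom

lemma bismul_def (u : A ⊗[k] Aᵐᵒᵖ) (p : HDual k A) : u • p = regular k A u p := rfl

variable {k A} in
@[simp] lemma tmul_smul_apply (a : A) (b : Aᵐᵒᵖ) (p : HDual k A) (x : A) :
    ((a ⊗ₜ[k] b) • p : HDual k A) x = p (b.unop * x * a) :=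
  regularRep_tmul k A a b (toDual k A p) x

instance : IsScalarTower k (A ⊗[k] Aᵐᵒᵖ) (HDual k A) where
  smul_assoc c u p := by
    rw [bismul_def, bismul_def, map_smul, LinearMap.smul_apply]

instance : IsModuleAlgebra k (A ⊗[k] Aᵐᵒᵖ) (HDual k A) where
  smul_one' u := by
    induction u with
    | zero =>
      have e : algebraMap k (HDual k A) (counit (R := k) (0 : A ⊗[k] Aᵐᵒᵖ)) = 0 := by
        rw [map_zero, map_zero]
      exact (zero_smul (A ⊗[k] Aᵐᵒᵖ) _).trans e.symm
    | add x y hx hy => simp only [add_smul, map_add, hx, hy]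
    | tmul a b =>
      ext x
      rw [tmul_smul_apply]
      simp [MulOpposite.counit_def, Algebra.algebraMap_eq_smul_one, mul_comm, mul_left_comm]
  smul_mul' u p q := by
    induction u with
    | zero =>
      have e : smulMul k p q (comul (R := k) (0 : A ⊗[k] Aᵐᵒᵖ)) = 0 := by
        rw [map_zero, map_zero]
      exact (zero_smul (A ⊗[k] Aᵐᵒᵖ) _).trans e.symm
    | add x y hx hy => simp only [add_smul, map_add, hx, hy]
    | tmul a b =>
      ext x
      rw [tmul_smul_apply]
      induction b using MulOpposite.rec' with | _ b
      rw [mul_apply]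
      simp only [MulOpposite.unop_op, Bialgebra.comul_mul, TensorProduct.comul_tmul,
        MulOpposite.comul_def, LinearMap.comp_apply, LinearEquiv.coe_coe,
        MulOpposite.coe_opLinearEquiv_symm]
      generalize comul (R := k) a = s
      generalize comul (R := k) b = t
      induction s with
      | zero => simp
      | add x y hx hy => simp only [mul_add, map_add, add_tmul, add_apply, hx, hy]
      | tmul a a' =>
        induction t with
        | zero => simp
        | add x y hx hy => simp only [add_mul, map_add, tmul_add, add_apply, hx, hy]
        | tmul b b' =>
          simp only [map_tmul, LinearEquiv.coe_coe, MulOpposite.coe_opLinearEquiv,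
            AlgebraTensorModule.tensorTensorTensorComm_tmul, smulMul_tmul, mul_apply]
          generalize comul (R := k) x = r
          induction r with
          | zero => simp
          | add x y hx hy => simp only [add_mul, mul_add, map_add, hx, hy]
          | tmul x y => simp [toDual_apply]

end HDual

end DualModule

section Hits

variable (k A : Type*) [Field k] [Ring A] [Bialgebra k A]

namespace HDual

/-- The left regular action `(a ⇀ p)(x) = p(x a)` of `A` on `A*`. -/
def lhit : A →ₗ[k] HDual k A →ₗ[k] HDual k A :=
  LinearMap.mk₂ k (fun a p => (toDual k A).symm (toDual k A p ∘ₗ LinearMap.mulRight k a))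
    (by intros; ext; simp [mul_add, toDual_apply]) (by intros; ext; simp [toDual_apply])
    (by intros; ext; simp [toDual_apply]) (by intros; ext; simp [toDual_apply])

/-- The right regular action `(p ↼ a)(x) = p(a x)` of `A` on `A*`. -/
def rhit : A →ₗ[k] HDual k A →ₗ[k] HDual k A :=
  LinearMap.mk₂ k (fun a p => (toDual k A).symm (toDual k A p ∘ₗ LinearMap.mulLeft k a))
    (by intros; ext; simp [add_mul, toDual_apply]) (by intros; ext; simp [toDual_apply])
    (by intros; ext; simp [toDual_apply]) (by intros; ext; simp [toDual_apply])

variable {k A}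

@[simp] lemma lhit_apply (a : A) (p : HDual k A) (x : A) : lhit k A a p x = p (x * a) := rfl
@[simp] lemma rhit_apply (a : A) (p : HDual k A) (x : A) : rhit k A a p x = p (a * x) := rfl

lemma tmul_smul (a : A) (b : Aᵐᵒᵖ) (p : HDual k A) :
    (a ⊗ₜ[k] b) • p = lhit k A a (rhit k A b.unop p) := by
  ext x
  simp [mul_assoc]

lemma lhit_one (p : HDual k A) : lhit k A 1 p = p := by ext; simp
lemma rhit_one (p : HDual k A) : rhit k A 1 p = p := by ext; simp
lemma rhit_rhit (a b : A) (p : HDual k A) : rhit k A a (rhit k A b p) = rhit k A (b * a) p := by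
  ext; simp [mul_assoc]
lemma lhit_rhit (a b : A) (p : HDual k A) :
    lhit k A a (rhit k A b p) = rhit k A b (lhit k A a p) := by
  ext; simp [mul_assoc]

variable [Module.Finite k A]

lemma comul_lhit (a : A) (p : HDual k A) :
    comul (R := k) (lhit k A a p) = (lhit k A a).lTensor _ (comul p) := by
  apply ext₂
  intro x y
  have e : ∀ s, ev₂ k A x y ((lhit k A a).lTensor _ s) = ev₂ k A x (y * a) s := by
    intro s
    induction s with
    | zero => simp
    | add a b ha hb => simp only [map_add, ha, hb]
    | tmul p q => simp
  rw [e, ev₂_comul, ev₂_comul, lhit_apply, mul_assoc]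

lemma comul_rhit (a : A) (p : HDual k A) :
    comul (R := k) (rhit k A a p) = (rhit k A a).rTensor _ (comul p) := by
  apply ext₂
  intro x y
  have e : ∀ s, ev₂ k A x y ((rhit k A a).rTensor _ s) = ev₂ k A (a * x) y s := by
    intro s
    induction s with
    | zero => simp
    | add a b ha hb => simp only [map_add, ha, hb]
    | tmul p q => simp
  rw [e, ev₂_comul, ev₂_comul, rhit_apply, mul_assoc]

/-- `∑ p₁ ⊗ (p₂ ↼ a) = ∑ (a ⇀ p₁) ⊗ p₂`. -/
lemma lTensor_rhit_comul (a : A) (p : HDual k A) :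
    (rhit k A a).lTensor _ (comul (R := k) p) = (lhit k A a).rTensor _ (comul p) := by
  apply ext₂
  intro x y
  have e : ∀ s, ev₂ k A x y ((rhit k A a).lTensor _ s) = ev₂ k A x (a * y) s := by
    intro s
    induction s with
    | zero => simp
    | add a b ha hb => simp only [map_add, ha, hb]
    | tmul p q => simp
  have e' : ∀ s, ev₂ k A x y ((lhit k A a).rTensor _ s) = ev₂ k A (x * a) y s := by
    intro s
    induction s with
    | zero => simp
    | add a b ha hb => simp only [map_add, ha, hb]
    | tmul p q => simp
  rw [e, e', ev₂_comul, ev₂_comul, mul_assoc]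

end HDual

end Hits

section Double

variable (k A : Type*) [Field k] [Ring A] [HopfAlgebra k A] [Module.Finite k A]

/-- The Drinfeld double `D(A)`; as a coalgebra it is `A*^cop ⊗ A`. -/
def DrinfeldDouble : Type _ := Cop (HDual k A) ⊗[k] A

namespace DrinfeldDouble

instance : AddCommGroup (DrinfeldDouble k A) :=
  inferInstanceAs (AddCommGroup (Cop (HDual k A) ⊗[k] A))
instance : Module k (DrinfeldDouble k A) := inferInstanceAs (Module k (Cop (HDual k A) ⊗[k] A))
instance : Coalgebra k (DrinfeldDouble k A) :=
  inferInstanceAs (Coalgebra k (Cop (HDual k A) ⊗[k] A))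
instance : Module.Finite k (DrinfeldDouble k A) :=
  inferInstanceAs (Module.Finite k (Cop (HDual k A) ⊗[k] A))

/-- The identification of the vector space `D(A)` with `A* ⊗ A`. -/
def ofTensor : HDual k A ⊗[k] A ≃ₗ[k] DrinfeldDouble k A :=
  LinearEquiv.refl k (HDual k A ⊗[k] A)

variable {k A} in
/-- The element `p ⊗ a` of `D(A)`. -/
def mk (p : HDual k A) (a : A) : DrinfeldDouble k A := ofTensor k A (p ⊗ₜ a)

/-- The map `x ⊗ (u ⊗ v) ↦ (x ⊗ S⁻¹(v)) ⊗ u`. -/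
def conjAux : A ⊗[k] (A ⊗[k] A) →ₗ[k] (A ⊗[k] Aᵐᵒᵖ) ⊗[k] A :=
  (TensorProduct.assoc k A Aᵐᵒᵖ A).symm.toLinearMap ∘ₗ
    ((TensorProduct.comm k A Aᵐᵒᵖ).toLinearMap ∘ₗ
      (antipodeInvOp k (A := A)).toLinearMap.lTensor A).lTensor A

variable {k A} in
@[simp] lemma conjAux_tmul (x u v : A) : conjAux k A (x ⊗ₜ (u ⊗ₜ v))
    = (x ⊗ₜ MulOpposite.op (antipodeInv k A v)) ⊗ₜ u := by simp [conjAux]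

/-- The map `a ↦ ∑ (a₁ ⊗ S⁻¹(a₃)) ⊗ a₂`. -/
def conj : A →ₗ[k] (A ⊗[k] Aᵐᵒᵖ) ⊗[k] A := conjAux k A ∘ₗ comul.lTensor A ∘ₗ comul

/-- The map `(u ⊗ v) ↦ (q ⊗ b ↦ (u • q) ⊗ v b)`. -/
def pairAct : (A ⊗[k] Aᵐᵒᵖ) ⊗[k] A →ₐ[k] Module.End k (HDual k A ⊗[k] A) :=
  (Module.endTensorEndAlgHom (R := k) (S := k) (A := k) (M := HDual k A) (N := A)).comp
    (Algebra.TensorProduct.map (Algebra.lsmul k k (HDual k A)) (Algebra.lmul k A))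

variable {k A} in
lemma pairAct_tmul (u : A ⊗[k] Aᵐᵒᵖ) (v : A) (q : HDual k A) (b : A) :
    pairAct k A (u ⊗ₜ v) (q ⊗ₜ b) = (u • q) ⊗ₜ (v * b) := by
  simp [pairAct, Module.endTensorEndAlgHom_apply]

/-- The multiplication
`(p ⊗ a)(q ⊗ b) = ∑ p (a₁ ⇀ q ↼ S⁻¹(a₃)) ⊗ a₂ b` on `A* ⊗ A`. -/
def mulMap : HDual k A ⊗[k] A →ₗ[k] Module.End k (HDual k A ⊗[k] A) :=
  TensorProduct.lift ((LinearMap.mul k (Module.End k (HDual k A ⊗[k] A))).compl₁₂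
    (SmashProduct.left k (HDual k A) A).toLinearMap ((pairAct k A).toLinearMap ∘ₗ conj k A))

lemma mulMap_tmul (p : HDual k A) (a : A) : mulMap k A (p ⊗ₜ a)
    = SmashProduct.left k (HDual k A) A p * pairAct k A (conj k A a) := rfl

/-- The algebra map `a ↦ ∑ a₁ ⊗ S⁻¹(a₂)`. -/
def twist : A →ₐ[k] A ⊗[k] Aᵐᵒᵖ :=
  (Algebra.TensorProduct.map (AlgHom.id k A) (antipodeInvOp k)).comp (comulAlgHom k A)

lemma twist_apply (a : A) :
    twist k A a = map LinearMap.id (antipodeInvOp k).toLinearMap (comul (R := k) a) := rfl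

lemma comul_twist (a : A) :
    comul (R := k) (twist k A a) = (twist k A).toLinearMap.lTensor _ (conj k A a) := by
  let H : A ⊗[k] (A ⊗[k] (A ⊗[k] A)) →ₗ[k]
      (A ⊗[k] Aᵐᵒᵖ) ⊗[k] (A ⊗[k] Aᵐᵒᵖ) :=
    (map ((antipodeInvOp k).toLinearMap.lTensor A) ((antipodeInvOp k).toLinearMap.lTensor A)) ∘ₗ
    (TensorProduct.tensorTensorTensorComm k A A A A).toLinearMap ∘ₗ
    ((TensorProduct.comm k A A).toLinearMap.lTensor (A ⊗[k] A)) ∘ₗ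
    (TensorProduct.assoc k A A (A ⊗[k] A)).symm.toLinearMap
  have hH : ∀ x x' y y', H (x ⊗ₜ (x' ⊗ₜ (y ⊗ₜ y')))
      = (x ⊗ₜ MulOpposite.op (antipodeInv k A y')) ⊗ₜ (x' ⊗ₜ MulOpposite.op (antipodeInv k A y)) := by
    intro x x' y y'
    simp [H]
  have e1 : ∀ s : A ⊗[k] A, comul (R := k) (map LinearMap.id (antipodeInvOp k).toLinearMap s)
      = H ((comul.lTensor A).lTensor A (TensorProduct.assoc k A A A (comul.rTensor A s))) := by
    intro s
    induction s with
    | zero => simp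
    | add x y hx hy => simp only [map_add, hx, hy]
    | tmul x y =>
      simp only [map_tmul, LinearMap.id_apply, TensorProduct.comul_tmul, AlgHom.toLinearMap_apply,
        antipodeInvOp_apply, MulOpposite.comul_def, LinearMap.comp_apply, LinearEquiv.coe_coe,
        MulOpposite.coe_opLinearEquiv_symm, MulOpposite.unop_op, comul_antipodeInv,
        LinearMap.rTensor_tmul]
      generalize comul (R := k) x = s
      induction s with
      | zero => simp
      | add x y hx hy => simp only [map_add, add_tmul, hx, hy]
      | tmul x x' =>
        simp only [TensorProduct.assoc_tmul, LinearMap.lTensor_tmul]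
        generalize comul (R := k) y = t
        induction t with
        | zero => simp
        | add x y hx hy => simp only [map_add, tmul_add, hx, hy]
        | tmul y y' => simp [hH]
  have e2 : ∀ s : A ⊗[k] A, (twist k A).toLinearMap.lTensor _ (conjAux k A (comul.lTensor A s))
      = H ((TensorProduct.assoc k A A A).toLinearMap.lTensor A
          ((comul.rTensor A).lTensor A (comul.lTensor A s))) := by
    intro s
    induction s with
    | zero => simp
    | add x y hx hy => simp only [map_add, hx, hy]
    | tmul x c =>
      simp only [LinearMap.lTensor_tmul]
      generalize comul (R := k) c = t
      induction t with
      | zero => simp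
      | add x y hx hy => simp only [map_add, tmul_add, hx, hy]
      | tmul u v =>
        simp only [conjAux_tmul, LinearMap.lTensor_tmul, LinearMap.rTensor_tmul,
          AlgHom.toLinearMap_apply, twist_apply]
        generalize comul (R := k) u = r
        induction r with
        | zero => simp
        | add x y hx hy => simp only [map_add, tmul_add, add_tmul, hx, hy]
        | tmul u u' => simp [hH]
  clear_value H
  have e3 : conj k A a = conjAux k A (comul.lTensor A (comul a)) := rfl
  rw [twist_apply, e1, e3, e2, coassoc_apply]
  generalize comul (R := k) a = s
  induction s with
  | zero => simp
  | add x y hx hy => simp only [map_add, hx, hy]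
  | tmul x c => simp [coassoc_apply]

lemma twist_injective : Function.Injective (twist k A) := by
  have h : ∀ a, TensorProduct.rid k A (map LinearMap.id (counit (R := k)) (twist k A a)) = a := by
    intro a
    rw [twist_apply]
    have e : ∀ s : A ⊗[k] A, map LinearMap.id (counit (R := k))
        (map LinearMap.id (antipodeInvOp k).toLinearMap s) = counit.lTensor A s := by
      intro s
      induction s with
      | zero => simp
      | add x y hx hy => simp only [map_add, hx, hy]
      | tmul x y => simp [MulOpposite.counit_def, counit_antipodeInv]
    rw [e]
    simp
  exact fun a b hab => by rw [← h a, hab, h b]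

/-- The embedding of `D(A)` into `A* # (A ⊗ Aᵒᵖ)`. -/
def toSmash : HDual k A ⊗[k] A →ₗ[k] SmashProduct k (HDual k A) (A ⊗[k] Aᵐᵒᵖ) :=
  (SmashProduct.ofTensor k _ _).toLinearMap ∘ₗ (twist k A).toLinearMap.lTensor (HDual k A)

lemma toSmash_injective : Function.Injective (toSmash k A) :=
  (SmashProduct.ofTensor k _ _).injective.comp
    (Module.Flat.lTensor_preserves_injective_linearMap _ (twist_injective k A))

lemma toSmash_mulMap (x y : HDual k A ⊗[k] A) :
    toSmash k A (mulMap k A x y) = toSmash k A x * toSmash k A y := by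
  induction x with
  | zero => simp
  | add x y hx hy => simp only [map_add, add_mul, LinearMap.add_apply, hx, hy]
  | tmul p a =>
    induction y with
    | zero => simp
    | add x y hx hy => simp only [map_add, mul_add, hx, hy]
    | tmul q b =>
      have e : toSmash k A (p ⊗ₜ a) * toSmash k A (q ⊗ₜ b) = SmashProduct.ofTensor k _ _
        (SmashProduct.left k _ _ p (SmashProduct.actAux q (twist k A b)
          (comul (R := k) (twist k A a)))) := by
        rw [← SmashProduct.act_tmul]
        rfl
      rw [e, comul_twist, mulMap_tmul, Module.End.mul_apply]
      generalize conj k A a = s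
      induction s with
      | zero => simp
      | add x y hx hy => simp only [map_add, LinearMap.add_apply, hx, hy]
      | tmul u v =>
        rw [pairAct_tmul]
        simp [toSmash, SmashProduct.actAux]

instance : Ring (DrinfeldDouble k A) where
  __ := (inferInstance : AddCommGroup (DrinfeldDouble k A))
  mul x y := ofTensor k A (mulMap k A ((ofTensor k A).symm x) ((ofTensor k A).symm y))
  one := mk 1 1
  mul_assoc x y z := by
    have h : ∀ x y z, mulMap k A (mulMap k A x y) z = mulMap k A x (mulMap k A y z) := by
      intro x y z
      apply toSmash_injective
      simp only [toSmash_mulMap, mul_assoc]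
    exact h x y z
  one_mul x := by
    have h : ∀ x, mulMap k A (1 ⊗ₜ 1) x = x := by
      intro x
      apply toSmash_injective
      rw [toSmash_mulMap]
      have : toSmash k A (1 ⊗ₜ 1) = 1 := by simp [toSmash, SmashProduct.one_def, SmashProduct.mk]
      rw [this, one_mul]
    exact h x
  mul_one x := by
    have h : ∀ x, mulMap k A x (1 ⊗ₜ 1) = x := by
      intro x
      apply toSmash_injective
      rw [toSmash_mulMap]
      have : toSmash k A (1 ⊗ₜ 1) = 1 := by simp [toSmash, SmashProduct.one_def, SmashProduct.mk]
      rw [this, mul_one]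
    exact h x
  left_distrib x y z := map_add (mulMap k A x) y z
  right_distrib x y z := congr($(map_add (mulMap k A) x y) z)
  zero_mul x := congr($(map_zero (mulMap k A)) x)
  mul_zero x := map_zero (mulMap k A x)

instance : Algebra k (DrinfeldDouble k A) := Algebra.ofModule
  (fun r x y => congr($(map_smul (mulMap k A) r x) y))
  (fun r x y => map_smul (mulMap k A x) r y)

variable {k A}

lemma one_def : (1 : DrinfeldDouble k A) = mk 1 1 := rfl

/-- The product of `D(A)`; here `∑ a₁ ⊗ a₂ = ∑ i, rᵢ ⊗ r'ᵢ` and `∑ a₂ ⊗ a₃` is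
expanded further on each `r'ᵢ`. -/
lemma mk_mul_mk {ι κ : Type*} (p q : HDual k A) (a b : A) (r : Coalgebra.Repr k a ι)
    (s : ∀ i, Coalgebra.Repr k (r.right i) κ) :
    mk p a * mk q b = ∑ i ∈ r.index, ∑ j ∈ (s i).index,
      mk (p * HDual.lhit k A (r.left i)
          (HDual.rhit k A (antipodeInv k A ((s i).right j)) q)) ((s i).left j * b) := by
  show ofTensor k A (mulMap k A (p ⊗ₜ a) (q ⊗ₜ b)) = _
  have e : conj k A a = ∑ i ∈ r.index, ∑ j ∈ (s i).index,
      (r.left i ⊗ₜ MulOpposite.op (antipodeInv k A ((s i).right j))) ⊗ₜ[k] (s i).left j := by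
    rw [conj, LinearMap.comp_apply, LinearMap.comp_apply, ← r.eq]
    simp only [map_sum, LinearMap.lTensor_tmul]
    refine Finset.sum_congr rfl fun i _ => ?_
    rw [← (s i).eq]
    simp [tmul_sum]
  rw [mulMap_tmul, e]
  simp [pairAct_tmul, HDual.tmul_smul, mk]

end DrinfeldDouble
end Double

section DoubleBialgebra

variable (k A : Type*) [Field k] [Ring A] [HopfAlgebra k A] [Module.Finite k A]

namespace DrinfeldDouble

lemma toSmash_mk (p : HDual k A) (a : A) :
    toSmash k A (p ⊗ₜ a) = SmashProduct.mk p (twist k A a) := rfl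

lemma mk_mul_mk_one (p : HDual k A) (a b : A) : mk p a * mk 1 b = mk p (a * b) := by
  apply toSmash_injective k A
  refine (toSmash_mulMap k A (p ⊗ₜ a) (1 ⊗ₜ b)).trans ?_
  rw [toSmash_mk, toSmash_mk, SmashProduct.mk_mul_mk_one, ← map_mul]
  rfl

lemma mk_one_mul_mk (p q : HDual k A) (b : A) : mk p 1 * mk q b = mk (p * q) b := by
  apply toSmash_injective k A
  refine (toSmash_mulMap k A (p ⊗ₜ 1) (q ⊗ₜ b)).trans ?_
  rw [toSmash_mk, toSmash_mk, map_one, SmashProduct.mk_one_mul_mk]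
  rfl

/-- The embedding `a ↦ ε ⊗ a` of `A` into `D(A)`. -/
def inclA : A →ₐ[k] DrinfeldDouble k A := AlgHom.ofLinearMap
  ((ofTensor k A).toLinearMap ∘ₗ TensorProduct.mk k (HDual k A) A 1) rfl
  (fun a b => (mk_mul_mk_one k A 1 a b).symm)

/-- The embedding `p ↦ p ⊗ 1` of `A*` into `D(A)`. -/
def inclDual : HDual k A →ₐ[k] DrinfeldDouble k A := AlgHom.ofLinearMap
  ((ofTensor k A).toLinearMap ∘ₗ (TensorProduct.mk k (HDual k A) A).flip 1) rfl
  (fun p q => (mk_one_mul_mk k A p q 1).symm)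

variable {k A}

lemma inclA_apply (a : A) : inclA k A a = mk 1 a := rfl
lemma inclDual_apply (p : HDual k A) : inclDual k A p = mk p 1 := rfl

lemma inclDual_mul_inclA (p : HDual k A) (a : A) : inclDual k A p * inclA k A a = mk p a := by
  rw [inclA_apply, inclDual_apply, mk_mul_mk_one, one_mul]

variable (k A) in
/-- The map `x ⊗ y ↦ (ε ⊗ x)((q ↼ y) ⊗ 1)`. -/
def crossL (q : HDual k A) : A ⊗[k] A →ₗ[k] DrinfeldDouble k A :=
  LinearMap.mul' k _ ∘ₗ map (inclA k A).toLinearMap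
    ((inclDual k A).toLinearMap ∘ₗ (HDual.rhit k A).flip q)

variable (k A) in
/-- The map `x ⊗ y ↦ (x ⇀ q) ⊗ y`. -/
def crossR (q : HDual k A) : A ⊗[k] A →ₗ[k] DrinfeldDouble k A :=
  LinearMap.mul' k _ ∘ₗ map ((inclDual k A).toLinearMap ∘ₗ (HDual.lhit k A).flip q)
    (inclA k A).toLinearMap

@[simp] lemma crossL_tmul (q : HDual k A) (x y : A) :
    crossL k A q (x ⊗ₜ y) = inclA k A x * inclDual k A (HDual.rhit k A y q) := rfl

@[simp] lemma crossR_tmul (q : HDual k A) (x y : A) :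
    crossR k A q (x ⊗ₜ y) = inclDual k A (HDual.lhit k A x q) * inclA k A y := rfl

/-- `∑ (ε ⊗ a₁)((q ↼ a₂) ⊗ 1) = ∑ (a₁ ⇀ q) ⊗ a₂`. -/
lemma crossL_comul (q : HDual k A) (a : A) :
    crossL k A q (comul a) = crossR k A q (comul a) := by
  let N : A ⊗[k] A →ₗ[k] A := LinearMap.mul' k A ∘ₗ (antipodeInv k A).lTensor A ∘ₗ
    (TensorProduct.comm k A A).toLinearMap
  have hN : ∀ z, N (comul z) = algebraMap k A (counit z) := mul_lTensor_antipodeInv_comm_comul k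
  have hN' : ∀ v w, N (v ⊗ₜ w) = w * antipodeInv k A v := fun v w => by simp [N]
  let E : A ⊗[k] (A ⊗[k] A) →ₗ[k] DrinfeldDouble k A := (ofTensor k A).toLinearMap ∘ₗ
    (TensorProduct.lift ((HDual.lhit k A).compl₁₂ LinearMap.id
      ((HDual.rhit k A).flip q))).rTensor A ∘ₗ
    (TensorProduct.assoc k A A A).symm.toLinearMap ∘ₗ
    (TensorProduct.comm k A A).toLinearMap.lTensor A
  have hE : ∀ x u z, E (x ⊗ₜ (u ⊗ₜ z)) = mk (HDual.lhit k A x (HDual.rhit k A z q)) u :=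
    fun x u z => by simp [E, mk]
  clear_value N E
  have e0 : ∀ (x : A) (p : HDual k A), inclA k A x * inclDual k A p
      = ofTensor k A (pairAct k A (conjAux k A (comul.lTensor A (comul x))) (p ⊗ₜ 1)) := by
    intro x p
    show ofTensor k A (mulMap k A (1 ⊗ₜ x) (p ⊗ₜ 1)) = _
    rw [mulMap_tmul, map_one, one_mul]
    rfl
  have e1 : ∀ s : A ⊗[k] A, crossL k A q s = E ((N.lTensor A).lTensor A
      ((TensorProduct.assoc k A A A).toLinearMap.lTensor A
        ((comul.rTensor A).lTensor A (TensorProduct.assoc k A A A (comul.rTensor A s))))) := by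
    intro s
    induction s with
    | zero => simp
    | add x y hx hy => simp only [map_add, hx, hy]
    | tmul x w =>
      rw [crossL_tmul, e0, LinearMap.rTensor_tmul]
      generalize comul (R := k) x = s
      induction s with
      | zero => simp
      | add x y hx hy => simp only [map_add, add_tmul, LinearMap.add_apply, hx, hy]
      | tmul x c =>
        simp only [TensorProduct.assoc_tmul, LinearMap.lTensor_tmul, LinearMap.rTensor_tmul]
        generalize comul (R := k) c = t
        induction t with
        | zero => simp
        | add x y hx hy => simp only [map_add, add_tmul, tmul_add, LinearMap.add_apply, hx, hy]
        | tmul u v =>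
          simp [hE, hN', pairAct_tmul, HDual.tmul_smul, HDual.rhit_rhit, mk]
  have e2 : ∀ s : A ⊗[k] A, crossR k A q s = E ((N.lTensor A).lTensor A
      ((comul.lTensor A).lTensor A (comul.lTensor A s))) := by
    intro s
    induction s with
    | zero => simp
    | add x y hx hy => simp only [map_add, hx, hy]
    | tmul x y =>
      have e3 : (N.lTensor A) ((comul.lTensor A) (comul (R := k) y)) = y ⊗ₜ 1 := by
        have h := congrArg (LinearMap.lTensor A (Algebra.linearMap k A))
          (Coalgebra.lTensor_counit_comul (R := k) y)
        refine Eq.trans ?_ (h.trans (by simp))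
        generalize comul (R := k) y = t
        induction t with
        | zero => simp
        | add x y hx hy => simp only [map_add, hx, hy]
        | tmul u v => simp [hN]
      simp only [LinearMap.lTensor_tmul]
      rw [e3, hE, HDual.rhit_one, crossR_tmul, inclDual_mul_inclA]
  rw [e1, e2, coassoc_apply]
  congr 2
  generalize comul (R := k) a = s
  induction s with
  | zero => simp
  | add x y hx hy => simp only [map_add, hx, hy]
  | tmul x c => simp [coassoc_apply]

variable (k A) in
/-- The map `x ⊗ y ↦ x ⊗ (q ↼ y)`. -/
def shift (q : HDual k A) : A ⊗[k] A →ₗ[k] A ⊗[k] HDual k A :=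
  ((HDual.rhit k A).flip q).lTensor A

/-- Two linear maps on `A ⊗ A*` that agree on all `∑ a₁ ⊗ (q ↼ a₂)` are equal. -/
lemma eq_of_shift {W : Type*} [AddCommGroup W] [Module k W] (X Y : A ⊗[k] HDual k A →ₗ[k] W)
    (h : ∀ a q, X (shift k A q (comul a)) = Y (shift k A q (comul a))) : X = Y := by
  apply TensorProduct.ext'
  intro a q
  let N : A ⊗[k] A →ₗ[k] A := LinearMap.mul' k A ∘ₗ (antipodeInv k A).rTensor A ∘ₗ
    (TensorProduct.comm k A A).toLinearMap
  have hN : ∀ z, N (comul z) = algebraMap k A (counit z) := mul_antipodeInv_comm_comul k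
  have hN' : ∀ v w, N (v ⊗ₜ w) = antipodeInv k A w * v := fun v w => by simp [N]
  clear_value N
  have e1 : ∀ s : A ⊗[k] A,
      (X - Y) (shift k A q (N.lTensor A (TensorProduct.assoc k A A A (comul.rTensor A s)))) = 0 := by
    intro s
    induction s with
    | zero => simp
    | add x y hx hy => simp only [map_add, hx, hy, add_zero]
    | tmul x y =>
      have e : ∀ t : A ⊗[k] A, shift k A q (N.lTensor A (TensorProduct.assoc k A A A (t ⊗ₜ y)))
          = shift k A (HDual.rhit k A (antipodeInv k A y) q) t := by
        intro t
        induction t with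
        | zero => simp
        | add x y hx hy => simp only [map_add, add_tmul, hx, hy]
        | tmul u v => simp [shift, hN', HDual.rhit_rhit]
      rw [LinearMap.rTensor_tmul, e, LinearMap.sub_apply, h, sub_self]
  have e2 := e1 (comul a)
  have e3 : ∀ s : A ⊗[k] A, N.lTensor A (comul.lTensor A s)
      = (Algebra.linearMap k A).lTensor A (counit.lTensor A s) := by
    intro s
    induction s with
    | zero => simp
    | add x y hx hy => simp only [map_add, hx, hy]
    | tmul u v => simp [hN]
  rw [coassoc_apply, e3, Coalgebra.lTensor_counit_comul] at e2
  simpa [shift, HDual.rhit_one, sub_eq_zero] using e2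

/-- A linear map on `D(A)` is multiplicative when it is so on `A`, on `A*`, on products `pa`, and
respects the cross relation. -/
lemma map_mul_of_cross {W : Type*} [Ring W] [Algebra k W] (f : DrinfeldDouble k A →ₗ[k] W)
    (hA : ∀ a b, f (inclA k A (a * b)) = f (inclA k A a) * f (inclA k A b))
    (hP : ∀ p q, f (inclDual k A (p * q)) = f (inclDual k A p) * f (inclDual k A q))
    (hPA : ∀ p a, f (mk p a) = f (inclDual k A p) * f (inclA k A a))
    (hR : ∀ a q, LinearMap.mul' k W (map (f ∘ₗ (inclA k A).toLinearMap)
        (f ∘ₗ (inclDual k A).toLinearMap) (shift k A q (comul a)))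
      = LinearMap.mul' k W (map (f ∘ₗ (inclDual k A).toLinearMap ∘ₗ (HDual.lhit k A).flip q)
        (f ∘ₗ (inclA k A).toLinearMap) (comul a)))
    (x y : DrinfeldDouble k A) : f (x * y) = f x * f y := by
  have key := eq_of_shift (k := k) (A := A)
    (f ∘ₗ LinearMap.mul' k _ ∘ₗ map (inclA k A).toLinearMap (inclDual k A).toLinearMap)
    (LinearMap.mul' k W ∘ₗ map (f ∘ₗ (inclA k A).toLinearMap)
        (f ∘ₗ (inclDual k A).toLinearMap)) (by
      intro a q
      have e1 : ∀ s : A ⊗[k] A, (f ∘ₗ LinearMap.mul' k _ ∘ₗ map (inclA k A).toLinearMap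
          (inclDual k A).toLinearMap) (shift k A q s) = f (crossL k A q s) := by
        intro s
        induction s with
        | zero => simp
        | add x y hx hy => simp only [map_add, hx, hy]
        | tmul u v => simp [shift]
      have e2 : ∀ s : A ⊗[k] A, LinearMap.mul' k W
          (map (f ∘ₗ (inclDual k A).toLinearMap ∘ₗ (HDual.lhit k A).flip q)
          (f ∘ₗ (inclA k A).toLinearMap) s) = f (crossR k A q s) := by
        intro s
        induction s with
        | zero => simp
        | add x y hx hy => simp only [map_add, hx, hy]
        | tmul u v => simp [inclDual_mul_inclA, hPA]
      rw [e1, crossL_comul, LinearMap.comp_apply, hR, e2])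
  have key' : ∀ a q, f (inclA k A a * inclDual k A q) = f (inclA k A a) * f (inclDual k A q) := by
    intro a q
    simpa using congr($key (a ⊗ₜ q))
  have hl : ∀ p z, f (inclDual k A p * z) = f (inclDual k A p) * f z := by
    intro p z
    obtain ⟨z, rfl⟩ := (ofTensor k A).surjective z
    induction z with
    | zero => simp
    | add x y hx hy => simp only [map_add, mul_add, hx, hy]
    | tmul q b =>
      have e : inclDual k A p * mk q b = mk (p * q) b := mk_one_mul_mk k A p q b
      change f (inclDual k A p * mk q b) = f (inclDual k A p) * f (mk q b)
      rw [e, hPA, hP, hPA, mul_assoc]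
  have hr : ∀ z b, f (z * inclA k A b) = f z * f (inclA k A b) := by
    intro z b
    obtain ⟨z, rfl⟩ := (ofTensor k A).surjective z
    induction z with
    | zero => simp
    | add x y hx hy => simp only [map_add, add_mul, hx, hy]
    | tmul q a =>
      have e : mk q a * inclA k A b = mk q (a * b) := mk_mul_mk_one k A q a b
      change f (mk q a * inclA k A b) = f (mk q a) * f (inclA k A b)
      rw [e, hPA, hA, hPA, mul_assoc]
  obtain ⟨x, rfl⟩ := (ofTensor k A).surjective x
  obtain ⟨y, rfl⟩ := (ofTensor k A).surjective y
  induction x with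
  | zero => simp
  | add x y hx hy => simp only [map_add, add_mul, hx, hy]
  | tmul p a =>
    induction y with
    | zero => simp
    | add x y hx hy => simp only [map_add, mul_add, hx, hy]
    | tmul q b =>
      change f (mk p a * mk q b) = f (mk p a) * f (mk q b)
      rw [← inclDual_mul_inclA p a, ← inclDual_mul_inclA q b, mul_assoc, hl,
        ← mul_assoc (inclA k A a), hr, key', hl, hr]
      simp only [mul_assoc]

lemma counit_mk (p : HDual k A) (a : A) :
    counit (R := k) (mk p a) = p 1 * counit (R := k) a := by
  refine (TensorProduct.counit_tmul (R := k) (S := k) (Cop.toCop k _ p) a).trans ?_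
  rw [Cop.counit_toCop, HDual.counit_apply, smul_eq_mul, mul_comm]

lemma comul_mk (p : HDual k A) (a : A) :
    comul (R := k) (mk p a) = map (inclDual k A).toLinearMap (inclDual k A).toLinearMap
      (TensorProduct.comm k _ _ (comul p)) *
        map (inclA k A).toLinearMap (inclA k A).toLinearMap (comul a) := by
  let Φ : (Cop (HDual k A) ⊗[k] Cop (HDual k A)) ⊗[k] (A ⊗[k] A) →ₗ[k]
      DrinfeldDouble k A ⊗[k] DrinfeldDouble k A :=
    (TensorProduct.tensorTensorTensorComm k (Cop (HDual k A)) (Cop (HDual k A)) A A).toLinearMap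
  have hΦ : ∀ (p p' : HDual k A) (a a' : A), Φ ((Cop.toCop k _ p ⊗ₜ Cop.toCop k _ p') ⊗ₜ (a ⊗ₜ a'))
      = mk p a ⊗ₜ mk p' a' := fun _ _ _ _ => rfl
  have h : comul (R := k) (mk p a) = Φ (comul (Cop.toCop k _ p) ⊗ₜ comul a) :=
    TensorProduct.comul_tmul (R := k) (S := k) (Cop.toCop k _ p) a
  rw [h, Cop.comul_toCop]
  clear_value Φ
  generalize comul (R := k) p = s
  generalize comul (R := k) a = t
  induction s with
  | zero => simp
  | add x y hx hy => simp only [map_add, add_mul, add_tmul, hx, hy]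
  | tmul p p' =>
    induction t with
    | zero => simp
    | add x y hx hy => simp only [map_add, mul_add, tmul_add, hx, hy]
    | tmul a a' => simp [inclDual_mul_inclA, hΦ]

lemma comul_inclA (a : A) : comul (R := k) (inclA k A a)
    = map (inclA k A).toLinearMap (inclA k A).toLinearMap (comul a) := by
  have e : map (inclDual k A).toLinearMap (inclDual k A).toLinearMap
      (TensorProduct.comm k _ _ (comul (R := k) 1)) = 1 := by
    rw [Bialgebra.comul_one, Algebra.TensorProduct.one_def]
    simp [Algebra.TensorProduct.one_def]
  rw [inclA_apply, comul_mk, e, one_mul]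

lemma comul_inclDual (p : HDual k A) : comul (R := k) (inclDual k A p)
    = map (inclDual k A).toLinearMap (inclDual k A).toLinearMap
      (TensorProduct.comm k _ _ (comul p)) := by
  have e : map (inclA k A).toLinearMap (inclA k A).toLinearMap (comul (R := k) 1) = 1 := by
    rw [Bialgebra.comul_one, Algebra.TensorProduct.one_def]
    simp [Algebra.TensorProduct.one_def]
  rw [inclDual_apply, comul_mk, e, mul_one]

lemma comul_cross (a : A) (q : HDual k A) :
    LinearMap.mul' k (DrinfeldDouble k A ⊗[k] DrinfeldDouble k A)
        (map (comul ∘ₗ (inclA k A).toLinearMap)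
        (comul ∘ₗ (inclDual k A).toLinearMap) (shift k A q (comul a)))
      = LinearMap.mul' k _ (map (comul ∘ₗ (inclDual k A).toLinearMap ∘ₗ (HDual.lhit k A).flip q)
        (comul ∘ₗ (inclA k A).toLinearMap) (comul a)) := by
  let r := ℛ k q
  let rt := fun x : DrinfeldDouble k A => (LinearMap.mulRight k x) ∘ₗ (inclA k A).toLinearMap
  let lt := fun x : DrinfeldDouble k A => (LinearMap.mulLeft k x) ∘ₗ (inclA k A).toLinearMap
  let G1 : A ⊗[k] (A ⊗[k] A) →ₗ[k] DrinfeldDouble k A ⊗[k] DrinfeldDouble k A :=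
    ∑ i ∈ r.index, map (rt (inclDual k A (r.right i))) (crossL k A (r.left i))
  let G2 : A ⊗[k] (A ⊗[k] A) →ₗ[k] DrinfeldDouble k A ⊗[k] DrinfeldDouble k A :=
    ∑ i ∈ r.index, map (rt (inclDual k A (r.right i))) (crossR k A (r.left i))
  let G3 : (A ⊗[k] A) ⊗[k] A →ₗ[k] DrinfeldDouble k A ⊗[k] DrinfeldDouble k A :=
    ∑ i ∈ r.index, map (crossL k A (r.right i)) (lt (inclDual k A (r.left i)))
  let G4 : (A ⊗[k] A) ⊗[k] A →ₗ[k] DrinfeldDouble k A ⊗[k] DrinfeldDouble k A :=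
    ∑ i ∈ r.index, map (crossR k A (r.right i)) (lt (inclDual k A (r.left i)))
  have h12 : ∀ s : A ⊗[k] A, G1 (comul.lTensor A s) = G2 (comul.lTensor A s) := by
    intro s
    induction s with
    | zero => simp
    | add x y hx hy => simp only [map_add, hx, hy]
    | tmul x y => simp [G1, G2, crossL_comul]
  have h34 : ∀ s : A ⊗[k] A, G3 (comul.rTensor A s) = G4 (comul.rTensor A s) := by
    intro s
    induction s with
    | zero => simp
    | add x y hx hy => simp only [map_add, hx, hy]
    | tmul x y => simp [G3, G4, crossL_comul]
  have h23 : ∀ s : (A ⊗[k] A) ⊗[k] A, G2 (TensorProduct.assoc k A A A s) = G3 s := by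
    intro s
    induction s with
    | zero => simp
    | add x y hx hy => simp only [map_add, hx, hy]
    | tmul x z =>
      induction x with
      | zero => simp
      | add x y hx hy => simp only [map_add, add_tmul, hx, hy]
      | tmul u y =>
        have h := congrArg (fun t => (map (rt 1) (lt 1) (u ⊗ₜ[k] (1 : A))) *
          (map (inclDual k A).toLinearMap (inclDual k A).toLinearMap
            (TensorProduct.comm k _ _ t)) * (1 ⊗ₜ inclA k A z))
          (HDual.lTensor_rhit_comul (k := k) y q)
        rw [← r.eq] at h
        simpa [G2, G3, rt, lt, Finset.mul_sum, Finset.sum_mul] using h.symm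
  have hL : ∀ s : A ⊗[k] A, LinearMap.mul' k (DrinfeldDouble k A ⊗[k] DrinfeldDouble k A)
        (map (comul ∘ₗ (inclA k A).toLinearMap)
        (comul ∘ₗ (inclDual k A).toLinearMap) (shift k A q s))
        = G1 (TensorProduct.assoc k A A A (comul.rTensor A s)) := by
    intro s
    induction s with
    | zero => simp
    | add x y hx hy => simp only [map_add, hx, hy]
    | tmul x y =>
      simp only [shift, LinearMap.lTensor_tmul, map_tmul, LinearMap.mul'_apply,
        LinearMap.comp_apply, AlgHom.toLinearMap_apply, comul_inclA, comul_inclDual,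
        LinearMap.flip_apply, HDual.comul_rhit, LinearMap.rTensor_tmul]
      rw [← r.eq]
      generalize comul (R := k) x = t
      induction t with
      | zero => simp
      | add x y hx hy => simp only [map_add, add_tmul, add_mul, hx, hy]
      | tmul u v => simp [G1, rt, Finset.mul_sum]
  have hR : ∀ s : A ⊗[k] A, LinearMap.mul' k _ (map (comul ∘ₗ (inclDual k A).toLinearMap ∘ₗ
        (HDual.lhit k A).flip q) (comul ∘ₗ (inclA k A).toLinearMap) s)
        = G4 ((TensorProduct.assoc k A A A).symm (comul.lTensor A s)) := by
    intro s
    induction s with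
    | zero => simp
    | add x y hx hy => simp only [map_add, hx, hy]
    | tmul x y =>
      simp only [LinearMap.lTensor_tmul, map_tmul, LinearMap.mul'_apply,
        LinearMap.comp_apply, AlgHom.toLinearMap_apply, comul_inclA, comul_inclDual,
        LinearMap.flip_apply, HDual.comul_lhit]
      rw [← r.eq]
      generalize comul (R := k) y = t
      induction t with
      | zero => simp
      | add x y hx hy => simp only [map_add, tmul_add, mul_add, hx, hy]
      | tmul u v => simp [G4, lt, Finset.sum_mul]
  rw [hL, hR, coassoc_symm_apply, ← h34, ← h23, coassoc_apply, h12]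

lemma comul_mul (x y : DrinfeldDouble k A) :
    comul (R := k) (x * y) = comul (R := k) x * comul (R := k) y := by
  refine map_mul_of_cross (k := k) (A := A) comul ?_ ?_ ?_ ?_ x y
  · intro a b
    have e : map (inclA k A).toLinearMap (inclA k A).toLinearMap
      = (Algebra.TensorProduct.map (inclA k A) (inclA k A)).toLinearMap := rfl
    rw [comul_inclA, comul_inclA, comul_inclA, Bialgebra.comul_mul, e]
    simp only [map_mul, AlgHom.toLinearMap_apply]
  · intro p q
    have e : map (inclDual k A).toLinearMap (inclDual k A).toLinearMap
      = (Algebra.TensorProduct.map (inclDual k A) (inclDual k A)).toLinearMap := rfl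
    have e' : ∀ s, TensorProduct.comm k (HDual k A) (HDual k A) s
      = Algebra.TensorProduct.comm k (HDual k A) (HDual k A) s := fun _ => rfl
    rw [comul_inclDual, comul_inclDual, comul_inclDual, Bialgebra.comul_mul, e]
    simp only [e', map_mul, AlgHom.toLinearMap_apply]
  · intro p a
    rw [comul_mk, comul_inclA, comul_inclDual]
  · exact comul_cross

lemma counit_mul (x y : DrinfeldDouble k A) :
    counit (R := k) (x * y) = counit (R := k) x * counit (R := k) y := by
  have hA : ∀ a, counit (R := k) (inclA k A a) = counit (R := k) a := by
    intro a
    rw [inclA_apply, counit_mk]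
    simp
  have hP : ∀ p, counit (R := k) (inclDual k A p) = p 1 := by
    intro p
    rw [inclDual_apply, counit_mk]
    simp
  refine map_mul_of_cross (k := k) (A := A) counit ?_ ?_ ?_ ?_ x y
  · intro a b
    rw [hA, hA, hA, Bialgebra.counit_mul]
  · intro p q
    rw [hP, hP, hP, ← HDual.counit_apply, ← HDual.counit_apply, ← HDual.counit_apply,
      Bialgebra.counit_mul]
  · intro p a
    rw [counit_mk, hA, hP]
  · intro a q
    have e1 : ∀ s, LinearMap.mul' k k (map (counit ∘ₗ (inclA k A).toLinearMap)
        (counit ∘ₗ (inclDual k A).toLinearMap) (shift k A q s))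
        = q (TensorProduct.lid k A (counit.rTensor A s)) := by
      intro s
      induction s with
      | zero => simp
      | add x y hx hy => simp only [map_add, HDual.map_add_apply, hx, hy]
      | tmul x y => simp [shift, hA, hP]
    have e2 : ∀ s, LinearMap.mul' k k (map (counit ∘ₗ (inclDual k A).toLinearMap ∘ₗ
        (HDual.lhit k A).flip q) (counit ∘ₗ (inclA k A).toLinearMap) s)
        = q (TensorProduct.rid k A (counit.lTensor A s)) := by
      intro s
      induction s with
      | zero => simp
      | add x y hx hy => simp only [map_add, HDual.map_add_apply, hx, hy]
      | tmul x y => simp [hA, hP, mul_comm]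
    rw [e1, e2]
    simp

variable (k A) in
/-- The Drinfeld double as a bialgebra. -/
instance : Bialgebra k (DrinfeldDouble k A) := Bialgebra.mk' k (DrinfeldDouble k A)
  (by rw [one_def, counit_mk]; simp)
  (by intro x y; exact counit_mul x y)
  (by rw [← map_one (inclA k A), comul_inclA, Bialgebra.comul_one,
        Algebra.TensorProduct.one_def]; simp [Algebra.TensorProduct.one_def])
  (by intro x y; exact comul_mul x y)

end DrinfeldDouble
end DoubleBialgebra

section DualActions

variable (k A : Type*) [Field k] [Ring A] [Bialgebra k A]

namespace HDual

/-- The left action `p ⇀ a = ∑ p(a₂) a₁` of `A*` on `A`. -/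
def leftAct : HDual k A →ₐ[k] Module.End k A := AlgHom.ofLinearMap
  { toFun := fun p => (TensorProduct.rid k A).toLinearMap ∘ₗ (toDual k A p).lTensor A ∘ₗ comul
    map_add' := fun p q => by ext; simp
    map_smul' := fun c p => by ext; simp }
  (by
    ext a
    exact (congrArg (TensorProduct.rid k A) (Coalgebra.lTensor_counit_comul (R := k) a)).trans
      (by simp))
  (by
    intro p q
    ext a
    have e1 : ∀ s : A ⊗[k] A, TensorProduct.rid k A ((toDual k A (p * q)).lTensor A s)
        = TensorProduct.rid k A ((LinearMap.mul' k k ∘ₗ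
            map (toDual k A p) (toDual k A q)).lTensor A (comul.lTensor A s)) := by
      intro s
      induction s with
      | zero => simp
      | add x y hx hy => simp only [map_add, hx, hy]
      | tmul x y => simp [toDual_apply, mul_apply]
    have e2 : ∀ s : A ⊗[k] A, TensorProduct.rid k A ((toDual k A p).lTensor A (comul
          (TensorProduct.rid k A ((toDual k A q).lTensor A s))))
        = TensorProduct.rid k A ((LinearMap.mul' k k ∘ₗ
            map (toDual k A p) (toDual k A q)).lTensor A
              (TensorProduct.assoc k A A A (comul.rTensor A s))) := by
      intro s
      induction s with
      | zero => simp
      | add x y hx hy => simp only [map_add, hx, hy]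
      | tmul x y =>
        simp only [LinearMap.lTensor_tmul, LinearMap.rTensor_tmul, TensorProduct.rid_tmul,
          map_smul]
        generalize comul (R := k) x = t
        induction t with
        | zero => simp
        | add x y hx hy => simp only [map_add, add_tmul, smul_add, hx, hy]
        | tmul u v => simp [smul_smul, mul_comm]
    exact (e1 (comul a)).trans ((e2 (comul a)).trans (by rw [coassoc_apply])).symm)

/-- The right action `a ↼ p = ∑ p(a₁) a₂` of `A*` on `A`. -/
def rightAct : (HDual k A)ᵐᵒᵖ →ₐ[k] Module.End k A := AlgHom.ofLinearMap
  { toFun := fun p =>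
      (TensorProduct.lid k A).toLinearMap ∘ₗ (toDual k A p.unop).rTensor A ∘ₗ comul
    map_add' := fun p q => by ext; simp
    map_smul' := fun c p => by ext; simp }
  (by
    ext a
    exact (congrArg (TensorProduct.lid k A) (Coalgebra.rTensor_counit_comul (R := k) a)).trans
      (by simp))
  (by
    intro p q
    ext a
    have e1 : ∀ s : A ⊗[k] A, TensorProduct.lid k A ((toDual k A (q.unop * p.unop)).rTensor A s)
        = TensorProduct.lid k A ((LinearMap.mul' k k ∘ₗ
            map (toDual k A q.unop) (toDual k A p.unop)).rTensor A (comul.rTensor A s)) := by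
      intro s
      induction s with
      | zero => simp
      | add x y hx hy => simp only [map_add, hx, hy]
      | tmul x y => simp [toDual_apply, mul_apply]
    have e2 : ∀ s : A ⊗[k] A, TensorProduct.lid k A ((toDual k A p.unop).rTensor A (comul
          (TensorProduct.lid k A ((toDual k A q.unop).rTensor A s))))
        = TensorProduct.lid k A ((LinearMap.mul' k k ∘ₗ
            map (toDual k A q.unop) (toDual k A p.unop)).rTensor A
              ((TensorProduct.assoc k A A A).symm (comul.lTensor A s))) := by
      intro s
      induction s with
      | zero => simp
      | add x y hx hy => simp only [map_add, hx, hy]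
      | tmul x y =>
        simp only [LinearMap.lTensor_tmul, LinearMap.rTensor_tmul, TensorProduct.lid_tmul,
          map_smul]
        generalize comul (R := k) y = t
        induction t with
        | zero => simp
        | add x y hx hy => simp only [map_add, tmul_add, smul_add, hx, hy]
        | tmul u v => simp [smul_smul]
    exact (e1 (comul a)).trans ((e2 (comul a)).trans (by rw [coassoc_symm_apply])).symm)

variable {k A}

lemma leftAct_apply {ι : Type*} (p : HDual k A) {a : A} (r : Coalgebra.Repr k a ι) :
    leftAct k A p a = ∑ i ∈ r.index, p (r.right i) • r.left i := by
  have : leftAct k A p a = TensorProduct.rid k A ((toDual k A p).lTensor A (comul a)) := rfl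
  rw [this, ← r.eq]
  simp [toDual_apply]

lemma rightAct_apply {ι : Type*} (p : HDual k A) {a : A} (r : Coalgebra.Repr k a ι) :
    rightAct k A (MulOpposite.op p) a = ∑ i ∈ r.index, p (r.left i) • r.right i := by
  have : rightAct k A (MulOpposite.op p) a
    = TensorProduct.lid k A ((toDual k A p).rTensor A (comul a)) := rfl
  rw [this, ← r.eq]
  simp [toDual_apply]

/-- The left and right actions of `A*` on `A` commute. -/
lemma leftAct_rightAct (p : HDual k A) (q : (HDual k A)ᵐᵒᵖ) (a : A) :
    leftAct k A p (rightAct k A q a) = rightAct k A q (leftAct k A p a) := by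
  let F : A ⊗[k] (A ⊗[k] A) →ₗ[k] A := (TensorProduct.lid k A).toLinearMap ∘ₗ
    map (toDual k A q.unop) ((TensorProduct.rid k A).toLinearMap ∘ₗ (toDual k A p).lTensor A)
  have e1 : ∀ s : A ⊗[k] A, TensorProduct.rid k A ((toDual k A p).lTensor A (comul
      (TensorProduct.lid k A ((toDual k A q.unop).rTensor A s)))) = F (comul.lTensor A s) := by
    intro s
    induction s with
    | zero => simp
    | add x y hx hy => simp only [map_add, hx, hy]
    | tmul x y => simp [F]
  have e2 : ∀ s : A ⊗[k] A, TensorProduct.lid k A ((toDual k A q.unop).rTensor A (comul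
      (TensorProduct.rid k A ((toDual k A p).lTensor A s))))
        = F (TensorProduct.assoc k A A A (comul.rTensor A s)) := by
    intro s
    induction s with
    | zero => simp
    | add x y hx hy => simp only [map_add, hx, hy]
    | tmul x y =>
      simp only [LinearMap.lTensor_tmul, LinearMap.rTensor_tmul, TensorProduct.rid_tmul,
          map_smul]
      generalize comul (R := k) x = t
      induction t with
      | zero => simp
      | add x y hx hy => simp only [map_add, add_tmul, smul_add, hx, hy]
      | tmul u v => simp [F, smul_smul, mul_comm]
  exact (e1 (comul a)).trans ((e2 (comul a)).trans (by rw [coassoc_apply])).symm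

instance : Module (HDual k A) A := Module.compHom A (leftAct k A).toRingHom

lemma smul_def (p : HDual k A) (a : A) : p • a = leftAct k A p a := rfl

instance : IsScalarTower k (HDual k A) A where
  smul_assoc c p a := by rw [smul_def, smul_def, map_smul, LinearMap.smul_apply]

variable [Module.Finite k A]

lemma leftAct_mul (p : HDual k A) (a b : A) {ι : Type*} (r : Coalgebra.Repr k p ι) :
    leftAct k A p (a * b)
      = ∑ i ∈ r.index, leftAct k A (r.left i) a * leftAct k A (r.right i) b := by
  have h : ∀ x y : A, p (x * y) = ∑ i ∈ r.index, r.left i x * r.right i y := by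
    intro x y
    rw [← ev₂_comul, ← r.eq]
    simp
  have e : leftAct k A p (a * b) = ∑ i ∈ (ℛ k a).index, ∑ j ∈ (ℛ k b).index,
      p ((ℛ k a).right i * (ℛ k b).right j) • ((ℛ k a).left i * (ℛ k b).left j) := by
    have : leftAct k A p (a * b)
      = TensorProduct.rid k A ((toDual k A p).lTensor A (comul (a * b))) := rfl
    rw [this, Bialgebra.comul_mul, ← (ℛ k a).eq, ← (ℛ k b).eq, Finset.sum_mul_sum]
    simp [toDual_apply]
  rw [e]
  simp only [leftAct_apply _ (ℛ k a), leftAct_apply _ (ℛ k b), Finset.sum_mul_sum, h,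
    Finset.sum_smul, smul_mul_smul_comm]
  symm
  rw [Finset.sum_comm]
  exact Finset.sum_congr rfl fun i _ => Finset.sum_comm

lemma rightAct_mul (p : HDual k A) (a b : A) {ι : Type*} (r : Coalgebra.Repr k p ι) :
    rightAct k A (MulOpposite.op p) (a * b) = ∑ i ∈ r.index,
      rightAct k A (MulOpposite.op (r.left i)) a * rightAct k A (MulOpposite.op (r.right i)) b := by
  have h : ∀ x y : A, p (x * y) = ∑ i ∈ r.index, r.left i x * r.right i y := by
    intro x y
    rw [← ev₂_comul, ← r.eq]
    simp
  have e : rightAct k A (MulOpposite.op p) (a * b) = ∑ i ∈ (ℛ k a).index, ∑ j ∈ (ℛ k b).index,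
      p ((ℛ k a).left i * (ℛ k b).left j) • ((ℛ k a).right i * (ℛ k b).right j) := by
    have : rightAct k A (MulOpposite.op p) (a * b)
      = TensorProduct.lid k A ((toDual k A p).rTensor A (comul (a * b))) := rfl
    rw [this, Bialgebra.comul_mul, ← (ℛ k a).eq, ← (ℛ k b).eq, Finset.sum_mul_sum]
    simp [toDual_apply]
  rw [e]
  simp only [rightAct_apply _ (ℛ k a), rightAct_apply _ (ℛ k b), Finset.sum_mul_sum, h,
    Finset.sum_smul, smul_mul_smul_comm]
  symm
  rw [Finset.sum_comm]
  exact Finset.sum_congr rfl fun i _ => Finset.sum_comm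

lemma leftAct_one (p : HDual k A) : leftAct k A p 1 = algebraMap k A (p 1) := by
  have : leftAct k A p 1 = TensorProduct.rid k A ((toDual k A p).lTensor A (comul 1)) := rfl
  rw [this, Bialgebra.comul_one, Algebra.TensorProduct.one_def]
  simp [toDual_apply, Algebra.algebraMap_eq_smul_one]

lemma rightAct_one (p : HDual k A) :
    rightAct k A (MulOpposite.op p) 1 = algebraMap k A (p 1) := by
  have : rightAct k A (MulOpposite.op p) 1
    = TensorProduct.lid k A ((toDual k A p).rTensor A (comul 1)) := rfl
  rw [this, Bialgebra.comul_one, Algebra.TensorProduct.one_def]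
  simp [toDual_apply, Algebra.algebraMap_eq_smul_one]

lemma lhit_mul (a : A) (p q : HDual k A) {ι : Type*} (r : Coalgebra.Repr k a ι) :
    lhit k A a (p * q) = ∑ i ∈ r.index, lhit k A (r.left i) p * lhit k A (r.right i) q := by
  have e : ∀ (a : A) (p : HDual k A), lhit k A a p = (a ⊗ₜ[k] (1 : Aᵐᵒᵖ)) • p := by
    intro a p
    rw [tmul_smul, MulOpposite.unop_one, rhit_one]
  rw [e, IsModuleAlgebra.smul_mul' (k := k), TensorProduct.comul_tmul, ← r.eq,
    Bialgebra.comul_one, Algebra.TensorProduct.one_def]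
  simp [sum_tmul, ← e]

lemma lhit_one_right (a : A) :
    lhit k A a (1 : HDual k A) = algebraMap k (HDual k A) (counit (R := k) a) := by
  ext x
  simp [Algebra.algebraMap_eq_smul_one, mul_comm]

instance : IsModuleAlgebra k (HDual k A) A where
  smul_one' p := by rw [smul_def, leftAct_one, counit_apply]
  smul_mul' p a b := by
    rw [smul_def, leftAct_mul p a b (ℛ k p)]
    conv_rhs => rw [← (ℛ k p).eq]
    simp [smul_def]

end HDual

end DualActions

section HeisenbergDouble

variable (k A : Type*) [Field k] [Ring A] [HopfAlgebra k A] [Module.Finite k A]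

/-- The Heisenberg double `H(A) = A # A*`, the smash product for the action
`p ⇀ a = ∑ p(a₂) a₁`. -/
abbrev Heisenberg : Type _ := SmashProduct k A (HDual k A)

/-- The bialgebra `A ⊗ A*ᵒᵖ`. -/
abbrev HeisenbergBase : Type _ := A ⊗[k] (HDual k A)ᵐᵒᵖ

namespace Heisenberg

/-- `a ↦ (p ↦ (a ⇀ p))` as an algebra map. -/
def lhitHom : A →ₐ[k] Module.End k (HDual k A) := AlgHom.ofLinearMap (HDual.lhit k A)
  (by ext; simp) (fun a b => by ext; simp [mul_assoc])

/-- The action `(a ⊗ p) • (b # q) = (b ↼ p) # (a ⇀ q)` of `A ⊗ A*ᵒᵖ` on `H(A)`. -/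
def baseRep : HeisenbergBase k A →ₐ[k] Module.End k (Heisenberg k A) :=
  (((SmashProduct.ofTensor k A (HDual k A)).conjAlgEquiv k).toAlgHom.comp
    (Module.endTensorEndAlgHom (R := k) (S := k) (A := k) (M := A) (N := HDual k A))).comp
    ((Algebra.TensorProduct.map (HDual.rightAct k A) (lhitHom k A)).comp
      (Algebra.TensorProduct.comm k A (HDual k A)ᵐᵒᵖ).toAlgHom)

instance : Module (HeisenbergBase k A) (Heisenberg k A) :=
  Module.compHom (Heisenberg k A) (baseRep k A).toRingHom

lemma base_smul_def (x : HeisenbergBase k A) (v : Heisenberg k A) : x • v = baseRep k A x v := rfl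

instance : IsScalarTower k (HeisenbergBase k A) (Heisenberg k A) where
  smul_assoc c x v := by rw [base_smul_def, base_smul_def, map_smul, LinearMap.smul_apply]

variable {k A}

lemma mk_sum_sum {ι κ : Type*} (s : Finset ι) (t : Finset κ) (f : ι → A) (g : κ → HDual k A) :
    (SmashProduct.mk (∑ i ∈ s, f i) (∑ j ∈ t, g j) : Heisenberg k A)
      = ∑ j ∈ t, ∑ i ∈ s, SmashProduct.mk (f i) (g j) := by
  simp only [SmashProduct.mk, sum_tmul, tmul_sum, map_sum]

lemma base_smul_mk (a : A) (p : (HDual k A)ᵐᵒᵖ) (b : A) (q : HDual k A) :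
    (a ⊗ₜ[k] p : HeisenbergBase k A) • (SmashProduct.mk b q : Heisenberg k A)
      = SmashProduct.mk (HDual.rightAct k A p b) (HDual.lhit k A a q) := rfl

instance : IsModuleAlgebra k (HeisenbergBase k A) (Heisenberg k A) where
  smul_one' x := by
    induction x using TensorProduct.induction_on with
    | zero =>
      have e : algebraMap k (Heisenberg k A) (counit (R := k) (0 : HeisenbergBase k A)) = 0 := by
        rw [map_zero, map_zero]
      exact (zero_smul (HeisenbergBase k A) _).trans e.symm
    | add x y hx hy => rw [add_smul, map_add, map_add, hx, hy]
    | tmul a p =>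
      induction p using MulOpposite.rec' with | _ p
      rw [SmashProduct.one_def, base_smul_mk, HDual.rightAct_one, HDual.lhit_one_right]
      rw [Algebra.algebraMap_eq_smul_one, Algebra.algebraMap_eq_smul_one,
        Algebra.algebraMap_eq_smul_one, SmashProduct.one_def, TensorProduct.counit_tmul]
      simp only [SmashProduct.mk, smul_tmul', smul_smul, MulOpposite.counit_def, tmul_smul,
        HDual.counit_apply, LinearMap.comp_apply, LinearEquiv.coe_coe, smul_eq_mul,
        MulOpposite.coe_opLinearEquiv_symm, MulOpposite.unop_op]
      rw [mul_comm, ← smul_tmul', map_smul]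
  smul_mul' x v w := by
    induction x using TensorProduct.induction_on with
    | zero =>
      have e : smulMul k v w (comul (R := k) (0 : HeisenbergBase k A)) = 0 := by
        rw [map_zero, map_zero]
      exact (zero_smul (HeisenbergBase k A) _).trans e.symm
    | add x y hx hy => rw [add_smul, map_add, map_add, hx, hy]
    | tmul a p =>
      induction p using MulOpposite.rec' with | _ p
      have hc : comul (R := k) (a ⊗ₜ[k] MulOpposite.op p : HeisenbergBase k A)
          = ∑ i ∈ (ℛ k a).index, ∑ j ∈ (ℛ k p).index,
            ((ℛ k a).left i ⊗ₜ MulOpposite.op ((ℛ k p).left j)) ⊗ₜ[k]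
            ((ℛ k a).right i ⊗ₜ MulOpposite.op ((ℛ k p).right j)) := by
        rw [TensorProduct.comul_tmul, MulOpposite.comul_def]
        simp only [LinearMap.comp_apply, LinearEquiv.coe_coe, MulOpposite.coe_opLinearEquiv_symm,
          MulOpposite.unop_op]
        conv_lhs => rw [← (ℛ k a).eq, ← (ℛ k p).eq]
        simp only [sum_tmul, tmul_sum, map_sum, map_tmul, LinearEquiv.coe_coe,
          MulOpposite.coe_opLinearEquiv, AlgebraTensorModule.tensorTensorTensorComm_tmul]
        exact Finset.sum_comm
      rw [hc]
      simp only [map_sum, smulMul_tmul]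
      obtain ⟨v, rfl⟩ := (SmashProduct.ofTensor k A (HDual k A)).surjective v
      obtain ⟨w, rfl⟩ := (SmashProduct.ofTensor k A (HDual k A)).surjective w
      induction v using TensorProduct.induction_on with
      | zero => simp
      | add x y hx hy => simp only [map_add, add_mul, smul_add, Finset.sum_add_distrib, hx, hy]
      | tmul b q =>
        induction w using TensorProduct.induction_on with
        | zero => simp
        | add x y hx hy => simp only [map_add, mul_add, smul_add, Finset.sum_add_distrib, hx, hy]
        | tmul b' q' =>
          let r := ℛ k q
          let r' : ∀ c : A, Coalgebra.Repr k (HDual.lhit k A c q) _ := fun c =>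
            { index := r.index
              left := r.left
              right := fun i => HDual.lhit k A c (r.right i)
              eq := by
                rw [HDual.comul_lhit, ← r.eq]
                simp }
          change (a ⊗ₜ[k] MulOpposite.op p : HeisenbergBase k A) •
            ((SmashProduct.mk b q : Heisenberg k A) * SmashProduct.mk b' q') = ∑ i ∈ _, ∑ j ∈ _,
            (_ • (SmashProduct.mk b q : Heisenberg k A)) * (_ • SmashProduct.mk b' q')
          rw [SmashProduct.mk_mul_mk _ _ _ _ r, Finset.smul_sum]
          simp only [base_smul_mk, SmashProduct.mk_mul_mk _ _ _ _ (r' _),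
            HDual.rightAct_mul _ _ _ (ℛ k p), HDual.lhit_mul _ _ _ (ℛ k a)]
          simp only [mk_sum_sum, r', HDual.smul_def, HDual.leftAct_rightAct]
          rw [Finset.sum_comm]
          refine Finset.sum_congr rfl fun i _ => ?_
          rw [Finset.sum_comm]

end Heisenberg
end HeisenbergDouble

section Quasitriangular

variable (k : Type*) {H : Type*} [CommRing k] [Ring H] [Bialgebra k H]

/-- `R` is an `R`-matrix of the bialgebra `H`: it is invertible,
`(Δ ⊗ id)(R) = R₁₃ R₂₃`, `(id ⊗ Δ)(R) = R₁₃ R₁₂`, and `Δ^cop(h) R = R Δ(h)` for all `h`. -/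
structure IsRMatrix (R : H ⊗[k] H) : Prop where
  isUnit : IsUnit R
  comul_rTensor : TensorProduct.assoc k H H H ((comul (R := k)).rTensor H R)
    = Algebra.TensorProduct.map (AlgHom.id k H) Algebra.TensorProduct.includeRight R *
      Algebra.TensorProduct.includeRight (A := H) R
  comul_lTensor : (comul (R := k)).lTensor H R
    = Algebra.TensorProduct.map (AlgHom.id k H) Algebra.TensorProduct.includeRight R *
      Algebra.TensorProduct.map (AlgHom.id k H) Algebra.TensorProduct.includeLeft R
  comm_comul_mul : ∀ h : H, TensorProduct.comm k H H (comul (R := k) h) * R = R * comul h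

/-- A left `H`-module algebra `V` is quantum commutative with respect to `R` if
`v w = ∑ (R² • w)(R¹ • v)` for all `v, w`. -/
def IsQuantumCommutative (R : H ⊗[k] H) (V : Type*) [Ring V] [Algebra k V] [Module H V]
    [IsScalarTower k H V] : Prop :=
  ∀ v w : V, v * w = smulMul k w v (TensorProduct.comm k H H R)

/-- The subspace `R_(l) = {(id ⊗ f)(R) | f ∈ H*}` of `H`. -/
def leftSupport (R : H ⊗[k] H) : Set H :=
  Set.range fun f : Module.Dual k H => TensorProduct.rid k H (f.lTensor H R)

end Quasitriangular

section Groupoid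

/-- A source map `α : B → T` (an algebra map) and a target map `β : B → T` (an algebra
anti-homomorphism) with commuting images. -/
structure SourceTarget (k B T : Type*) [CommRing k] [Ring B] [Algebra k B] [Ring T]
    [Algebra k T] where
  source : B →ₐ[k] T
  target : B →ₐ[k] Tᵐᵒᵖ
  source_mul_target : ∀ b c : B, source b * (target c).unop = (target c).unop * source b

namespace SourceTarget

variable {k B T : Type*} [CommRing k] [Ring B] [Algebra k B] [Ring T] [Algebra k T]
  (σ : SourceTarget k B T)

/-- The target map as a linear map `B → T`. -/
def tgt : B →ₗ[k] T := (MulOpposite.opLinearEquiv k).symm.toLinearMap ∘ₗ σ.target.toLinearMap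

lemma tgt_mul (b c : B) : σ.tgt (b * c) = σ.tgt c * σ.tgt b :=
  congrArg MulOpposite.unop (map_mul σ.target b c)

lemma source_mul_tgt (b c : B) : σ.source b * σ.tgt c = σ.tgt c * σ.source b :=
  σ.source_mul_target b c

/-- The relations `β(b) t ⊗ t' = t ⊗ α(b) t'` that define `T ⊗_B T`, where `T` is a
`B`-bimodule by `b · t = α(b) t` and `t · b = β(b) t`. -/
def relations : Submodule k (T ⊗[k] T) :=
  Submodule.span k (Set.range fun x : B × T × T =>
    (σ.tgt x.1 * x.2.1) ⊗ₜ[k] x.2.2 - x.2.1 ⊗ₜ[k] (σ.source x.1 * x.2.2))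

/-- The tensor product `T ⊗_B T`. -/
abbrev TensorOver : Type _ := (T ⊗[k] T) ⧸ σ.relations

/-- The projection `T ⊗ T → T ⊗_B T`. -/
def proj : T ⊗[k] T →ₗ[k] σ.TensorOver := σ.relations.mkQ

lemma proj_surjective : Function.Surjective σ.proj := Submodule.mkQ_surjective _

lemma proj_tgt_mul (b : B) (t t' : T) :
    σ.proj ((σ.tgt b * t) ⊗ₜ t') = σ.proj (t ⊗ₜ (σ.source b * t')) := by
  refine (Submodule.Quotient.eq _).2 ?_
  exact Submodule.subset_span ⟨(b, t, t'), rfl⟩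

/-- Descent of a linear map on `T ⊗ T` to `T ⊗_B T`. -/
def descend {M : Type*} [AddCommGroup M] [Module k M] (f : T ⊗[k] T →ₗ[k] M)
    (hf : ∀ b t t', f ((σ.tgt b * t) ⊗ₜ t') = f (t ⊗ₜ (σ.source b * t'))) :
    σ.TensorOver →ₗ[k] M :=
  σ.relations.liftQ f (by
    refine Submodule.span_le.2 ?_
    rintro _ ⟨⟨b, t, t'⟩, rfl⟩
    simp [hf])

@[simp] lemma descend_proj {M : Type*} [AddCommGroup M] [Module k M] (f : T ⊗[k] T →ₗ[k] M)
    (hf : ∀ b t t', f ((σ.tgt b * t) ⊗ₜ t') = f (t ⊗ₜ (σ.source b * t'))) (x : T ⊗[k] T) :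
    σ.descend f hf (σ.proj x) = f x := rfl

/-- The left `B`-action `b · (t ⊗ t') = α(b) t ⊗ t'` on `T ⊗_B T`. -/
def leftB (b : B) : σ.TensorOver →ₗ[k] σ.TensorOver :=
  σ.descend (σ.proj ∘ₗ (LinearMap.mulLeft k (σ.source b)).rTensor T) (by
    intro c t t'
    simp only [LinearMap.comp_apply, LinearMap.rTensor_tmul, LinearMap.mulLeft_apply]
    rw [← mul_assoc, source_mul_tgt, mul_assoc, proj_tgt_mul])

/-- The right `B`-action `(t ⊗ t') · b = t ⊗ β(b) t'` on `T ⊗_B T`. -/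
def rightB (b : B) : σ.TensorOver →ₗ[k] σ.TensorOver :=
  σ.descend (σ.proj ∘ₗ (LinearMap.mulLeft k (σ.tgt b)).lTensor T) (by
    intro c t t'
    simp only [LinearMap.comp_apply, LinearMap.lTensor_tmul, LinearMap.mulLeft_apply]
    rw [← mul_assoc, ← source_mul_tgt, mul_assoc, proj_tgt_mul])

/-- Right multiplication of `T ⊗_B T` by `T ⊗ T`: `(t ⊗ t')(s ⊗ s') = ts ⊗ t's'`. -/
def rightMul : σ.TensorOver →ₗ[k] T ⊗[k] T →ₗ[k] σ.TensorOver :=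
  σ.descend ((LinearMap.mul k (T ⊗[k] T)).compr₂ σ.proj) (by
    intro c t t'
    apply TensorProduct.ext'
    intro s s'
    simp only [LinearMap.compr₂_apply, LinearMap.mul_apply',
      Algebra.TensorProduct.tmul_mul_tmul]
    rw [mul_assoc, mul_assoc, proj_tgt_mul])

lemma rightMul_proj (x y : T ⊗[k] T) : σ.rightMul (σ.proj x) y = σ.proj (x * y) := rfl

/-- The relations that define `T ⊗_B T ⊗_B T`. -/
def relations₃ : Submodule k (T ⊗[k] (T ⊗[k] T)) :=
  Submodule.span k
    ((Set.range fun x : B × T × T × T =>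
      (σ.tgt x.1 * x.2.1) ⊗ₜ[k] (x.2.2.1 ⊗ₜ[k] x.2.2.2)
        - x.2.1 ⊗ₜ[k] ((σ.source x.1 * x.2.2.1) ⊗ₜ[k] x.2.2.2)) ∪
    (Set.range fun x : B × T × T × T =>
      x.2.1 ⊗ₜ[k] ((σ.tgt x.1 * x.2.2.1) ⊗ₜ[k] x.2.2.2)
        - x.2.1 ⊗ₜ[k] (x.2.2.1 ⊗ₜ[k] (σ.source x.1 * x.2.2.2))))

/-- The tensor product `T ⊗_B T ⊗_B T`. -/
abbrev TensorOver₃ : Type _ := (T ⊗[k] (T ⊗[k] T)) ⧸ σ.relations₃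

/-- The projection `T ⊗ T ⊗ T → T ⊗_B T ⊗_B T`. -/
def proj₃ : T ⊗[k] (T ⊗[k] T) →ₗ[k] σ.TensorOver₃ := σ.relations₃.mkQ

lemma proj₃_left (b : B) (t t' t'' : T) :
    σ.proj₃ ((σ.tgt b * t) ⊗ₜ (t' ⊗ₜ t'')) = σ.proj₃ (t ⊗ₜ ((σ.source b * t') ⊗ₜ t'')) := by
  refine (Submodule.Quotient.eq _).2 ?_
  exact Submodule.subset_span (Or.inl ⟨(b, t, t', t''), rfl⟩)

lemma proj₃_right (b : B) (t t' t'' : T) :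
    σ.proj₃ (t ⊗ₜ ((σ.tgt b * t') ⊗ₜ t'')) = σ.proj₃ (t ⊗ₜ (t' ⊗ₜ (σ.source b * t''))) := by
  refine (Submodule.Quotient.eq _).2 ?_
  exact Submodule.subset_span (Or.inr ⟨(b, t, t', t''), rfl⟩)

/-- The map `(T ⊗_B T) ⊗ T → T ⊗_B T ⊗_B T`. -/
def assocLeft : σ.TensorOver →ₗ[k] T →ₗ[k] σ.TensorOver₃ :=
  σ.descend (TensorProduct.curry (σ.proj₃ ∘ₗ (TensorProduct.assoc k T T T).toLinearMap)) (by
    intro b t t'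
    ext t''
    simp [proj₃_left])

/-- The map `T ⊗ (T ⊗_B T) → T ⊗_B T ⊗_B T`. -/
def assocRight : σ.TensorOver →ₗ[k] T →ₗ[k] σ.TensorOver₃ :=
  σ.descend ((TensorProduct.mk k T (T ⊗[k] T)).compr₂ σ.proj₃).flip (by
    intro b t t'
    ext t''
    simp [proj₃_right])

lemma assocLeft_rightB (b : B) (u : σ.TensorOver) (t : T) :
    σ.assocLeft (σ.rightB b u) t = σ.assocLeft u (σ.source b * t) := by
  obtain ⟨x, rfl⟩ := σ.proj_surjective u
  induction x with
  | zero => simp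
  | add x y hx hy => simp only [map_add, LinearMap.add_apply, hx, hy]
  | tmul u v => exact σ.proj₃_right b u v t

lemma assocRight_leftB (b : B) (u : σ.TensorOver) (t : T) :
    σ.assocRight u (σ.tgt b * t) = σ.assocRight (σ.leftB b u) t := by
  obtain ⟨x, rfl⟩ := σ.proj_surjective u
  induction x with
  | zero => simp
  | add x y hx hy => simp only [map_add, LinearMap.add_apply, hx, hy]
  | tmul u v => exact σ.proj₃_left b t u v

/-- The map `Δ ⊗_B id : T ⊗_B T → T ⊗_B T ⊗_B T` for a right `B`-linear `Δ`. -/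
def comulTensorId (Δ : T →ₗ[k] σ.TensorOver)
    (hΔ : ∀ b t, Δ (σ.tgt b * t) = σ.rightB b (Δ t)) : σ.TensorOver →ₗ[k] σ.TensorOver₃ :=
  σ.descend (TensorProduct.lift (σ.assocLeft ∘ₗ Δ)) (by
    intro b t t'
    simp only [TensorProduct.lift.tmul, LinearMap.comp_apply, hΔ, assocLeft_rightB])

/-- The map `id ⊗_B Δ : T ⊗_B T → T ⊗_B T ⊗_B T` for a left `B`-linear `Δ`. -/
def idTensorComul (Δ : T →ₗ[k] σ.TensorOver)
    (hΔ : ∀ b t, Δ (σ.source b * t) = σ.leftB b (Δ t)) : σ.TensorOver →ₗ[k] σ.TensorOver₃ :=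
  σ.descend (TensorProduct.lift (σ.assocRight ∘ₗ Δ).flip) (by
    intro b t t'
    simp only [TensorProduct.lift.tmul, LinearMap.comp_apply, LinearMap.flip_apply, hΔ,
      assocRight_leftB])

/-- The map `ε ⊗_B id : T ⊗_B T → T`, `t ⊗ t' ↦ α(ε(t)) t'`, for a right `B`-linear `ε`. -/
def counitTensorId (ε : T →ₗ[k] B) (hε : ∀ b t, ε (σ.tgt b * t) = ε t * b) :
    σ.TensorOver →ₗ[k] T :=
  σ.descend (LinearMap.mul' k T ∘ₗ (σ.source.toLinearMap ∘ₗ ε).rTensor T) (by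
    intro b t t'
    simp [hε, mul_assoc])

/-- The map `id ⊗_B ε : T ⊗_B T → T`, `t ⊗ t' ↦ β(ε(t')) t`, for a left `B`-linear `ε`. -/
def idTensorCounit (ε : T →ₗ[k] B) (hε : ∀ b t, ε (σ.source b * t) = b * ε t) :
    σ.TensorOver →ₗ[k] T :=
  σ.descend (LinearMap.mul' k T ∘ₗ (TensorProduct.comm k T T).toLinearMap ∘ₗ
      (σ.tgt ∘ₗ ε).lTensor T) (by
    intro b t t'
    simp [hε, tgt_mul, mul_assoc])

/-- The map `T ⊗ T ⊗ T → T ⊗_B T`, `t ⊗ t' ⊗ t'' ↦ Δ(t)(t' ⊗ t'')`. Its domain is written as the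
algebra `T ⊗ Tᵒᵖ ⊗ Tᵒᵖ`. -/
def comulMul (Δ : T →ₗ[k] σ.TensorOver) : T ⊗[k] (Tᵐᵒᵖ ⊗[k] Tᵐᵒᵖ) →ₗ[k] σ.TensorOver :=
  TensorProduct.lift ((σ.rightMul ∘ₗ Δ).compl₂
    (map (MulOpposite.opLinearEquiv k).symm.toLinearMap
      (MulOpposite.opLinearEquiv k).symm.toLinearMap))

end SourceTarget

/-- A bialgebroid (in the sense of Lu) with base algebra `B` and total algebra `T`. -/
structure Bialgebroid (k B T : Type*) [CommRing k] [Ring B] [Algebra k B] [Ring T] [Algebra k T]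
    extends SourceTarget k B T where
  /-- the coproduct, a map of `B`-bimodules -/
  comul : T →ₗ[k] toSourceTarget.TensorOver
  comul_source_mul : ∀ b t,
    comul (toSourceTarget.source b * t) = toSourceTarget.leftB b (comul t)
  comul_tgt_mul : ∀ b t,
    comul (toSourceTarget.tgt b * t) = toSourceTarget.rightB b (comul t)
  comul_one : comul 1 = toSourceTarget.proj (1 ⊗ₜ 1)
  coassoc : ∀ t, toSourceTarget.comulTensorId comul comul_tgt_mul (comul t)
    = toSourceTarget.idTensorComul comul comul_source_mul (comul t)
  /-- the kernel of `t ⊗ t' ⊗ t'' ↦ Δ(t)(t' ⊗ t'')` is a left ideal of `T ⊗ Tᵒᵖ ⊗ Tᵒᵖ` -/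
  comul_compat : ∀ z, toSourceTarget.comulMul comul z = 0 →
    ∀ y, toSourceTarget.comulMul comul (y * z) = 0
  /-- the counit, a map of `B`-bimodules -/
  counit : T →ₗ[k] B
  counit_source_mul : ∀ b t, counit (toSourceTarget.source b * t) = b * counit t
  counit_tgt_mul : ∀ b t, counit (toSourceTarget.tgt b * t) = counit t * b
  counit_one : counit 1 = 1
  counit_comul : ∀ t, toSourceTarget.counitTensorId counit counit_tgt_mul (comul t) = t
  comul_counit : ∀ t, toSourceTarget.idTensorCounit counit counit_source_mul (comul t) = t
  /-- the kernel of the counit is a left ideal of `T` -/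
  counit_compat : ∀ t, counit t = 0 → ∀ s, counit (s * t) = 0

/-- A Hopf algebroid (in the sense of Lu, also called a quantum groupoid): a bialgebroid with an
antipode `τ`, an algebra anti-automorphism of `T`. -/
structure HopfAlgebroid (k B T : Type*) [CommRing k] [Ring B] [Algebra k B] [Ring T] [Algebra k T]
    extends Bialgebroid k B T where
  antipode : T ≃ₐ[k] Tᵐᵒᵖ
  antipode_tgt : ∀ b, (antipode (toSourceTarget.tgt b)).unop = toSourceTarget.source b
  /-- `m (τ ⊗ id) Δ = β ε τ` -/
  antipode_mul : ∀ t, toSourceTarget.descend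
    (LinearMap.mul' k T ∘ₗ ((MulOpposite.opLinearEquiv k).symm.toLinearMap ∘ₗ
      antipode.toLinearMap).rTensor T)
    (by
      intro b t t'
      simp [antipode_tgt, mul_assoc])
    (comul t) = toSourceTarget.tgt (counit (antipode t).unop)
  /-- there is a linear section `γ` of `T ⊗ T → T ⊗_B T` with `m (id ⊗ τ) γ Δ = α ε` -/
  exists_section : ∃ γ : toSourceTarget.TensorOver →ₗ[k] T ⊗[k] T,
    (∀ x, toSourceTarget.proj (γ x) = x) ∧
    ∀ t, LinearMap.mul' k T (((MulOpposite.opLinearEquiv k).symm.toLinearMap ∘ₗ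
      antipode.toLinearMap).lTensor T (γ (comul t))) = toSourceTarget.source (counit t)

end Groupoid

section Main

variable (k A : Type*) [Field k] [Ring A] [HopfAlgebra k A] [Module.Finite k A]

/-- The bialgebra `D(A)^{op cop}`. -/
abbrev DoubleOpCop : Type _ := Cop (DrinfeldDouble k A)ᵐᵒᵖ

/-- The identity map `D(A) → D(A)^{op cop}`. -/
def toOpCop : DrinfeldDouble k A ≃ₗ[k] DoubleOpCop k A :=
  (MulOpposite.opLinearEquiv k).trans (Cop.toCop k (DrinfeldDouble k A)ᵐᵒᵖ)

/-- The bialgebra `D(A) ⊗ D(A)^{op cop}`. -/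
abbrev DoubleEnvelope : Type _ := DrinfeldDouble k A ⊗[k] DoubleOpCop k A

/-- The `R`-matrix `R = ∑ (ε ⊗ eᵢ) ⊗ (eⁱ ⊗ 1)` of `D(A)`, where `(eᵢ)` is a basis of `A` and `(eⁱ)`
is the dual basis of `A*`. -/
def DrinfeldDouble.rMatrix : DrinfeldDouble k A ⊗[k] DrinfeldDouble k A :=
  ∑ i, DrinfeldDouble.mk 1 (Module.finBasis k A i) ⊗ₜ
    DrinfeldDouble.mk ((HDual.toDual k A).symm ((Module.finBasis k A).coord i)) 1

/-- The element `∑ (R¹ ⊗ U²) ⊗ (R² ⊗ U¹)`, where `U = R⁻¹`. -/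
def DoubleEnvelope.rMatrix : DoubleEnvelope k A ⊗[k] DoubleEnvelope k A :=
  TensorProduct.tensorTensorTensorComm k _ _ _ _
    (DrinfeldDouble.rMatrix k A ⊗ₜ
      map (toOpCop k A).toLinearMap (toOpCop k A).toLinearMap
        (TensorProduct.comm k _ _ (Ring.inverse (DrinfeldDouble.rMatrix k A))))

namespace Heisenberg

/-- The identification of `H(A)` with the dual of `D(A)`:
`⟨a # f, p ⊗ x⟩ = p(a) f(x)`. -/
def toDoubleDual : Heisenberg k A ≃ₗ[k] Module.Dual k (DrinfeldDouble k A) :=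
  (SmashProduct.ofTensor k A (HDual k A)).symm.trans
    ((TensorProduct.congr ((Module.evalEquiv k A).trans (HDual.toDual k A).dualMap)
      (HDual.toDual k A)).trans
    ((dualDistribEquiv k (HDual k A) A).trans (DrinfeldDouble.ofTensor k A).symm.dualMap))

lemma toDoubleDual_mk (a : A) (f p : HDual k A) (x : A) :
    toDoubleDual k A (SmashProduct.mk a f) (DrinfeldDouble.mk p x) = p a * f x := rfl

/-- The left and right regular actions of `D(A)` on its dual, transported to `H(A)`:
`⟨(h ⊗ h') • φ, x⟩ = ⟨φ, h' x h⟩`. -/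
def envelopeRep : DoubleEnvelope k A →ₐ[k] Module.End k (Heisenberg k A) :=
  (((toDoubleDual k A).symm.conjAlgEquiv k).toAlgHom.comp
    (regularRep k (DrinfeldDouble k A))).comp
    (Algebra.TensorProduct.map (AlgHom.id k (DrinfeldDouble k A))
      (AlgHom.ofLinearMap (Cop.toCop k (DrinfeldDouble k A)ᵐᵒᵖ).symm.toLinearMap rfl
        (fun _ _ => rfl)))

instance : Module (DoubleEnvelope k A) (Heisenberg k A) :=
  Module.compHom (Heisenberg k A) (envelopeRep k A).toRingHom

lemma envelope_smul_def (x : DoubleEnvelope k A) (v : Heisenberg k A) :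
    x • v = envelopeRep k A x v := rfl

instance : IsScalarTower k (DoubleEnvelope k A) (Heisenberg k A) where
  smul_assoc c x v := by
    rw [envelope_smul_def, envelope_smul_def, map_smul, LinearMap.smul_apply]

lemma toDoubleDual_smul (h h' : DrinfeldDouble k A) (v : Heisenberg k A)
    (x : DrinfeldDouble k A) :
    toDoubleDual k A ((h ⊗ₜ[k] toOpCop k A h' : DoubleEnvelope k A) • v) x
      = toDoubleDual k A v (h' * x * h) := by
  have e : (h ⊗ₜ[k] toOpCop k A h' : DoubleEnvelope k A) • v = (toDoubleDual k A).symm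
      (regularRep k (DrinfeldDouble k A) (h ⊗ₜ MulOpposite.op h') (toDoubleDual k A v)) := rfl
  rw [e, LinearEquiv.apply_symm_apply, regularRep_tmul, MulOpposite.unop_op]

end Heisenberg

/-- The embedding `a ⊗ p ↦ (ε ⊗ a) ⊗ (p ⊗ 1)` of the algebra `A ⊗ A*ᵒᵖ` into
`D(A) ⊗ D(A)^{op cop}`. -/
def HeisenbergBase.incl : HeisenbergBase k A →ₐ[k] DoubleEnvelope k A :=
  Algebra.TensorProduct.map (DrinfeldDouble.inclA k A)
    ((AlgHom.ofLinearMap (Cop.toCop k (DrinfeldDouble k A)ᵐᵒᵖ).toLinearMap rfl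
      (fun _ _ => rfl)).comp (DrinfeldDouble.inclDual k A).op)

lemma HeisenbergBase.incl_tmul (a : A) (p : HDual k A) :
    HeisenbergBase.incl k A (a ⊗ₜ MulOpposite.op p)
      = DrinfeldDouble.mk 1 a ⊗ₜ toOpCop k A (DrinfeldDouble.mk p 1) := rfl

/-- The inverse `a ⊗ p ↦ S⁻¹(a) ⊗ (p ∘ S)` of the antipode of `A ⊗ A*ᵒᵖ`. -/
def HeisenbergBase.antipodeInv : HeisenbergBase k A →ₗ[k] HeisenbergBase k A :=
  map (HopfDouble.antipodeInv k A) ((MulOpposite.opLinearEquiv k).toLinearMap ∘ₗ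
    (HDual.toDual k A).symm.toLinearMap ∘ₗ (HopfAlgebra.antipode k (A := A)).dualMap ∘ₗ
    (HDual.toDual k A).toLinearMap ∘ₗ (MulOpposite.opLinearEquiv k).symm.toLinearMap)

/-- The algebra `H(A) # (A ⊗ A*ᵒᵖ)`. -/
abbrev HeisenbergGroupoid : Type _ := SmashProduct k (Heisenberg k A) (HeisenbergBase k A)

end Main

end HopfDouble

end

open HopfDouble

/-! The Hopf algebroid comes from a general construction. Let a bialgebra `L` act on an algebra `V`,
put `T = V # L` and `α(v) = v # 1`, and let `β(v) = ∑ v₀ # v₁` be a candidate target map.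
`IsBraidedTarget` collects what `β` has to satisfy: it is an antihomomorphism commuting with `α`, it
is compatible with `L`, and `v ↦ ∑ v₀ ⊗ v₁` is a coaction. From these conditions alone one gets a
bialgebroid (`IsBraidedTarget.bialgebroid`). The coproduct lifts to an algebra map `comulHom : T → T
⊗ T`, and left multiplication by `Δ(t)` preserves the relations `β(b)t ⊗ t' = t ⊗ α(b)t'`
(`proj_comulHom_mul`); this gives Lu's left ideal condition. If `L` is a Hopf algebra and everything
is finite-dimensional, then `v # l ↦ S⁻¹(l)β(v)` is a bijective antihomomorphism, and its inverse is
the antipode (`IsBraidedTarget.hopfAlgebroid`).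

Such a `β` arises from an `R`-matrix. If `V` is quantum commutative over `(H, R)`, then `β(v) = ∑
R²v # R¹` satisfies all the conditions for `V # H` (`isBraidedTarget_targetOf`), each condition
reflecting one or two identities of `R`. If the first legs of `R` lie in a sub-bialgebra `L` of `H`,
the same formula lands in `V # L` and the conditions are inherited
(`isBraidedTarget_targetOf_of_injective`). The theorem is the case `V = H(A)`, `H = D(A) ⊗ D(A)^{op
cop}`, `L = A ⊗ A*ᵒᵖ`.

It remains to supply the `R`-matrix and quantum commutativity. Under `A ⊗ A* ≅ Hom(A, A)` with the
convolution product, the canonical element `∑ eᵢ ⊗ eⁱ` is the identity map. Hence its inverse comes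
from the antipode and its behaviour under both coproducts is immediate. Its commutation with
coproducts in `D(A)` is the cross relation `crossL_comul`. So `R` is an `R`-matrix; the flip of
`R⁻¹` is one for the op-cop (`IsRMatrix.opCop`), and tensor products of `R`-matrices are
`R`-matrices (`IsRMatrix.tensor`), which gives the `R`-matrix of `D(A) ⊗ D(A)^{op cop}`.

The link with the Heisenberg double is `Heisenberg.toDoubleDual_mul`: as a product on `D(A)*`, the
product of `H(A)` is dual to the twisted coproduct, `⟨vw, z⟩ = ⟨v ⊗ w, R Δ(z)⟩`. With this formula
both the module algebra axiom and quantum commutativity reduce to `Δ^cop(h) R = R Δ(h)`. -/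

noncomputable section

namespace HopfDouble

open TensorProduct Coalgebra Bialgebra HopfAlgebra WithConv

/-! ### Algebra maps out of a smash product; its coproduct, coaction and counit. -/

namespace SmashProduct

section Lift

variable {k V H : Type*} [CommRing k] [Ring H] [Ring V] [Algebra k V]
  [Bialgebra k H] [Module H V] [IsScalarTower k H V] [IsModuleAlgebra k H V]

/-- Two linear maps on a smash product that agree on all `v # h` are equal. -/
lemma hom_ext {W : Type*} [AddCommMonoid W] [Module k W] {f g : SmashProduct k V H →ₗ[k] W}
    (h : ∀ v x, f (mk v x) = g (mk v x)) : f = g := by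
  apply LinearMap.ext
  intro x
  obtain ⟨x, rfl⟩ := (ofTensor k V H).surjective x
  induction x with
  | zero => simp
  | add x y hx hy => simp only [map_add, hx, hy]
  | tmul v y => exact h v y

variable (k V H) in
/-- The embedding `v ↦ v # 1`. -/
def inclLeft : V →ₐ[k] SmashProduct k V H := AlgHom.ofLinearMap
  ((ofTensor k V H).toLinearMap ∘ₗ (TensorProduct.mk k V H).flip 1) rfl
  (fun v w => (mk_one_mul_mk v w 1).symm)

variable (k V H) in
/-- The embedding `h ↦ 1 # h`. -/
def inclRight : H →ₐ[k] SmashProduct k V H := AlgHom.ofLinearMap (mkHom 1) rfl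
  (fun h g => (mk_mul_mk_one 1 h g).symm)

lemma inclLeft_apply (v : V) : inclLeft k V H v = mk v 1 := rfl
lemma inclRight_apply (h : H) : inclRight k V H h = mk 1 h := rfl

lemma inclLeft_mul_inclRight (v : V) (h : H) :
    inclLeft k V H v * inclRight k V H h = mk v h := by
  rw [inclLeft_apply, inclRight_apply, mk_one_mul_mk, mul_one]

lemma mkHom_eq (v : V) :
    (mkHom v : H →ₗ[k] SmashProduct k V H)
      = LinearMap.mulLeft k (inclLeft k V H v) ∘ₗ (inclRight k V H).toLinearMap := by
  ext h
  exact (inclLeft_mul_inclRight v h).symm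

/-- The straightening rule: together with the products inside `V` and inside `H` it determines the
product of `V # H`. It is the form in which later computations move elements of `H` past elements of
`V`. -/
lemma inclRight_mul_inclLeft (h : H) (v : V) :
    inclRight k V H h * inclLeft k V H v = LinearMap.mul' k _
      (map ((inclLeft k V H).toLinearMap ∘ₗ smulAt k v) (inclRight k V H).toLinearMap
        (comul h)) := by
  rw [inclLeft_apply, inclRight_apply, mk_mul_mk _ _ _ _ (ℛ k h), ← (ℛ k h).eq]
  simp [inclLeft_mul_inclRight]

/-- The algebra map on a smash product `V # H` given by a covariant pair of algebra maps on `V`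
and `H`. -/
def lift {W : Type*} [Ring W] [Algebra k W] (f : V →ₐ[k] W) (g : H →ₐ[k] W)
    (hfg : ∀ h v, g h * f v
      = LinearMap.mul' k W (map (f.toLinearMap ∘ₗ smulAt k v) g.toLinearMap (comul h))) :
    SmashProduct k V H →ₐ[k] W :=
  AlgHom.ofLinearMap (LinearMap.mul' k W ∘ₗ map f.toLinearMap g.toLinearMap ∘ₗ
      (ofTensor k V H).symm.toLinearMap)
    (by
      have : (ofTensor k V H).symm 1 = 1 ⊗ₜ 1 := rfl
      simp [this])
    (by
      set F := LinearMap.mul' k W ∘ₗ map f.toLinearMap g.toLinearMap ∘ₗ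
        (ofTensor k V H).symm.toLinearMap with hF
      have hF' : ∀ v h, F (mk v h) = f v * g h := fun v h => by simp [hF, mk]
      clear_value F
      have key : (LinearMap.mul k (SmashProduct k V H)).compr₂ F
          = (LinearMap.mul k W).compl₁₂ F F := by
        refine hom_ext fun v h => hom_ext fun w y => ?_
        simp only [LinearMap.compr₂_apply, LinearMap.mul_apply', LinearMap.compl₁₂_apply]
        -- Only the inner factor `g h * f w` is out of order, and covariance straightens it exactly
        -- as in `V # H`.
        have e : f v * g h * (f w * g y) = f v * (g h * f w) * g y := by simp only [mul_assoc]
        rw [mk_mul_mk _ _ _ _ (ℛ k h), hF', hF', e, hfg, ← (ℛ k h).eq]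
        simp [hF', Finset.mul_sum, Finset.sum_mul, mul_assoc]
      exact fun x y => congr($key x y))

@[simp] lemma lift_mk {W : Type*} [Ring W] [Algebra k W] (f : V →ₐ[k] W) (g : H →ₐ[k] W)
    (hfg : ∀ h v, g h * f v
      = LinearMap.mul' k W (map (f.toLinearMap ∘ₗ smulAt k v) g.toLinearMap (comul h)))
    (v : V) (h : H) : lift f g hfg (mk v h) = f v * g h := by
  simp [lift, mk]

variable (k V H) in
/-- The algebra map `V # H → (V # H) ⊗ (V # H)`, `v # h ↦ ∑ (v # h₁) ⊗ (1 # h₂)`. -/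
def comulHom : SmashProduct k V H →ₐ[k] SmashProduct k V H ⊗[k] SmashProduct k V H :=
  lift (Algebra.TensorProduct.includeLeft.comp (inclLeft k V H))
    ((Algebra.TensorProduct.map (inclRight k V H) (inclRight k V H)).comp (comulAlgHom k H))
    (by
      intro h v
      let G : H ⊗[k] (H ⊗[k] H) →ₗ[k] SmashProduct k V H ⊗[k] SmashProduct k V H :=
        map (LinearMap.mul' k _ ∘ₗ
          map ((inclLeft k V H).toLinearMap ∘ₗ smulAt k v) (inclRight k V H).toLinearMap)
          (inclRight k V H).toLinearMap ∘ₗ (TensorProduct.assoc k H H H).symm.toLinearMap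
      have hG : ∀ x y z, G (x ⊗ₜ (y ⊗ₜ z))
          = (inclLeft k V H (x • v) * inclRight k V H y) ⊗ₜ inclRight k V H z :=
        fun x y z => by simp [G]
      -- Covariance: both sides equal `∑ (h₁v)h₂ ⊗ h₃`, one through `(Δ ⊗ id)Δ` and the other
      -- through `(id ⊗ Δ)Δ`.
      have e1 : ∀ s : H ⊗[k] H,
          map (inclRight k V H).toLinearMap (inclRight k V H).toLinearMap s *
            (inclLeft k V H v ⊗ₜ 1) = G (TensorProduct.assoc k H H H (comul.rTensor H s)) := by
        intro s
        induction s with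
        | zero => simp
        | add x y hx hy => simp only [map_add, add_mul, hx, hy]
        | tmul x y => simp [G, inclRight_mul_inclLeft]
      have e2 : ∀ s : H ⊗[k] H, LinearMap.mul' k _ (map
          ((Algebra.TensorProduct.includeLeft.comp (inclLeft k V H)).toLinearMap ∘ₗ smulAt k v)
          ((Algebra.TensorProduct.map (inclRight k V H) (inclRight k V H)).comp
            (comulAlgHom k H)).toLinearMap s) = G (comul.lTensor H s) := by
        intro s
        induction s with
        | zero => simp
        | add x y hx hy => simp only [map_add, hx, hy]
        | tmul x y =>
          simp only [map_tmul, LinearMap.mul'_apply, LinearMap.comp_apply, smulAt_apply,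
            AlgHom.toLinearMap_apply, AlgHom.comp_apply, comulAlgHom_apply,
            LinearMap.lTensor_tmul, Algebra.TensorProduct.includeLeft_apply]
          generalize comul (R := k) y = t
          induction t with
          | zero => simp
          | add x y hx hy => simp only [map_add, tmul_add, mul_add, hx, hy]
          | tmul u w => simp [hG]
      rw [e2, ← coassoc_apply, ← e1]
      rfl)

lemma comulHom_mk (v : V) (h : H) : comulHom k V H (mk v h)
    = map (mkHom v) (mkHom 1) (comul h) := by
  rw [comulHom, lift_mk]
  have : (mkHom v : H →ₗ[k] SmashProduct k V H)
    = LinearMap.mulLeft k (inclLeft k V H v) ∘ₗ (inclRight k V H).toLinearMap := mkHom_eq v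
  rw [this]
  simp only [AlgHom.comp_apply, comulAlgHom_apply]
  generalize comul (R := k) h = t
  induction t with
  | zero => simp
  | add x y hx hy => simp only [map_add, mul_add, hx, hy]
  | tmul u w => simp [inclRight_apply, mkHom_apply]

variable (k V H) in
/-- The coaction `v # h ↦ ∑ (v # h₁) ⊗ h₂` of `H` on `V # H`. -/
def coaction : SmashProduct k V H →ₗ[k] SmashProduct k V H ⊗[k] H :=
  (ofTensor k V H).toLinearMap.rTensor H ∘ₗ (TensorProduct.assoc k V H H).symm.toLinearMap ∘ₗ
    (comul (R := k)).lTensor V ∘ₗ (ofTensor k V H).symm.toLinearMap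

lemma coaction_mk (v : V) (h : H) :
    coaction k V H (mk v h) = (mkHom v).rTensor H (comul (R := k) h) := by
  simp only [coaction, mk, LinearMap.comp_apply, LinearEquiv.coe_coe,
    LinearEquiv.symm_apply_apply, LinearMap.lTensor_tmul]
  generalize comul (R := k) h = t
  induction t with
  | zero => simp
  | add x y hx hy => simp only [map_add, tmul_add, hx, hy]
  | tmul u w => simp [mkHom_apply, mk]

/-- The second leg of the lifted coproduct always lies in `H`, and `coaction` remembers this. Axioms
stated for the coaction are turned into formulas for the coproduct here. -/
lemma lTensor_coaction (t : SmashProduct k V H) :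
    (inclRight k V H).toLinearMap.lTensor _ (coaction k V H t) = comulHom k V H t := by
  have : (inclRight k V H).toLinearMap.lTensor _ ∘ₗ coaction k V H
      = (comulHom k V H).toLinearMap := by
    refine hom_ext fun v h => ?_
    simp only [LinearMap.comp_apply, AlgHom.toLinearMap_apply, coaction_mk, comulHom_mk]
    exact congr($(LinearMap.lTensor_comp_rTensor _ _ _) _)
  exact congr($this t)

variable (k V H) in
/-- The map `v # h ↦ ε(h) v`. -/
def counitMap : SmashProduct k V H →ₗ[k] V :=
  (TensorProduct.rid k V).toLinearMap ∘ₗ (counit (R := k)).lTensor V ∘ₗ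
    (ofTensor k V H).symm.toLinearMap

@[simp] lemma counitMap_mk (v : V) (h : H) :
    counitMap k V H (mk v h) = counit (R := k) h • v := by
  simp [counitMap, mk]

lemma counitMap_inclLeft_mul (v : V) (t : SmashProduct k V H) :
    counitMap k V H (inclLeft k V H v * t) = v * counitMap k V H t := by
  have : counitMap k V H ∘ₗ LinearMap.mulLeft k (inclLeft k V H v)
      = LinearMap.mulLeft k v ∘ₗ counitMap k V H := by
    refine hom_ext fun w h => ?_
    simp [inclLeft_apply, mk_one_mul_mk]
  exact congr($this t)

lemma counitMap_mul_inclRight (t : SmashProduct k V H) (h : H) :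
    counitMap k V H (t * inclRight k V H h) = counit (R := k) h • counitMap k V H t := by
  have : counitMap k V H ∘ₗ LinearMap.mulRight k (inclRight k V H h)
      = counit (R := k) h • counitMap k V H := by
    refine hom_ext fun w g => ?_
    simp [inclRight_apply, mk_mul_mk_one, smul_smul, mul_comm]
  exact congr($this t)

/-- A right factor from `H` contributes only its counit, so inside `ε(s t)` the element `t` may be
replaced by `ε(t)`. In particular the kernel of the counit is a left ideal. -/
lemma counitMap_mul (s t : SmashProduct k V H) :
    counitMap k V H (s * t) = counitMap k V H (s * inclLeft k V H (counitMap k V H t)) := by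
  have : counitMap k V H ∘ₗ LinearMap.mulLeft k s
      = counitMap k V H ∘ₗ LinearMap.mulLeft k s ∘ₗ (inclLeft k V H).toLinearMap ∘ₗ
        counitMap k V H := by
    refine hom_ext fun w g => ?_
    simp only [LinearMap.comp_apply, LinearMap.mulLeft_apply, counitMap_mk, map_smul,
      AlgHom.toLinearMap_apply]
    rw [← inclLeft_mul_inclRight, ← mul_assoc, counitMap_mul_inclRight]
  exact congr($this t)

end Lift

end SmashProduct

/-! ### The relations of `T ⊗_B T`, and Lu's left ideal condition. -/

namespace SourceTarget

variable {k B T : Type*} [CommRing k] [Ring B] [Algebra k B] [Ring T] [Algebra k T]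
  (σ : SourceTarget k B T)

@[simp] lemma tgt_one : σ.tgt 1 = 1 := congrArg MulOpposite.unop (map_one σ.target)

/-- The relations multiply by `α` and `β` from the left only, so they are stable under right
multiplication. They are not a left ideal in general; this is why left multiplications need a
separate criterion. -/
lemma mul_mem_relations {x : T ⊗[k] T} (hx : x ∈ σ.relations) (y : T ⊗[k] T) :
    x * y ∈ σ.relations := by
  have h : σ.relations ≤ σ.relations.comap (LinearMap.mulRight k y) := by
    refine Submodule.span_le.2 ?_
    rintro _ ⟨⟨b, t, t'⟩, rfl⟩
    induction y with
    | zero => simp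
    | add y z hy hz =>
      simp only [SetLike.mem_coe, Submodule.mem_comap, LinearMap.mulRight_apply] at hy hz ⊢
      rw [mul_add]
      exact add_mem hy hz
    | tmul s s' =>
      refine Submodule.subset_span ⟨(b, t * s, t' * s'), ?_⟩
      simp [sub_mul, mul_assoc]
  exact h hx

lemma proj_eq_zero {x : T ⊗[k] T} : σ.proj x = 0 ↔ x ∈ σ.relations :=
  Submodule.Quotient.mk_eq_zero _

lemma proj_mul_congr {x x' : T ⊗[k] T} (h : σ.proj x = σ.proj x') (y : T ⊗[k] T) :
    σ.proj (x * y) = σ.proj (x' * y) := by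
  rw [← sub_eq_zero, ← map_sub, proj_eq_zero] at h ⊢
  rw [← sub_mul]
  exact σ.mul_mem_relations h y

/-- Left multiplication by `x` descends to `T ⊗_B T` if it equalizes `β(b) ⊗ 1` and
`1 ⊗ α(b)`. -/
lemma mul_mem_relations_left {x : T ⊗[k] T}
    (hx : ∀ b, σ.proj (x * (σ.tgt b ⊗ₜ 1)) = σ.proj (x * (1 ⊗ₜ σ.source b)))
    {y : T ⊗[k] T} (hy : y ∈ σ.relations) : x * y ∈ σ.relations := by
  have h : σ.relations ≤ σ.relations.comap (LinearMap.mulLeft k x) := by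
    refine Submodule.span_le.2 ?_
    rintro _ ⟨⟨b, t, t'⟩, rfl⟩
    -- A generator is `(β(b) ⊗ 1 - 1 ⊗ α(b))(t ⊗ t')`; the hypothesis treats the first factor, and
    -- right multiplication by the second is harmless.
    have := σ.proj_mul_congr (hx b) (t ⊗ₜ t')
    rw [mul_assoc, mul_assoc, ← sub_eq_zero, ← map_sub, proj_eq_zero, ← mul_sub] at this
    simpa using this
  exact h hy

/-- Write `W(t ⊗ x) = D(t) U(x)`. As `D` is multiplicative and `U` antimultiplicative, `W((s ⊗ x) z)
= D(s) W(z) U(x)`: the left factor preserves the relations by hypothesis, the right factor always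
does. The application has `P = Tᵒᵖ ⊗ Tᵒᵖ`, with `U` the passage back to `T ⊗ T`. -/
lemma mul_mem_relations_of_antihom {P : Type*} [Ring P] [Algebra k P] (D : T →ₐ[k] T ⊗[k] T)
    (hD : ∀ t, ∀ x ∈ σ.relations, D t * x ∈ σ.relations)
    (U : P →ₗ[k] T ⊗[k] T) (hU : ∀ x y, U (x * y) = U y * U x) (z : T ⊗[k] P)
    (hz : LinearMap.mul' k _ (map D.toLinearMap U z) ∈ σ.relations) (y : T ⊗[k] P) :
    LinearMap.mul' k _ (map D.toLinearMap U (y * z)) ∈ σ.relations := by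
  have hW : ∀ s x z, LinearMap.mul' k _ (map D.toLinearMap U ((s ⊗ₜ x) * z))
      = D s * LinearMap.mul' k _ (map D.toLinearMap U z) * U x := by
    intro s x z
    induction z with
    | zero => simp
    | add x y hx hy => simp only [map_add, mul_add, add_mul, hx, hy]
    | tmul t y => simp [hU, mul_assoc]
  induction y with
  | zero => simp
  | add x y hx hy => rw [add_mul, map_add, map_add]; exact add_mem hx hy
  | tmul s x =>
    rw [hW]
    exact σ.mul_mem_relations (hD s _ hz) _

/-- If `Δ = π ∘ D` for an algebra map `D : T → T ⊗ T` such that the left multiplications by all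
`D(t)` descend to `T ⊗_B T`, then the kernel of `comulMul Δ` is a left ideal. -/
lemma comulMul_mul_eq_zero (D : T →ₐ[k] T ⊗[k] T)
    (hD : ∀ t, ∀ x ∈ σ.relations, D t * x ∈ σ.relations) (z : T ⊗[k] (Tᵐᵒᵖ ⊗[k] Tᵐᵒᵖ))
    (hz : σ.comulMul (σ.proj ∘ₗ D.toLinearMap) z = 0) (y : T ⊗[k] (Tᵐᵒᵖ ⊗[k] Tᵐᵒᵖ)) :
    σ.comulMul (σ.proj ∘ₗ D.toLinearMap) (y * z) = 0 := by
  set U : Tᵐᵒᵖ ⊗[k] Tᵐᵒᵖ →ₗ[k] T ⊗[k] T :=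
    map (MulOpposite.opLinearEquiv k).symm.toLinearMap
      (MulOpposite.opLinearEquiv k).symm.toLinearMap with hU
  have hW : ∀ z, σ.comulMul (σ.proj ∘ₗ D.toLinearMap) z
      = σ.proj (LinearMap.mul' k _ (map D.toLinearMap U z)) := by
    intro z
    induction z with
    | zero => simp only [map_zero]
    | add x y hx hy => simp only [map_add, hx, hy]
    | tmul t x => rfl
  have hUm : ∀ x y, U (x * y) = U y * U x := by
    intro x y
    induction x with
    | zero => simp
    | add x y hx hy => simp only [map_add, mul_add, add_mul, hx, hy]
    | tmul x x' =>
      induction y with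
      | zero => simp
      | add x y hx hy => simp only [map_add, mul_add, add_mul, hx, hy]
      | tmul y y' => simp [hU]
  rw [hW, proj_eq_zero] at hz ⊢
  exact σ.mul_mem_relations_of_antihom D hD U hUm z hz y

lemma comulTensorId_proj (Δ : T →ₗ[k] σ.TensorOver)
    (hΔ : ∀ b t, Δ (σ.tgt b * t) = σ.rightB b (Δ t)) (t t' : T) :
    σ.comulTensorId Δ hΔ (σ.proj (t ⊗ₜ t')) = σ.assocLeft (Δ t) t' := rfl

lemma idTensorComul_proj (Δ : T →ₗ[k] σ.TensorOver)
    (hΔ : ∀ b t, Δ (σ.source b * t) = σ.leftB b (Δ t)) (t t' : T) :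
    σ.idTensorComul Δ hΔ (σ.proj (t ⊗ₜ t')) = σ.assocRight (Δ t') t := rfl

lemma assocLeft_proj (x : T ⊗[k] T) (t : T) :
    σ.assocLeft (σ.proj x) t = σ.proj₃ (TensorProduct.assoc k T T T (x ⊗ₜ t)) := rfl

lemma assocRight_proj (x : T ⊗[k] T) (t : T) :
    σ.assocRight (σ.proj x) t = σ.proj₃ (t ⊗ₜ x) := rfl

end SourceTarget

/-! ### The bialgebroid of a braided commutative module algebra. -/

namespace SmashProduct

section

variable {k V L : Type*} [CommRing k] [Ring L] [Ring V] [Algebra k V]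
  [Bialgebra k L] [Module L V] [IsScalarTower k L V] [IsModuleAlgebra k L V]

/-- The conditions on a linear map `β : V → V # L`, `β(v) = ∑ v₀ # v₁`, to be the target map of a
bialgebroid `V # L`: the map `v ↦ ∑ v₀ ⊗ v₁` makes `V` a braided commutative Yetter-Drinfeld module
algebra. -/
structure IsBraidedTarget (β : V →ₗ[k] SmashProduct k V L) : Prop where
  target_one : β 1 = 1
  target_mul : ∀ v w, β (v * w) = β w * β v
  inclLeft_mul_target : ∀ v w, inclLeft k V L v * β w = β w * inclLeft k V L v
  /-- `l β(v) = ∑ β(l₂ v) l₁` -/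
  inclRight_mul_target : ∀ l v, inclRight k V L l * β v = LinearMap.mul' k _
    (map (β ∘ₗ smulAt k v) (inclRight k V L).toLinearMap (TensorProduct.comm k L L (comul l)))
  -- This axiom and the next say that `v ↦ ∑ v₀ ⊗ v₁` is coassociative and counital, i.e. a right
  -- coaction of `L` on `V`.
  coaction_target : ∀ v, coaction k V L (β v) = β.rTensor L ((ofTensor k V L).symm (β v))
  counitMap_target : ∀ v, counitMap k V L (β v) = v

namespace IsBraidedTarget

variable {β : V →ₗ[k] SmashProduct k V L} (hβ : IsBraidedTarget β)
include hβ

/-- The source and target maps `α(v) = v # 1` and `β`. -/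
def sourceTarget : SourceTarget k V (SmashProduct k V L) where
  source := inclLeft k V L
  target := AlgHom.ofLinearMap ((MulOpposite.opLinearEquiv k).toLinearMap ∘ₗ β)
    (MulOpposite.unop_injective (by simp [hβ.target_one]))
    (fun v w => MulOpposite.unop_injective (by simp [hβ.target_mul]))
  source_mul_target := hβ.inclLeft_mul_target

@[simp] lemma sourceTarget_tgt (v : V) : hβ.sourceTarget.tgt v = β v := rfl
@[simp] lemma sourceTarget_source (v : V) : hβ.sourceTarget.source v = inclLeft k V L v := rfl

/-- Coassociativity of the coaction, read in `T ⊗ T`: the lifted coproduct of `β(v)` is `∑ β(v₀) ⊗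
v₁`. -/
lemma comulHom_apply (v : V) : comulHom k V L (β v)
    = map β (inclRight k V L).toLinearMap ((ofTensor k V L).symm (β v)) := by
  rw [← lTensor_coaction, hβ.coaction_target]
  exact congr($(LinearMap.lTensor_comp_rTensor _ _ _) _)

/-- `Δ(β(v)) = 1 ⊗ β(v)` in `T ⊗_B T`. -/
lemma proj_comulHom (v : V) :
    hβ.sourceTarget.proj (comulHom k V L (β v)) = hβ.sourceTarget.proj (1 ⊗ₜ β v) := by
  rw [comulHom_apply hβ]
  -- Over `V`, the factor `β(v₀)` moves across the tensor sign and becomes `α(v₀)`, which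
  -- reassembles `∑ α(v₀)v₁ = β(v)` in the second leg.
  have : hβ.sourceTarget.proj ∘ₗ map β (inclRight k V L).toLinearMap
      = hβ.sourceTarget.proj ∘ₗ TensorProduct.mk k _ _ 1 ∘ₗ (ofTensor k V L).toLinearMap := by
    apply TensorProduct.ext'
    intro w l
    have h := hβ.sourceTarget.proj_tgt_mul w 1 (inclRight k V L l)
    simpa [inclLeft_mul_inclRight, SmashProduct.mk] using h
  exact congr($this _)

/-- `Δ(t)(β(b) ⊗ 1) = Δ(t)(1 ⊗ α(b))` in `T ⊗_B T`. -/
lemma proj_comulHom_mul (t : SmashProduct k V L) (b : V) :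
    hβ.sourceTarget.proj (comulHom k V L t * (β b ⊗ₜ 1))
      = hβ.sourceTarget.proj (comulHom k V L t * (1 ⊗ₜ inclLeft k V L b)) := by
  set σ := hβ.sourceTarget with hσ
  let F : L ⊗[k] (L ⊗[k] L) →ₗ[k] σ.TensorOver := σ.proj ∘ₗ
    map (inclRight k V L).toLinearMap (LinearMap.mul' k _ ∘ₗ
      map ((inclLeft k V L).toLinearMap ∘ₗ smulAt k b) (inclRight k V L).toLinearMap)
  have hF : ∀ x y z, F (x ⊗ₜ (y ⊗ₜ z)) = σ.proj (inclRight k V L x ⊗ₜ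
      (inclLeft k V L (y • b) * inclRight k V L z)) := fun x y z => by simp [F]
  -- For `t = l` in `L` the compatibility of `β` with `L` gives `l₁β(b) ⊗ l₂ = β(l₂b)l₁ ⊗ l₃ = l₁ ⊗
  -- α(l₂b)l₃`, and the last expression is `l₁ ⊗ l₂α(b)` by the straightening rule. A left factor
  -- from `V` is then absorbed by the left action on `T ⊗_B T`.
  have e1 : ∀ s : L ⊗[k] L, σ.proj (map (inclRight k V L).toLinearMap
      (inclRight k V L).toLinearMap s * (β b ⊗ₜ 1))
        = F (TensorProduct.assoc k L L L (comul.rTensor L s)) := by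
    intro s
    induction s with
    | zero => simp
    | add x y hx hy => simp only [map_add, add_mul, hx, hy]
    | tmul x y =>
      simp only [map_tmul, AlgHom.toLinearMap_apply, Algebra.TensorProduct.tmul_mul_tmul,
        mul_one, hβ.inclRight_mul_target, LinearMap.rTensor_tmul]
      generalize comul (R := k) x = t
      induction t with
      | zero => simp
      | add x y hx hy => simp only [map_add, add_tmul, hx, hy]
      | tmul u w =>
        have := σ.proj_tgt_mul (w • b) (inclRight k V L u) (inclRight k V L y)
        simpa [hF, hσ] using this
  have e2 : ∀ s : L ⊗[k] L, σ.proj (map (inclRight k V L).toLinearMap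
      (inclRight k V L).toLinearMap s * (1 ⊗ₜ inclLeft k V L b)) = F (comul.lTensor L s) := by
    intro s
    induction s with
    | zero => simp
    | add x y hx hy => simp only [map_add, add_mul, hx, hy]
    | tmul x y => simp [F, inclRight_mul_inclLeft]
  have e3 : ∀ l, comulHom k V L (inclRight k V L l) = map (inclRight k V L).toLinearMap
      (inclRight k V L).toLinearMap (comul l) := fun l => comulHom_mk 1 l
  have e4 : ∀ v, comulHom k V L (inclLeft k V L v) = inclLeft k V L v ⊗ₜ 1 := by
    intro v
    rw [inclLeft_apply, comulHom_mk, Bialgebra.comul_one, Algebra.TensorProduct.one_def]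
    rfl
  have e5 : ∀ v x, σ.proj ((inclLeft k V L v ⊗ₜ 1) * x) = σ.leftB v (σ.proj x) := by
    intro v x
    induction x with
    | zero => simp
    | add x y hx hy => simp only [map_add, mul_add, hx, hy]
    | tmul x y => simp [SourceTarget.leftB, hσ]
  have : σ.proj ∘ₗ LinearMap.mulRight k (β b ⊗ₜ 1) ∘ₗ (comulHom k V L).toLinearMap
      = σ.proj ∘ₗ LinearMap.mulRight k (1 ⊗ₜ inclLeft k V L b) ∘ₗ
        (comulHom k V L).toLinearMap := by
    refine hom_ext fun v l => ?_
    simp only [LinearMap.comp_apply, AlgHom.toLinearMap_apply, LinearMap.mulRight_apply]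
    rw [← inclLeft_mul_inclRight, map_mul (comulHom k V L), e4, mul_assoc, mul_assoc, e5, e5, e3,
      e1, e2, coassoc_apply]
  exact congr($this t)

/-- This makes left multiplication by `Δ(t)` well defined on `T ⊗_B T`. Both Lu's condition and the
formula for `Δ(t β(v))` rest on it. -/
lemma comulHom_mul_mem_relations (t : SmashProduct k V L) {x : SmashProduct k V L ⊗[k] SmashProduct k V L}
    (hx : x ∈ hβ.sourceTarget.relations) :
    comulHom k V L t * x ∈ hβ.sourceTarget.relations :=
  hβ.sourceTarget.mul_mem_relations_left (fun b => hβ.proj_comulHom_mul t b) hx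

lemma counitMap_source_mul (b : V) (t : SmashProduct k V L) :
    counitMap k V L (hβ.sourceTarget.source b * t) = b * counitMap k V L t :=
  counitMap_inclLeft_mul b t

/-- Replace `t` by `α(ε(t))`, move it to the left of `β(b)` since the two images commute, and use
`ε(β(b)) = b`. The exchange is what puts `b` on the right. -/
lemma counitMap_tgt_mul (b : V) (t : SmashProduct k V L) :
    counitMap k V L (hβ.sourceTarget.tgt b * t) = counitMap k V L t * b := by
  rw [sourceTarget_tgt, counitMap_mul, ← hβ.inclLeft_mul_target, counitMap_inclLeft_mul, hβ.counitMap_target]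

/-- The coproduct `v # l ↦ ∑ (v # l₁) ⊗ (1 # l₂)`. -/
def comulOver : SmashProduct k V L →ₗ[k] hβ.sourceTarget.TensorOver :=
  hβ.sourceTarget.proj ∘ₗ (comulHom k V L).toLinearMap

lemma comulOver_apply (t : SmashProduct k V L) :
    hβ.comulOver t = hβ.sourceTarget.proj (comulHom k V L t) := rfl

lemma comulOver_source_mul (b : V) (t : SmashProduct k V L) :
    hβ.comulOver (hβ.sourceTarget.source b * t) = hβ.sourceTarget.leftB b (hβ.comulOver t) := by
  rw [comulOver_apply, comulOver_apply, map_mul, sourceTarget_source, inclLeft_apply, comulHom_mk,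
    Bialgebra.comul_one, Algebra.TensorProduct.one_def]
  generalize comulHom k V L t = x
  induction x with
  | zero => simp
  | add x y hx hy => simp only [map_add, mul_add, hx, hy]
  | tmul x y => simp [SourceTarget.leftB, mkHom_apply, ← inclLeft_apply]

/-- Since the lift is multiplicative and the relations form a right ideal, `Δ(β(b))` can be replaced
by `1 ⊗ β(b)` inside the product. -/
lemma comulOver_tgt_mul (b : V) (t : SmashProduct k V L) :
    hβ.comulOver (hβ.sourceTarget.tgt b * t) = hβ.sourceTarget.rightB b (hβ.comulOver t) := by
  rw [comulOver_apply, comulOver_apply, map_mul, sourceTarget_tgt,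
    hβ.sourceTarget.proj_mul_congr (hβ.proj_comulHom b)]
  generalize comulHom k V L t = x
  induction x with
  | zero => simp
  | add x y hx hy => simp only [map_add, mul_add, hx, hy]
  | tmul x y => simp [SourceTarget.rightB]

/-- The bialgebroid `V # L` over a braided commutative algebra `V`. -/
def bialgebroid : Bialgebroid k V (SmashProduct k V L) where
  toSourceTarget := hβ.sourceTarget
  comul := hβ.comulOver
  comul_source_mul := hβ.comulOver_source_mul
  comul_tgt_mul := hβ.comulOver_tgt_mul
  comul_one := by rw [comulOver_apply, map_one, Algebra.TensorProduct.one_def]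
  coassoc t := by
    have : hβ.sourceTarget.comulTensorId _ hβ.comulOver_tgt_mul ∘ₗ hβ.comulOver
        = hβ.sourceTarget.idTensorComul _ hβ.comulOver_source_mul ∘ₗ hβ.comulOver := by
      refine hom_ext fun v l => ?_
      simp only [LinearMap.comp_apply, comulOver_apply, comulHom_mk]
      -- Both sides are the class of `∑ (v # l₁) ⊗ (1 # l₂) ⊗ (1 # l₃)`, so coassociativity comes
      -- from `L`.
      let F : L ⊗[k] (L ⊗[k] L) →ₗ[k] hβ.sourceTarget.TensorOver₃ :=
        hβ.sourceTarget.proj₃ ∘ₗ map (mkHom v) (map (mkHom 1) (mkHom 1))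
      have e1 : ∀ s, hβ.sourceTarget.comulTensorId _ hβ.comulOver_tgt_mul
          (hβ.sourceTarget.proj (map (mkHom v) (mkHom 1) s))
          = F (TensorProduct.assoc k L L L (comul.rTensor L s)) := by
        intro s
        induction s with
        | zero => simp
        | add x y hx hy => simp only [map_add, hx, hy]
        | tmul x y =>
          rw [map_tmul, SourceTarget.comulTensorId_proj, comulOver_apply, mkHom_apply,
            comulHom_mk, SourceTarget.assocLeft_proj, LinearMap.rTensor_tmul]
          generalize comul (R := k) x = t
          induction t with
          | zero => simp
          | add x y hx hy => simp only [map_add, add_tmul, hx, hy]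
          | tmul u w => simp [F]
      have e2 : ∀ s, hβ.sourceTarget.idTensorComul _ hβ.comulOver_source_mul
          (hβ.sourceTarget.proj (map (mkHom v) (mkHom 1) s)) = F (comul.lTensor L s) := by
        intro s
        induction s with
        | zero => simp
        | add x y hx hy => simp only [map_add, hx, hy]
        | tmul x y =>
          rw [map_tmul, SourceTarget.idTensorComul_proj, comulOver_apply, mkHom_apply 1,
            comulHom_mk, SourceTarget.assocRight_proj, LinearMap.lTensor_tmul]
          simp [F]
      rw [e1, e2, coassoc_apply]
    exact congr($this t)
  -- The lift of the coproduct to an honest algebra map into `T ⊗ T` is what makes the criterion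
  -- applicable.
  comul_compat := hβ.sourceTarget.comulMul_mul_eq_zero (comulHom k V L)
    (fun t _ hx => hβ.comulHom_mul_mem_relations t hx)
  counit := counitMap k V L
  counit_source_mul := hβ.counitMap_source_mul
  counit_tgt_mul := hβ.counitMap_tgt_mul
  counit_one := by simp [one_def]
  counit_comul t := by
    have : hβ.sourceTarget.counitTensorId _ hβ.counitMap_tgt_mul ∘ₗ hβ.comulOver
        = LinearMap.id := by
      refine hom_ext fun v l => ?_
      simp only [LinearMap.comp_apply, comulOver_apply, comulHom_mk, LinearMap.id_apply]
      have e : ∀ s : L ⊗[k] L, LinearMap.mul' k _ (LinearMap.rTensor _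
          (hβ.sourceTarget.source.toLinearMap ∘ₗ counitMap k V L) (map (mkHom v) (mkHom 1) s))
          = mkHom v (TensorProduct.lid k L (counit.rTensor L s)) := by
        intro s
        induction s with
        | zero => simp
        | add x y hx hy => simp only [map_add, hx, hy]
        | tmul x y => simp [mkHom_apply, ← inclRight_apply, inclLeft_mul_inclRight]
      refine (e _).trans ?_
      rw [Coalgebra.rTensor_counit_comul]
      simp [mkHom_apply]
    exact congr($this t)
  comul_counit t := by
    have : hβ.sourceTarget.idTensorCounit _ hβ.counitMap_source_mul ∘ₗ hβ.comulOver
        = LinearMap.id := by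
      refine hom_ext fun v l => ?_
      simp only [LinearMap.comp_apply, comulOver_apply, comulHom_mk, LinearMap.id_apply]
      have e : ∀ s : L ⊗[k] L, LinearMap.mul' k _ ((TensorProduct.comm k _ _).toLinearMap
          (LinearMap.lTensor _ (hβ.sourceTarget.tgt ∘ₗ counitMap k V L)
            (map (mkHom v) (mkHom 1) s)))
          = mkHom v (TensorProduct.rid k L (counit.lTensor L s)) := by
        intro s
        induction s with
        | zero => simp
        | add x y hx hy => simp only [map_add, hx, hy]
        | tmul x y => simp [mkHom_apply]
      refine (e _).trans ?_
      rw [Coalgebra.lTensor_counit_comul]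
      simp [mkHom_apply]
    exact congr($this t)
  counit_compat t ht s := by rw [counitMap_mul, ht, map_zero, mul_zero, map_zero]

end IsBraidedTarget

end

end SmashProduct

/-! ### The antipode of `V # L`, and the Hopf algebroid. -/

namespace SmashProduct

variable {k V L : Type*} [Field k] [Ring L] [Ring V] [Algebra k V]
  [HopfAlgebra k L] [Module L V] [IsScalarTower k L V] [IsModuleAlgebra k L V]
  [Module.Finite k L] [Module.Finite k V]

instance : Module.Finite k (SmashProduct k V L) := inferInstanceAs (Module.Finite k (V ⊗[k] L))

/-- The map `(v # l) ↦ (t ↦ β(v) t ⊗ (1 # l))`. -/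
def sectionAux (β : V →ₗ[k] SmashProduct k V L) : SmashProduct k V L →ₗ[k] SmashProduct k V L →ₗ[k]
    SmashProduct k V L ⊗[k] SmashProduct k V L :=
  TensorProduct.lift (LinearMap.mk₂ k (fun v l =>
    (TensorProduct.mk k _ _).flip (inclRight k V L l) ∘ₗ LinearMap.mulLeft k (β v))
    (fun _ _ _ => by ext; simp [add_mul]) (fun _ _ _ => by ext; simp [smul_tmul'])
    (fun _ _ _ => by ext; simp) (fun _ _ _ => by ext; simp)) ∘ₗ
    (ofTensor k V L).symm.toLinearMap

lemma sectionAux_mk (β : V →ₗ[k] SmashProduct k V L) (v : V) (l : L) (t : SmashProduct k V L) :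
    sectionAux β (mk v l) t = (β v * t) ⊗ₜ inclRight k V L l := rfl

namespace IsBraidedTarget

variable {β : V →ₗ[k] SmashProduct k V L} (hβ : IsBraidedTarget β)
include hβ

/-- `β(v) S⁻¹(l) = ∑ S⁻¹(l₂) β(l₁ v)`. -/
lemma target_mul_antipodeInv (l : L) (v : V) :
    β v * inclRight k V L (antipodeInv k L l) = LinearMap.mul' k _
      (map ((inclRight k V L).toLinearMap ∘ₗ antipodeInv k L) (β ∘ₗ smulAt k v)
        (TensorProduct.comm k L L (comul l))) := by
  let N : L ⊗[k] L →ₗ[k] L := LinearMap.mul' k L ∘ₗ (antipodeInv k L).rTensor L ∘ₗ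
    (TensorProduct.comm k L L).toLinearMap
  have hN : ∀ z, N (comul z) = algebraMap k L (counit z) := mul_antipodeInv_comm_comul k
  have hN' : ∀ v w, N (v ⊗ₜ w) = antipodeInv k L w * v := fun v w => by simp [N]
  let G : L ⊗[k] L →ₗ[k] SmashProduct k V L := LinearMap.mul' k _ ∘ₗ
    map (β ∘ₗ smulAt k v) ((inclRight k V L).toLinearMap ∘ₗ antipodeInv k L)
  have hG : ∀ x y, G (x ⊗ₜ y) = β (x • v) * inclRight k V L (antipodeInv k L y) :=
    fun x y => by simp [G]
  clear_value N G
  -- Moving `S⁻¹(l₂)` to the right of `β(l₁v)` and using that `S⁻¹` reverses the coproduct turns the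
  -- right side into `∑ β(S⁻¹(l₂)l₁v) S⁻¹(l₃)`; then `∑ S⁻¹(l₂)l₁ = ε(l)` collapses it.
  have e1 : ∀ s : L ⊗[k] L, LinearMap.mul' k _
      (map ((inclRight k V L).toLinearMap ∘ₗ antipodeInv k L) (β ∘ₗ smulAt k v)
        (TensorProduct.comm k L L s))
      = G (N.rTensor L ((TensorProduct.assoc k L L L).symm (comul.lTensor L s))) := by
    intro s
    induction s with
    | zero => simp
    | add x y hx hy => simp only [map_add, hx, hy]
    | tmul x y =>
      simp only [comm_tmul, map_tmul, LinearMap.mul'_apply, LinearMap.comp_apply,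
        AlgHom.toLinearMap_apply, smulAt_apply, hβ.inclRight_mul_target, comul_antipodeInv,
        LinearMap.lTensor_tmul]
      generalize comul (R := k) y = t
      induction t with
      | zero => simp
      | add x y hx hy => simp only [map_add, tmul_add, hx, hy]
      | tmul u w => simp [hG, hN', mul_smul]
  have e2 : ∀ s : L ⊗[k] L, G (N.rTensor L (comul.rTensor L s))
      = G ((Algebra.linearMap k L).rTensor L (counit.rTensor L s)) := by
    intro s
    induction s with
    | zero => simp
    | add x y hx hy => simp only [map_add, hx, hy]
    | tmul x y => simp [hN]
  rw [e1, coassoc_symm_apply, e2, Coalgebra.rTensor_counit_comul]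
  simp [hG]

/-- The anti-homomorphism `v # l ↦ S⁻¹(l) β(v)`, which is the inverse of the antipode. -/
def antipodeInvHom : SmashProduct k V L →ₐ[k] (SmashProduct k V L)ᵐᵒᵖ :=
  lift hβ.sourceTarget.target ((inclRight k V L).op.comp (antipodeInvOp k (A := L))) (by
    intro l v
    -- The covariance condition in `Tᵒᵖ` is the commutation rule of `β(v)` with `S⁻¹(l)`, read
    -- backwards.
    have h := congrArg (MulOpposite.opLinearEquiv k) (hβ.target_mul_antipodeInv l v)
    refine Eq.trans ?_ (h.trans ?_)
    · rfl
    · generalize comul (R := k) l = t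
      induction t with
      | zero => simp
      | add x y hx hy => simp only [map_add, hx, hy]
      | tmul u w => rfl)

lemma antipodeInvHom_mk (v : V) (l : L) : hβ.antipodeInvHom (SmashProduct.mk v l)
    = MulOpposite.op (inclRight k V L (antipodeInv k L l) * β v) := by
  rw [antipodeInvHom, lift_mk]
  rfl

lemma antipodeInvHom_inclLeft (v : V) :
    hβ.antipodeInvHom (inclLeft k V L v) = MulOpposite.op (β v) := by
  rw [inclLeft_apply, antipodeInvHom_mk, antipodeInv_one, map_one, one_mul]

lemma antipodeInvHom_inclRight (l : L) : hβ.antipodeInvHom (inclRight k V L l)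
    = MulOpposite.op (inclRight k V L (antipodeInv k L l)) := by
  rw [inclRight_apply, antipodeInvHom_mk, hβ.target_one, mul_one]

/-- `α(v) = ∑ β(v₀) S(v₁)`. -/
lemma sum_target_mul_antipode (v : V) : LinearMap.mul' k _
    (map β ((inclRight k V L).toLinearMap ∘ₗ antipode k) ((ofTensor k V L).symm (β v)))
      = inclLeft k V L v := by
  -- For arbitrary `t = v # l` the antipode axiom of `L` collapses `∑ v # l₁S(l₂)` to `α(ε(t))`.
  have e1 : ∀ t : SmashProduct k V L, LinearMap.mul' k _ (LinearMap.lTensor _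
      ((inclRight k V L).toLinearMap ∘ₗ antipode k) (coaction k V L t))
        = inclLeft k V L (counitMap k V L t) := by
    intro t
    have : LinearMap.mul' k _ ∘ₗ LinearMap.lTensor _
        ((inclRight k V L).toLinearMap ∘ₗ antipode k) ∘ₗ coaction k V L
        = (inclLeft k V L).toLinearMap ∘ₗ counitMap k V L := by
      refine hom_ext fun v l => ?_
      simp only [LinearMap.comp_apply, coaction_mk, counitMap_mk, AlgHom.toLinearMap_apply]
      have e : ∀ s : L ⊗[k] L, LinearMap.mul' k _ (LinearMap.lTensor _
          ((inclRight k V L).toLinearMap ∘ₗ antipode k) ((mkHom v).rTensor L s))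
          = inclLeft k V L v * inclRight k V L
            (LinearMap.mul' k L ((antipode k).lTensor L s)) := by
        intro s
        induction s with
        | zero => simp
        | add x y hx hy => simp only [map_add, mul_add, hx, hy]
        | tmul x y => simp [mkHom_apply, ← inclLeft_mul_inclRight, mul_assoc]
      rw [e, mul_antipode_lTensor_comul_apply]
      simp [Algebra.algebraMap_eq_smul_one]
    exact congr($this t)
  have e2 : ∀ s : V ⊗[k] L, LinearMap.mul' k _
      (map β ((inclRight k V L).toLinearMap ∘ₗ antipode k) s)
        = LinearMap.mul' k _ (LinearMap.lTensor _
          ((inclRight k V L).toLinearMap ∘ₗ antipode k) (β.rTensor L s)) := by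
    intro s
    induction s with
    | zero => simp
    | add x y hx hy => simp only [map_add, hx, hy]
    | tmul x y => rfl
  -- Coassociativity of the coaction recognises `∑ β(v₀) ⊗ v₁` as the coaction applied to `t =
  -- β(v)`, and `ε(β(v)) = v`.
  rw [e2, ← hβ.coaction_target, e1, hβ.counitMap_target]

/-- The range is a subalgebra of `Tᵒᵖ`. It contains `L`, because `S⁻¹(S(l)) = l`, and `β(V)`, the
image of `α(V)`; hence also `α(V)`, by `α(v) = ∑ β(v₀)S(v₁)`. Since `V` and `L` generate `T`, the
map is onto, and finite dimension gives injectivity. -/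
lemma antipodeInvHom_bijective : Function.Bijective hβ.antipodeInvHom := by
  have hr : ∀ l, MulOpposite.op (inclRight k V L l) ∈ hβ.antipodeInvHom.range := fun l =>
    ⟨inclRight k V L (antipode k l), by
      show hβ.antipodeInvHom _ = _
      rw [antipodeInvHom_inclRight, antipodeInv_antipode]⟩
  have hb : ∀ v, MulOpposite.op (β v) ∈ hβ.antipodeInvHom.range := fun v =>
    ⟨inclLeft k V L v, hβ.antipodeInvHom_inclLeft v⟩
  have hl : ∀ v, MulOpposite.op (inclLeft k V L v) ∈ hβ.antipodeInvHom.range := by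
    intro v
    rw [← hβ.sum_target_mul_antipode]
    generalize (ofTensor k V L).symm (β v) = s
    induction s with
    | zero => simp
    | add x y hx hy => simpa only [map_add, MulOpposite.op_add] using add_mem hx hy
    | tmul w l => exact mul_mem (hr _) (hb w)
  have hs : Function.Surjective hβ.antipodeInvHom := by
    intro x
    have : ∀ t : V ⊗[k] L, MulOpposite.op (ofTensor k V L t) ∈ hβ.antipodeInvHom.range := by
      intro t
      induction t with
      | zero => simp
      | add x y hx hy => simpa only [map_add, MulOpposite.op_add] using add_mem hx hy
      | tmul w l =>
        have h := mul_mem (hr l) (hl w)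
        rwa [← MulOpposite.op_mul, inclLeft_mul_inclRight] at h
    exact this ((ofTensor k V L).symm x.unop)
  refine ⟨?_, hs⟩
  -- Composing with `Tᵒᵖ → T` makes the map an endomorphism of a finite-dimensional space.
  have := LinearMap.injective_iff_surjective (f := (MulOpposite.opLinearEquiv k).symm.toLinearMap ∘ₗ
    hβ.antipodeInvHom.toLinearMap)
  have h2 := this.2 ((MulOpposite.opLinearEquiv k).symm.surjective.comp hs)
  exact fun x y h => h2 (congrArg MulOpposite.unop h)

/-- The antipode `τ` of `V # L`, with `τ(S⁻¹(l) β(v)) = v # l`. -/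
def antipodeEquiv : SmashProduct k V L ≃ₐ[k] (SmashProduct k V L)ᵐᵒᵖ :=
  (AlgEquiv.opComm (AlgEquiv.ofBijective hβ.antipodeInvHom hβ.antipodeInvHom_bijective)).symm

/-- This characterises `τ`, and every later computation with `τ` goes through it: elements are first
written in the form `S⁻¹(l)β(v)`. -/
lemma antipodeEquiv_unop_antipodeInvHom (t : SmashProduct k V L) :
    hβ.antipodeEquiv (hβ.antipodeInvHom t).unop = MulOpposite.op t := by
  rw [antipodeEquiv, AlgEquiv.symm_apply_eq]
  rfl

lemma antipodeEquiv_target (v : V) : hβ.antipodeEquiv (β v)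
    = MulOpposite.op (inclLeft k V L v) := by
  rw [← antipodeEquiv_unop_antipodeInvHom, antipodeInvHom_inclLeft]
  rfl

lemma antipodeEquiv_inclRight (l : L) : hβ.antipodeEquiv (inclRight k V L l)
    = MulOpposite.op (inclRight k V L (antipode k l)) := by
  rw [← antipodeEquiv_unop_antipodeInvHom, antipodeInvHom_inclRight, antipodeInv_antipode]
  rfl

/-- `Δ(t β(v)) = Δ(t) (1 ⊗ β(v))` in `T ⊗_B T`. -/
lemma comulOver_mul_target (t : SmashProduct k V L) (v : V) :
    hβ.comulOver (t * β v) = hβ.sourceTarget.proj (comulHom k V L t * (1 ⊗ₜ β v)) := by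
  have h := hβ.proj_comulHom v
  rw [comulOver_apply, map_mul]
  rw [← sub_eq_zero, ← map_sub, SourceTarget.proj_eq_zero] at h ⊢
  rw [← mul_sub]
  exact hβ.comulHom_mul_mem_relations t h

/-- The antipode as a linear map. -/
def antipodeMap : SmashProduct k V L →ₗ[k] SmashProduct k V L :=
  (MulOpposite.opLinearEquiv k).symm.toLinearMap ∘ₗ hβ.antipodeEquiv.toLinearMap

lemma antipodeMap_inclRight (l : L) : hβ.antipodeMap (inclRight k V L l)
    = inclRight k V L (antipode k l) :=
  congrArg MulOpposite.unop (hβ.antipodeEquiv_inclRight l)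

/-- `m (τ ⊗ id) Δ = β ε τ`. -/
lemma descend_antipode_comulOver (hf : ∀ b t t',
      (LinearMap.mul' k _ ∘ₗ hβ.antipodeMap.rTensor _) ((hβ.sourceTarget.tgt b * t) ⊗ₜ t')
        = (LinearMap.mul' k _ ∘ₗ hβ.antipodeMap.rTensor _)
          (t ⊗ₜ (hβ.sourceTarget.source b * t'))) (t : SmashProduct k V L) :
    hβ.sourceTarget.descend (LinearMap.mul' k _ ∘ₗ hβ.antipodeMap.rTensor _) hf (hβ.comulOver t)
      = β (counitMap k V L (hβ.antipodeMap t)) := by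
  -- Writing the argument as `S⁻¹(l)β(v)` replaces `τ(t)` by `v # l`, and only `τ` on `L` is then
  -- needed, where it is the antipode.
  obtain ⟨t, rfl⟩ : ∃ s, t = (hβ.antipodeInvHom s).unop :=
    ⟨(hβ.antipodeEquiv t).unop, by
      rw [← hβ.antipodeEquiv.injective.eq_iff, antipodeEquiv_unop_antipodeInvHom]; rfl⟩
  have e : hβ.antipodeMap (hβ.antipodeInvHom t).unop = t :=
    congrArg MulOpposite.unop (hβ.antipodeEquiv_unop_antipodeInvHom t)
  rw [e]
  have : (hβ.sourceTarget.descend (LinearMap.mul' k _ ∘ₗ hβ.antipodeMap.rTensor _) hf ∘ₗ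
      hβ.comulOver) ∘ₗ (MulOpposite.opLinearEquiv k).symm.toLinearMap ∘ₗ
        hβ.antipodeInvHom.toLinearMap = β ∘ₗ counitMap k V L := by
    refine hom_ext fun v l => ?_
    simp only [LinearMap.comp_apply, AlgHom.toLinearMap_apply, antipodeInvHom_mk,
      LinearEquiv.coe_coe, MulOpposite.coe_opLinearEquiv_symm, MulOpposite.unop_op,
      comulOver_mul_target, SourceTarget.descend_proj, counitMap_mk, map_smul]
    -- Since `Δ(x β(v)) = Δ(x)(1 ⊗ β(v))`, for `x = S⁻¹(l)` the left side is `∑ S(x₁)x₂β(v) =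
    -- ε(l)β(v)`.
    have e1 : ∀ s : L ⊗[k] L, LinearMap.mul' k _ (hβ.antipodeMap.rTensor _
        (map (inclRight k V L).toLinearMap (inclRight k V L).toLinearMap s * (1 ⊗ₜ β v)))
        = inclRight k V L (LinearMap.mul' k L ((antipode k).rTensor L s)) * β v := by
      intro s
      induction s with
      | zero => simp
      | add x y hx hy => simp only [map_add, add_mul, hx, hy]
      | tmul x y => simp [antipodeMap_inclRight, mul_assoc]
    have e2 : ∀ l, comulHom k V L (inclRight k V L l) = map (inclRight k V L).toLinearMap
      (inclRight k V L).toLinearMap (comul l) := fun l => comulHom_mk 1 l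
    rw [e2, e1, mul_antipode_rTensor_comul_apply, counit_antipodeInv]
    simp [Algebra.algebraMap_eq_smul_one]
  exact congr($this t)

/-- The section `t ⊗ (v # l) ↦ β(v) t ⊗ (1 # l)` of the projection `T ⊗ T → T ⊗_B T`. -/
def projSection : hβ.sourceTarget.TensorOver →ₗ[k] SmashProduct k V L ⊗[k] SmashProduct k V L :=
  hβ.sourceTarget.descend (TensorProduct.lift (sectionAux β).flip) (by
    intro b t t'
    -- The section descends to `T ⊗_B T` because `β` reverses products: `β(w)β(b)t = β(bw)t`.
    have : (sectionAux β).flip (β b * t)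
        = (sectionAux β).flip t ∘ₗ LinearMap.mulLeft k (inclLeft k V L b) := by
      refine hom_ext fun v l => ?_
      simp only [LinearMap.comp_apply, LinearMap.mulLeft_apply, LinearMap.flip_apply,
        inclLeft_apply, mk_one_mul_mk, sectionAux_mk, hβ.target_mul, mul_assoc]
    exact congr($this t'))

lemma proj_projSection (x : hβ.sourceTarget.TensorOver) :
    hβ.sourceTarget.proj (hβ.projSection x) = x := by
  obtain ⟨x, rfl⟩ := hβ.sourceTarget.proj_surjective x
  have : hβ.sourceTarget.proj ∘ₗ TensorProduct.lift (sectionAux β).flip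
      = hβ.sourceTarget.proj := by
    apply TensorProduct.ext
    apply LinearMap.ext
    intro t
    refine hom_ext fun v l => ?_
    have h := hβ.sourceTarget.proj_tgt_mul v t (inclRight k V L l)
    rw [sourceTarget_source, inclLeft_mul_inclRight] at h
    exact h
  exact congr($this x)

/-- The second legs of the lifted coproduct are of the form `1 # l` and `β(1) = 1`, so the section
returns the lift itself. The second antipode axiom can therefore be checked in `T ⊗ T`. -/
lemma projSection_comulOver (t : SmashProduct k V L) :
    hβ.projSection (hβ.comulOver t) = comulHom k V L t := by
  have : hβ.projSection ∘ₗ hβ.comulOver = (comulHom k V L).toLinearMap := by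
    refine hom_ext fun v l => ?_
    simp only [LinearMap.comp_apply, AlgHom.toLinearMap_apply, comulOver_apply, comulHom_mk]
    generalize comul (R := k) l = s
    induction s with
    | zero => simp
    | add x y hx hy => simp only [map_add, hx, hy]
    | tmul x y =>
      have h : hβ.projSection (hβ.sourceTarget.proj (SmashProduct.mk v x ⊗ₜ SmashProduct.mk 1 y))
        = sectionAux β (SmashProduct.mk 1 y) (SmashProduct.mk v x) := rfl
      rw [map_tmul, mkHom_apply, mkHom_apply, h, sectionAux_mk, hβ.target_one, one_mul]
      rfl
  exact congr($this t)

/-- As `τ` restricts to the antipode on `L`, the left side is `∑ v # l₁S(l₂)`. -/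
lemma mul_lTensor_antipode_comulHom (t : SmashProduct k V L) :
    LinearMap.mul' k _ (hβ.antipodeMap.lTensor _ (comulHom k V L t))
      = inclLeft k V L (counitMap k V L t) := by
  have : LinearMap.mul' k _ ∘ₗ hβ.antipodeMap.lTensor _ ∘ₗ (comulHom k V L).toLinearMap
      = (inclLeft k V L).toLinearMap ∘ₗ counitMap k V L := by
    refine hom_ext fun v l => ?_
    simp only [LinearMap.comp_apply, AlgHom.toLinearMap_apply, comulHom_mk, counitMap_mk]
    have e : ∀ s : L ⊗[k] L, LinearMap.mul' k _ (hβ.antipodeMap.lTensor _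
        (map (mkHom v) (mkHom 1) s))
        = inclLeft k V L v * inclRight k V L (LinearMap.mul' k L ((antipode k).lTensor L s)) := by
      intro s
      induction s with
      | zero => simp
      | add x y hx hy => simp only [map_add, mul_add, hx, hy]
      | tmul x y =>
        simp [mkHom_apply, ← inclLeft_mul_inclRight, mul_assoc, antipodeMap_inclRight]
    rw [e, mul_antipode_lTensor_comul_apply]
    simp [Algebra.algebraMap_eq_smul_one]
  exact congr($this t)

/-- The Hopf algebroid `V # L` over a braided commutative algebra `V`. -/
def hopfAlgebroid : HopfAlgebroid k V (SmashProduct k V L) where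
  toBialgebroid := hβ.bialgebroid
  antipode := hβ.antipodeEquiv
  antipode_tgt b := congrArg MulOpposite.unop (hβ.antipodeEquiv_target b)
  antipode_mul := hβ.descend_antipode_comulOver _
  exists_section := ⟨hβ.projSection, hβ.proj_projSection, fun t => by
    refine (congrArg _ (congrArg _ (hβ.projSection_comulOver t))).trans ?_
    exact hβ.mul_lTensor_antipode_comulHom t⟩

end IsBraidedTarget

end SmashProduct

/-! ### The axioms of an `R`-matrix as identities between sums, and its counits. -/

namespace IsRMatrix

variable {k H : Type*} [CommRing k] [Ring H] [Bialgebra k H] {R : H ⊗[k] H}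

/-- The axiom for `Δ ⊗ id` in Sweedler style. An arbitrary linear `G` allows it to be inserted into
any expression linear in the three legs. -/
lemma sum_comul_tmul (hR : IsRMatrix k R) {S : Finset (H × H)}
    (hS : R = ∑ i ∈ S, i.1 ⊗ₜ i.2) {W : Type*} [AddCommGroup W] [Module k W]
    (G : H ⊗[k] (H ⊗[k] H) →ₗ[k] W) :
    ∑ i ∈ S, G (TensorProduct.assoc k H H H (comul i.1 ⊗ₜ i.2))
      = ∑ i ∈ S, ∑ j ∈ S, G (i.1 ⊗ₜ (j.1 ⊗ₜ (i.2 * j.2))) := by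
  have h := congrArg G hR.comul_rTensor
  rw [hS] at h
  simpa [Finset.sum_mul_sum] using h

lemma sum_tmul_comul (hR : IsRMatrix k R) {S : Finset (H × H)}
    (hS : R = ∑ i ∈ S, i.1 ⊗ₜ i.2) {W : Type*} [AddCommGroup W] [Module k W]
    (G : H ⊗[k] (H ⊗[k] H) →ₗ[k] W) :
    ∑ i ∈ S, G (i.1 ⊗ₜ comul i.2)
      = ∑ i ∈ S, ∑ j ∈ S, G ((i.1 * j.1) ⊗ₜ (j.2 ⊗ₜ i.2)) := by
  have h := congrArg G hR.comul_lTensor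
  rw [hS] at h
  simpa [Finset.sum_mul_sum] using h

/-- `(ε ⊗ id)(R) = 1`. -/
lemma sum_counit_smul (hR : IsRMatrix k R) {S : Finset (H × H)}
    (hS : R = ∑ i ∈ S, i.1 ⊗ₜ i.2) : ∑ i ∈ S, counit (R := k) i.1 • i.2 = 1 := by
  have h := hR.sum_comul_tmul hS
    ((TensorProduct.lid k _).toLinearMap ∘ₗ (counit (R := k)).rTensor (H ⊗[k] H))
  have e : ∀ x y : H, ((TensorProduct.lid k _).toLinearMap ∘ₗ (counit (R := k)).rTensor (H ⊗[k] H))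
      (TensorProduct.assoc k H H H (comul x ⊗ₜ y)) = x ⊗ₜ y := by
    intro x y
    have e : ∀ s : H ⊗[k] H, ((TensorProduct.lid k _).toLinearMap ∘ₗ
        (counit (R := k)).rTensor (H ⊗[k] H)) (TensorProduct.assoc k H H H (s ⊗ₜ y))
        = TensorProduct.lid k H (counit.rTensor H s) ⊗ₜ y := by
      intro s
      induction s with
      | zero => simp
      | add x y hx hy => simp only [map_add, add_tmul, hx, hy]
      | tmul x y => simp [smul_tmul']
    rw [e]
    simp
  simp only [e] at h
  rw [← hS] at h
  -- The counit on the first leg of `(Δ ⊗ id)(R) = R₁₃R₂₃` gives `R = (1 ⊗ x)R` with `x = (ε ⊗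
  -- id)(R)`; invertibility of `R` then forces `x = 1`.
  have h2 : R = (1 ⊗ₜ (∑ i ∈ S, counit (R := k) i.1 • i.2)) * R := by
    conv_rhs => rw [hS]
    simp only [tmul_sum, Finset.sum_mul_sum, Algebra.TensorProduct.tmul_mul_tmul, one_mul]
    simpa [smul_mul_assoc] using h
  have h3 : (1 : H ⊗[k] H) = 1 ⊗ₜ (∑ i ∈ S, counit (R := k) i.1 • i.2) := by
    apply hR.isUnit.mul_right_cancel
    rw [one_mul]
    exact h2
  have h4 := congrArg (fun z => TensorProduct.lid k H ((counit (R := k)).rTensor H z)) h3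
  simpa [Algebra.TensorProduct.one_def] using h4.symm

/-- `(id ⊗ ε)(R) = 1`. -/
lemma sum_smul_counit (hR : IsRMatrix k R) {S : Finset (H × H)}
    (hS : R = ∑ i ∈ S, i.1 ⊗ₜ i.2) : ∑ i ∈ S, counit (R := k) i.2 • i.1 = 1 := by
  have h := hR.sum_tmul_comul hS
    (((TensorProduct.rid k _).toLinearMap ∘ₗ (counit (R := k)).lTensor H).lTensor H)
  simp only [LinearMap.lTensor_tmul, LinearMap.comp_apply, Coalgebra.lTensor_counit_comul,
    LinearEquiv.coe_coe, rid_tmul, one_smul] at h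
  rw [← hS] at h
  -- The same argument, with the counit on the third leg of `(id ⊗ Δ)(R) = R₁₃R₁₂`.
  have h2 : R = ((∑ i ∈ S, counit (R := k) i.2 • i.1) ⊗ₜ 1) * R := by
    conv_rhs => rw [hS]
    simp only [sum_tmul, Finset.sum_mul_sum, Algebra.TensorProduct.tmul_mul_tmul, one_mul]
    simpa [smul_mul_assoc, smul_tmul'] using h
  have h3 : (1 : H ⊗[k] H) = (∑ i ∈ S, counit (R := k) i.2 • i.1) ⊗ₜ 1 := by
    apply hR.isUnit.mul_right_cancel
    rw [one_mul]
    exact h2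
  have h4 := congrArg (fun z => TensorProduct.rid k H ((counit (R := k)).lTensor H z)) h3
  simpa [Algebra.TensorProduct.one_def] using h4.symm

lemma comm_comul_mul_sum (hR : IsRMatrix k R) {S : Finset (H × H)}
    (hS : R = ∑ i ∈ S, i.1 ⊗ₜ i.2) {W : Type*} [AddCommGroup W] [Module k W]
    (G : H ⊗[k] H →ₗ[k] W) (h : H) :
    ∑ i ∈ S, G (TensorProduct.comm k H H (comul h) * (i.1 ⊗ₜ i.2))
      = ∑ i ∈ S, G ((i.1 ⊗ₜ i.2) * comul h) := by
  have e := congrArg G (hR.comm_comul_mul h)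
  rw [hS] at e
  simpa [Finset.sum_mul, Finset.mul_sum] using e

end IsRMatrix

section

variable {k H V : Type*} [CommRing k] [Ring H] [Ring V] [Algebra k V] [Algebra k H]
  [Module H V] [IsScalarTower k H V]

lemma smulAt_add (v w : V) : (smulAt k (v + w) : H →ₗ[k] V) = smulAt k v + smulAt k w := by
  ext; simp

lemma smulAt_smul (c : k) (v : V) : (smulAt k (c • v) : H →ₗ[k] V) = c • smulAt k v := by
  ext h
  have : SMulCommClass H k V := IsScalarTower.to_smulCommClass'
  exact smul_comm h c v

end

/-! ### The target map of an `R`-matrix, and its restriction to a sub-bialgebra. -/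

namespace SmashProduct

section

variable {k V L H : Type*} [CommRing k] [Ring V] [Algebra k V]
  [Ring L] [Bialgebra k L] [Module L V] [IsScalarTower k L V] [IsModuleAlgebra k L V]
  [Ring H] [Bialgebra k H] [Module H V] [IsScalarTower k H V]

/-- The map `v ↦ ∑ K² • v # K¹`. -/
def targetOf (K : L ⊗[k] H) : V →ₗ[k] SmashProduct k V L where
  toFun v := ofTensor k V L ((smulAt k v).rTensor L (TensorProduct.comm k L H K))
  map_add' v w := by rw [smulAt_add, LinearMap.rTensor_add, LinearMap.add_apply, map_add]
  map_smul' c v := by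
    rw [smulAt_smul, LinearMap.rTensor_smul, LinearMap.smul_apply, map_smul, RingHom.id_apply]

lemma targetOf_apply (K : L ⊗[k] H) (v : V) : targetOf K v
    = ofTensor k V L ((smulAt k v).rTensor L (TensorProduct.comm k L H K)) := rfl

lemma targetOf_eq_sum {K : L ⊗[k] H} {S : Finset (L × H)} (hS : K = ∑ i ∈ S, i.1 ⊗ₜ i.2)
    (v : V) : targetOf K v = ∑ i ∈ S, inclLeft k V L (i.2 • v) * inclRight k V L i.1 := by
  rw [targetOf_apply, hS]
  simp [inclLeft_mul_inclRight, mk]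

end

section

variable {k V H : Type*} [CommRing k] [Ring V] [Algebra k V]
  [Ring H] [Bialgebra k H] [Module H V] [IsScalarTower k H V] [IsModuleAlgebra k H V]

/-- A quantum commutative module algebra is braided commutative. -/
theorem isBraidedTarget_targetOf {R : H ⊗[k] H} (hR : IsRMatrix k R)
    (hV : IsQuantumCommutative k R V) : IsBraidedTarget (targetOf (V := V) R) := by
  obtain ⟨S, hS⟩ := TensorProduct.exists_finset R
  have hβ := fun v : V => targetOf_eq_sum (V := V) hS v
  have hV' : ∀ v w : V, v * w = ∑ i ∈ S, (i.2 • w) * (i.1 • v) := by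
    intro v w
    rw [hV v w, hS]
    simp
  -- By quantum commutativity `v(R²w) = ∑ (R'²R²w)(R'¹v)`, where `R'` is a second copy of `R`. By
  -- `(Δ ⊗ id)(R) = R₁₃R₂₃` this is the expression obtained from `∑ (R²w)R¹v` on moving `R¹` past
  -- `v`.
  have hcomm : ∀ v w : V,
      inclLeft k V H v * targetOf R w = targetOf R w * inclLeft k V H v := by
    intro v w
    have h := hR.sum_comul_tmul hS (LinearMap.mul' k (SmashProduct k V H) ∘ₗ
      map (LinearMap.mul' k _ ∘ₗ map ((inclLeft k V H).toLinearMap ∘ₗ smulAt k w)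
        ((inclLeft k V H).toLinearMap ∘ₗ smulAt k v)) (inclRight k V H).toLinearMap ∘ₗ
        (TensorProduct.assoc k H H H).symm.toLinearMap ∘ₗ
        (TensorProduct.comm k (H ⊗[k] H) H).toLinearMap ∘ₗ
        (TensorProduct.assoc k H H H).symm.toLinearMap)
    have e : ∀ (x z : H), (LinearMap.mul' k (SmashProduct k V H) ∘ₗ
      map (LinearMap.mul' k _ ∘ₗ map ((inclLeft k V H).toLinearMap ∘ₗ smulAt k w)
        ((inclLeft k V H).toLinearMap ∘ₗ smulAt k v)) (inclRight k V H).toLinearMap ∘ₗ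
        (TensorProduct.assoc k H H H).symm.toLinearMap ∘ₗ
        (TensorProduct.comm k (H ⊗[k] H) H).toLinearMap ∘ₗ
        (TensorProduct.assoc k H H H).symm.toLinearMap)
        (TensorProduct.assoc k H H H (comul x ⊗ₜ z))
          = inclLeft k V H (z • w) * inclRight k V H x * inclLeft k V H v := by
      intro x z
      rw [mul_assoc, inclRight_mul_inclLeft]
      generalize comul (R := k) x = s
      induction s with
      | zero => simp
      | add x y hx hy => simp only [map_add, mul_add, add_tmul, hx, hy]
      | tmul x y => simp [mul_assoc]
    simp only [e] at h
    rw [hβ, Finset.sum_mul, h, Finset.mul_sum, Finset.sum_comm]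
    refine Finset.sum_congr rfl fun j _ => ?_
    rw [← mul_assoc, ← map_mul, hV', map_sum, Finset.sum_mul]
    refine Finset.sum_congr rfl fun i _ => ?_
    simp [mul_smul]
  -- The unit follows from `(id ⊗ ε)(R) = 1`; antimultiplicativity from `(id ⊗ Δ)(R) = R₁₃R₁₂` and
  -- `hcomm`; the rule for `lβ(v)` from `Δ^cop(h)R = RΔ(h)`; the coaction from `(Δ ⊗ id)(R) =
  -- R₁₃R₂₃`; the counit from `(ε ⊗ id)(R) = 1`.
  refine ⟨?_, ?_, hcomm, ?_, ?_, ?_⟩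
  · rw [hβ]
    have : ∀ x : H × H, inclLeft k V H (x.2 • (1 : V)) * inclRight k V H x.1
        = inclRight k V H (counit (R := k) x.2 • x.1) := by
      intro x
      rw [IsModuleAlgebra.smul_one' (k := k) x.2, AlgHom.commutes, map_smul, Algebra.smul_def]
    simp only [this]
    rw [← map_sum, hR.sum_smul_counit hS, map_one]
  · intro v w
    have h := hR.sum_tmul_comul hS (LinearMap.mul' k (SmashProduct k V H) ∘ₗ
      map ((inclLeft k V H).toLinearMap ∘ₗ smulMul k v w) (inclRight k V H).toLinearMap ∘ₗ
        (TensorProduct.comm k H (H ⊗[k] H)).toLinearMap)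
    simp only [LinearMap.comp_apply, LinearEquiv.coe_coe, comm_tmul, map_tmul,
      LinearMap.mul'_apply, ← IsModuleAlgebra.smul_mul', AlgHom.toLinearMap_apply,
      smulMul_tmul] at h
    rw [hβ, h, hβ v, Finset.mul_sum, Finset.sum_comm]
    refine Finset.sum_congr rfl fun j _ => ?_
    rw [← mul_assoc, ← hcomm, hβ w, Finset.mul_sum, Finset.sum_mul]
    refine Finset.sum_congr rfl fun i _ => ?_
    simp only [map_mul, mul_assoc]
  · intro h v
    have e := hR.comm_comul_mul_sum hS (LinearMap.mul' k (SmashProduct k V H) ∘ₗ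
      map ((inclLeft k V H).toLinearMap ∘ₗ smulAt k v) (inclRight k V H).toLinearMap ∘ₗ
        (TensorProduct.comm k H H).toLinearMap) h
    rw [hβ, Finset.mul_sum]
    refine Eq.trans ?_ (e.trans ?_)
    · refine Finset.sum_congr rfl fun i _ => ?_
      rw [← mul_assoc, inclRight_mul_inclLeft]
      generalize comul (R := k) h = s
      induction s with
      | zero => simp
      | add x y hx hy => simp only [map_add, add_mul, hx, hy]
      | tmul x y => simp [mul_smul, mul_assoc]
    · generalize comul (R := k) h = s
      induction s with
      | zero => simp
      | add x y hx hy => simp only [map_add, mul_add, Finset.sum_add_distrib, hx, hy]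
      | tmul x y => simp [hβ, mul_smul, mul_assoc, Finset.sum_mul]
  · intro v
    have h := hR.sum_comul_tmul hS ((TensorProduct.assoc k _ _ _).symm.toLinearMap ∘ₗ
      (smulAt k v).rTensor (H ⊗[k] H) ∘ₗ (TensorProduct.comm k (H ⊗[k] H) H).toLinearMap ∘ₗ
        (TensorProduct.assoc k H H H).symm.toLinearMap)
    have h' := congrArg ((ofTensor k V H).toLinearMap.rTensor H) h
    rw [map_sum, map_sum] at h'
    rw [hβ, map_sum, map_sum, map_sum]
    refine Eq.trans ?_ (h'.trans ?_)
    · refine Finset.sum_congr rfl fun i _ => ?_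
      rw [inclLeft_mul_inclRight, coaction_mk]
      generalize comul (R := k) i.1 = s
      induction s with
      | zero => simp
      | add x y hx hy => simp only [map_add, add_tmul, hx, hy]
      | tmul x y => simp [mkHom_apply, mk]
    · simp only [map_sum]
      rw [Finset.sum_comm]
      refine Finset.sum_congr rfl fun j _ => ?_
      rw [inclLeft_mul_inclRight]
      have e : (ofTensor k V H).symm (mk (j.2 • v) j.1) = (j.2 • v) ⊗ₜ j.1 := rfl
      rw [e, LinearMap.rTensor_tmul, hβ, sum_tmul]
      refine Finset.sum_congr rfl fun i _ => ?_
      simp [inclLeft_mul_inclRight, mul_smul, mk]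
  · intro v
    have e : ∀ x y : H, counitMap k V H (inclLeft k V H (y • v) * inclRight k V H x)
        = (counit (R := k) x • y) • v := by
      intro x y
      rw [inclLeft_mul_inclRight, counitMap_mk, smul_assoc]
    rw [hβ, map_sum]
    simp only [e]
    rw [← Finset.sum_smul, hR.sum_counit_smul hS, one_smul]

end

section

variable {k V L H : Type*} [Field k] [Ring V] [Algebra k V]
  [Ring L] [Bialgebra k L] [Module L V] [IsScalarTower k L V] [IsModuleAlgebra k L V]
  [Ring H] [Bialgebra k H] [Module H V] [IsScalarTower k H V] [IsModuleAlgebra k H V]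

/-- If `R ∈ ι(L) ⊗ H` for an injective map of bialgebras `ι : L → H`, then the target map of
`V # H` restricts to one of `V # L`. -/
theorem isBraidedTarget_targetOf_of_injective (ι : L →ₐ[k] H) (hι : Function.Injective ι)
    (hιΔ : ∀ x, comul (R := k) (ι x) = map ι.toLinearMap ι.toLinearMap (comul x))
    (hιε : ∀ x, counit (R := k) (ι x) = counit (R := k) x)
    (hιV : ∀ (x : L) (v : V), ι x • v = x • v) {R : H ⊗[k] H} {K : L ⊗[k] H}
    (hK : ι.toLinearMap.rTensor H K = R) (hR : IsBraidedTarget (targetOf (V := V) R)) :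
    IsBraidedTarget (targetOf (V := V) K) := by
  -- The algebra map `id # ι`. It is injective by flatness and carries the target map of `K` to that
  -- of `R`.
  let Φ : SmashProduct k V L →ₐ[k] SmashProduct k V H :=
    lift (inclLeft k V H) ((inclRight k V H).comp ι) (by
      intro l v
      rw [AlgHom.comp_apply, inclRight_mul_inclLeft, hιΔ]
      generalize comul (R := k) l = s
      induction s with
      | zero => simp
      | add x y hx hy => simp only [map_add, hx, hy]
      | tmul x y => simp [hιV])
  have hΦ : ∀ v l, Φ (mk v l) = mk v (ι l) := by
    intro v l
    rw [lift_mk, AlgHom.comp_apply, inclLeft_mul_inclRight]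
  have hΦ' : ∀ t, Φ t = ofTensor k V H (ι.toLinearMap.lTensor V ((ofTensor k V L).symm t)) := by
    intro t
    have : Φ.toLinearMap = (ofTensor k V H).toLinearMap ∘ₗ ι.toLinearMap.lTensor V ∘ₗ
        (ofTensor k V L).symm.toLinearMap := hom_ext fun v l => by
      rw [AlgHom.toLinearMap_apply, hΦ]
      rfl
    exact congr($this t)
  have hinj : Function.Injective Φ := by
    intro x y h
    rw [hΦ', hΦ'] at h
    exact (ofTensor k V L).symm.injective (Module.Flat.lTensor_preserves_injective_linearMap
      (M := V) ι.toLinearMap hι ((ofTensor k V H).injective h))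
  have hl : ∀ v, Φ (inclLeft k V L v) = inclLeft k V H v := fun v => by
    rw [inclLeft_apply, hΦ, map_one]
    rfl
  have hr : ∀ l, Φ (inclRight k V L l) = inclRight k V H (ι l) := fun l => hΦ 1 l
  have hβ : ∀ v, Φ (targetOf K v) = targetOf R v := by
    intro v
    rw [hΦ', targetOf_apply, targetOf_apply, ← hK]
    refine congrArg _ ?_
    rw [LinearEquiv.symm_apply_apply]
    clear hK
    induction K with
    | zero => simp
    | add x y hx hy => simp only [map_add, hx, hy]
    | tmul x y => simp
  clear_value Φ
  -- The first five conditions are checked after applying the injective map `Φ`, or `Φ ⊗ ι` for the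
  -- coaction. The counit condition needs no injectivity, since `Φ` preserves the counit map.
  refine ⟨?_, ?_, ?_, ?_, ?_, ?_⟩
  · apply hinj
    rw [hβ, hR.target_one, map_one]
  · intro v w
    apply hinj
    rw [map_mul Φ, hβ, hβ, hβ, hR.target_mul]
  · intro v w
    apply hinj
    rw [map_mul, map_mul, hβ, hl, hR.inclLeft_mul_target]
  · intro l v
    apply hinj
    rw [map_mul, hβ, hr, hR.inclRight_mul_target, hιΔ]
    generalize comul (R := k) l = s
    induction s with
    | zero => simp
    | add x y hx hy => simp only [map_add, hx, hy]
    | tmul x y => simp [hβ, hr, hιV]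
  · intro v
    have hinj2 : Function.Injective (map Φ.toLinearMap ι.toLinearMap) :=
      TensorProduct.map_injective_of_flat_flat _ _ hinj hι
    apply hinj2
    have e1 : ∀ t, map Φ.toLinearMap ι.toLinearMap (coaction k V L t)
        = coaction k V H (Φ t) := by
      intro t
      have : map Φ.toLinearMap ι.toLinearMap ∘ₗ coaction k V L
          = coaction k V H ∘ₗ Φ.toLinearMap := by
        refine hom_ext fun v l => ?_
        simp only [LinearMap.comp_apply, AlgHom.toLinearMap_apply, hΦ, coaction_mk, hιΔ]
        generalize comul (R := k) l = s
        induction s with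
        | zero => simp
        | add x y hx hy => simp only [map_add, hx, hy]
        | tmul x y => simp [mkHom_apply, hΦ]
      exact congr($this t)
    have e2 : ∀ s : V ⊗[k] L, map Φ.toLinearMap ι.toLinearMap ((targetOf K).rTensor L s)
        = (targetOf R).rTensor H (ι.toLinearMap.lTensor V s) := by
      intro s
      induction s with
      | zero => simp
      | add x y hx hy => simp only [map_add, hx, hy]
      | tmul x y => simp [hβ]
    have e3 : ι.toLinearMap.lTensor V ((ofTensor k V L).symm (targetOf K v))
        = (ofTensor k V H).symm (targetOf R v) := by
      rw [← hβ, hΦ', LinearEquiv.symm_apply_apply]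
    rw [e1, hβ, hR.coaction_target, e2, e3]
  · intro v
    have e : counitMap k V H ∘ₗ Φ.toLinearMap = counitMap k V L := hom_ext fun v l => by
      simp [hΦ, hιε]
    rw [← e, LinearMap.comp_apply, AlgHom.toLinearMap_apply, hβ, hR.counitMap_target]

end

end SmashProduct

/-! ### Inverses, op-cop and tensor products of `R`-matrices. -/

namespace IsRMatrix

section Inverse

variable {k H : Type*} [CommRing k] [Ring H] [Bialgebra k H] {R U : H ⊗[k] H}

/-- `Δ ⊗ id` is an algebra map, so it sends `U` to the inverse of `R₁₃R₂₃`, which is the product of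
inverses in reverse order. -/
lemma comul_rTensor_inv (hR : IsRMatrix k R) (hRU : R * U = 1) (hUR : U * R = 1) :
    TensorProduct.assoc k H H H ((comul (R := k)).rTensor H U)
      = Algebra.TensorProduct.includeRight (A := H) U *
        Algebra.TensorProduct.map (AlgHom.id k H) Algebra.TensorProduct.includeRight U := by
  let f : H ⊗[k] H →ₐ[k] H ⊗[k] (H ⊗[k] H) :=
    (Algebra.TensorProduct.assoc k k k H H H).toAlgHom.comp
      (Algebra.TensorProduct.map (comulAlgHom k H) (AlgHom.id k H))
  have hf : ∀ x, TensorProduct.assoc k H H H ((comul (R := k)).rTensor H x) = f x := fun _ => rfl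
  have h := hR.comul_rTensor
  rw [hf] at h ⊢
  refine left_inv_eq_right_inv (a := f R) ?_ ?_
  · rw [← map_mul, hUR, map_one]
  · rw [h, mul_assoc, ← mul_assoc (Algebra.TensorProduct.includeRight R), ← map_mul, hRU, map_one,
      one_mul, ← map_mul, hRU, map_one]

lemma comul_lTensor_inv (hR : IsRMatrix k R) (hRU : R * U = 1) (hUR : U * R = 1) :
    (comul (R := k)).lTensor H U
      = Algebra.TensorProduct.map (AlgHom.id k H) Algebra.TensorProduct.includeLeft U *
        Algebra.TensorProduct.map (AlgHom.id k H) Algebra.TensorProduct.includeRight U := by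
  let f : H ⊗[k] H →ₐ[k] H ⊗[k] (H ⊗[k] H) :=
    Algebra.TensorProduct.map (AlgHom.id k H) (comulAlgHom k H)
  have hf : ∀ x, (comul (R := k)).lTensor H x = f x := fun _ => rfl
  have h := hR.comul_lTensor
  rw [hf] at h ⊢
  refine left_inv_eq_right_inv (a := f R) ?_ ?_
  · rw [← map_mul, hUR, map_one]
  · rw [h, mul_assoc, ← mul_assoc (Algebra.TensorProduct.map (AlgHom.id k H)
      Algebra.TensorProduct.includeLeft R), ← map_mul, hRU, map_one,
      one_mul, ← map_mul, hRU, map_one]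

/-- The commutation axiom multiplied by `U` on both sides. -/
lemma comul_mul_inv (hR : IsRMatrix k R) (hRU : R * U = 1) (hUR : U * R = 1) (h : H) :
    comul (R := k) h * U = U * TensorProduct.comm k H H (comul h) := by
  calc comul (R := k) h * U = U * (R * comul h) * U := by
        rw [← mul_assoc, hUR, one_mul]
    _ = _ := by rw [← hR.comm_comul_mul, mul_assoc, mul_assoc, hRU, mul_one]

end Inverse

section OpCop

variable {k H : Type*} [CommRing k] [Ring H] [Bialgebra k H] {R U : H ⊗[k] H}

variable (k H) in
/-- The identity map `H → H^{op cop}`. -/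
def opCopEquiv : H ≃ₗ[k] Cop Hᵐᵒᵖ :=
  (MulOpposite.opLinearEquiv k).trans (Cop.toCop k Hᵐᵒᵖ)

lemma opCopEquiv_mul (x y : H) :
    opCopEquiv k H (x * y) = opCopEquiv k H y * opCopEquiv k H x := rfl

lemma opCopEquiv_one : opCopEquiv k H 1 = 1 := rfl

lemma comul_opCopEquiv (h : H) : comul (R := k) (opCopEquiv k H h)
    = map (opCopEquiv k H).toLinearMap (opCopEquiv k H).toLinearMap
      (TensorProduct.comm k H H (comul h)) := by
  have e : comul (R := k) (opCopEquiv k H h) = map (Cop.toCop k Hᵐᵒᵖ).toLinearMap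
      (Cop.toCop k Hᵐᵒᵖ).toLinearMap (TensorProduct.comm k _ _
        (map (MulOpposite.opLinearEquiv k).toLinearMap
          (MulOpposite.opLinearEquiv k).toLinearMap (comul (R := k) h))) := rfl
  rw [e]
  generalize comul (R := k) h = s
  induction s with
  | zero => simp
  | add x y hx hy => simp only [map_add, hx, hy]
  | tmul x y => rfl

/-- If `R` is an `R`-matrix of `H` with inverse `U`, and `c : H → H'` is an antiisomorphism of
algebras and coalgebras, then `∑ c(U²) ⊗ c(U¹)` is an `R`-matrix of `H'`. -/
theorem of_antiEquiv {H' : Type*} [Ring H'] [Bialgebra k H'] (c : H ≃ₗ[k] H')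
    (hcm : ∀ x y, c (x * y) = c y * c x) (hc1 : c 1 = 1)
    (hcΔ : ∀ h, comul (R := k) (c h)
      = map c.toLinearMap c.toLinearMap (TensorProduct.comm k H H (comul h)))
    (hR : IsRMatrix k R) (hRU : R * U = 1) (hUR : U * R = 1) :
    IsRMatrix k (map c.toLinearMap c.toLinearMap (TensorProduct.comm k H H U)) := by
  set F : H ⊗[k] H →ₗ[k] H' ⊗[k] H' :=
    map c.toLinearMap c.toLinearMap ∘ₗ
      (TensorProduct.comm k H H).toLinearMap with hF
  have hF0 : ∀ x y, F (x ⊗ₜ y) = c y ⊗ₜ c x := fun _ _ => rfl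
  have hFΔ : ∀ h, comul (R := k) (c h) = F (comul h) := hcΔ
  have hFm : ∀ x y, F (x * y) = F y * F x := by
    intro x y
    induction x with
    | zero => simp
    | add x y hx hy => simp only [map_add, mul_add, add_mul, hx, hy]
    | tmul x x' =>
      induction y with
      | zero => simp
      | add x y hx hy => simp only [map_add, mul_add, add_mul, hx, hy]
      | tmul y y' => simp [hF0, hcm]
  have hF1 : F 1 = 1 := by
    rw [Algebra.TensorProduct.one_def, hF0, hc1, Algebra.TensorProduct.one_def]
  -- Like `F`, this reverses the order of the legs and applies `c` to each, so it is an
  -- antihomomorphism.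
  let G : H ⊗[k] (H ⊗[k] H) →ₗ[k] H' ⊗[k] (H' ⊗[k] H') :=
    (TensorProduct.assoc k _ _ _).toLinearMap ∘ₗ (TensorProduct.comm k _ _).toLinearMap ∘ₗ
      map c.toLinearMap F
  have hG : ∀ x y z, G (x ⊗ₜ (y ⊗ₜ z))
      = c z ⊗ₜ (c y ⊗ₜ c x) := fun _ _ _ => rfl
  have hGm : ∀ x y, G (x * y) = G y * G x := by
    intro x y
    induction x with
    | zero => simp
    | add x y hx hy => simp only [map_add, mul_add, add_mul, hx, hy]
    | tmul x s =>
      induction y with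
      | zero => simp
      | add x y hx hy => simp only [map_add, mul_add, add_mul, hx, hy]
      | tmul y t =>
        induction s with
        | zero => simp
        | add x y hx hy => simp only [map_add, tmul_add, mul_add, add_mul, hx, hy]
        | tmul x' x'' =>
          induction t with
          | zero => simp
          | add x y hx hy => simp only [map_add, tmul_add, mul_add, add_mul, hx, hy]
          | tmul y' y'' => simp [hG, hcm]
  change IsRMatrix k (F U)
  clear_value F G
  -- Reversing three legs fixes the position 13 and exchanges 12 with 23, while `Δ ⊗ id` and `id ⊗
  -- Δ` trade places. Each coproduct identity for `F U` is therefore the image of the other one for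
  -- `U`.
  have e13 : ∀ s : H ⊗[k] H, Algebra.TensorProduct.map (AlgHom.id k (H'))
      Algebra.TensorProduct.includeRight (F s)
      = G (Algebra.TensorProduct.map (AlgHom.id k H) Algebra.TensorProduct.includeRight s) := by
    intro s
    induction s with
    | zero => simp
    | add x y hx hy => simp only [map_add, hx, hy]
    | tmul x y => simp [hF0, hG, hc1]
  have e23 : ∀ s : H ⊗[k] H, Algebra.TensorProduct.includeRight (F s)
      = G (Algebra.TensorProduct.map (AlgHom.id k H) Algebra.TensorProduct.includeLeft s) := by
    intro s
    induction s with
    | zero => simp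
    | add x y hx hy => simp only [map_add, hx, hy]
    | tmul x y => simp [hF0, hG, hc1]
  have e12 : ∀ s : H ⊗[k] H, Algebra.TensorProduct.map (AlgHom.id k (H'))
      Algebra.TensorProduct.includeLeft (F s)
      = G (Algebra.TensorProduct.includeRight s) := by
    intro s
    induction s with
    | zero => simp
    | add x y hx hy => simp only [map_add, hx, hy]
    | tmul x y => simp [hF0, hG, hc1]
  have ec : ∀ s : H ⊗[k] H, TensorProduct.comm k _ _ (F s) = F (TensorProduct.comm k H H s) := by
    intro s
    induction s with
    | zero => simp
    | add x y hx hy => simp only [map_add, hx, hy]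
    | tmul x y => simp [hF0]
  refine ⟨?_, ?_, ?_, ?_⟩
  · exact ⟨⟨F U, F R, by rw [← hFm, hRU, hF1], by rw [← hFm, hUR, hF1]⟩, rfl⟩
  · rw [e13, e23, ← hGm, ← hR.comul_lTensor_inv hRU hUR]
    generalize U = s
    induction s with
    | zero => simp
    | add x y hx hy => simp only [map_add, hx, hy]
    | tmul x y =>
      rw [hF0, LinearMap.rTensor_tmul, LinearMap.lTensor_tmul, hFΔ]
      generalize comul (R := k) y = t
      induction t with
      | zero => simp
      | add x y hx hy => simp only [map_add, add_tmul, tmul_add, hx, hy]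
      | tmul u w => simp [hF0, hG]
  · rw [e13, e12, ← hGm, ← hR.comul_rTensor_inv hRU hUR]
    generalize U = s
    induction s with
    | zero => simp
    | add x y hx hy => simp only [map_add, hx, hy]
    | tmul x y =>
      rw [hF0, LinearMap.rTensor_tmul, LinearMap.lTensor_tmul, hFΔ]
      generalize comul (R := k) x = t
      induction t with
      | zero => simp
      | add x y hx hy => simp only [map_add, add_tmul, tmul_add, hx, hy]
      | tmul u w => simp [hF0, hG]
  · intro h
    obtain ⟨h, rfl⟩ := c.surjective h
    rw [hFΔ, ec, ← hFm, ← hFm, hR.comul_mul_inv hRU hUR]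

/-- If `R` is an `R`-matrix of `H` with inverse `U`, then `∑ U² ⊗ U¹` is one of `H^{op cop}`. -/
theorem opCop (hR : IsRMatrix k R) (hRU : R * U = 1) (hUR : U * R = 1) :
    IsRMatrix k (map (opCopEquiv k H).toLinearMap (opCopEquiv k H).toLinearMap
      (TensorProduct.comm k H H U)) :=
  of_antiEquiv (opCopEquiv k H) opCopEquiv_mul opCopEquiv_one comul_opCopEquiv hR hRU hUR

end OpCop

section Tensor

variable {k H H' : Type*} [CommRing k] [Ring H] [Bialgebra k H] [Ring H'] [Bialgebra k H']

variable (k H H') in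
/-- The shuffle `(x ⊗ y ⊗ z) ⊗ (x' ⊗ y' ⊗ z') ↦ (x ⊗ x') ⊗ (y ⊗ y') ⊗ (z ⊗ z')`. -/
def shuffle : (H ⊗[k] (H ⊗[k] H)) ⊗[k] (H' ⊗[k] (H' ⊗[k] H')) →ₐ[k]
    (H ⊗[k] H') ⊗[k] ((H ⊗[k] H') ⊗[k] (H ⊗[k] H')) :=
  (Algebra.TensorProduct.map (AlgHom.id k (H ⊗[k] H'))
    (Algebra.TensorProduct.tensorTensorTensorComm k k k k H H H' H').toAlgHom).comp
    (Algebra.TensorProduct.tensorTensorTensorComm k k k k H (H ⊗[k] H) H' (H' ⊗[k] H')).toAlgHom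

@[simp] lemma shuffle_tmul (x y z : H) (x' y' z' : H') :
    shuffle k H H' ((x ⊗ₜ (y ⊗ₜ z)) ⊗ₜ (x' ⊗ₜ (y' ⊗ₜ z')))
      = (x ⊗ₜ x') ⊗ₜ ((y ⊗ₜ y') ⊗ₜ (z ⊗ₜ z')) := rfl

lemma shuffle_mul (x y : H ⊗[k] (H ⊗[k] H)) (x' y' : H' ⊗[k] (H' ⊗[k] H')) :
    shuffle k H H' ((x * y) ⊗ₜ (x' * y'))
      = shuffle k H H' (x ⊗ₜ x') * shuffle k H H' (y ⊗ₜ y') := by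
  rw [← map_mul, Algebra.TensorProduct.tmul_mul_tmul]

lemma tensorTensorTensorComm_mul (x y : H ⊗[k] H) (x' y' : H' ⊗[k] H') :
    TensorProduct.tensorTensorTensorComm k H H H' H' ((x * y) ⊗ₜ (x' * y'))
      = TensorProduct.tensorTensorTensorComm k H H H' H' (x ⊗ₜ x') *
        TensorProduct.tensorTensorTensorComm k H H H' H' (y ⊗ₜ y') := by
  rw [← Algebra.TensorProduct.tmul_mul_tmul]
  exact map_mul (Algebra.TensorProduct.tensorTensorTensorComm k k k k H H H' H') _ _

@[elab_as_elim] lemma tensor_induction₂ {p : H ⊗[k] H → H' ⊗[k] H' → Prop}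
    (hl : ∀ y, p 0 y) (hr : ∀ x, p x 0) (hal : ∀ x x' y, p x y → p x' y → p (x + x') y)
    (har : ∀ x y y', p x y → p x y' → p x (y + y'))
    (h : ∀ x x' y y', p (x ⊗ₜ x') (y ⊗ₜ y')) (R : H ⊗[k] H) (Q : H' ⊗[k] H') : p R Q := by
  induction R with
  | zero => exact hl _
  | add a b ha hb => exact hal _ _ _ ha hb
  | tmul x x' =>
    induction Q with
    | zero => exact hr _
    | add a b ha hb => exact har _ _ _ ha hb
    | tmul y y' => exact h _ _ _ _

lemma comul_tmul_eq (x : H) (y : H') : comul (R := k) (x ⊗ₜ[k] y)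
    = TensorProduct.tensorTensorTensorComm k H H H' H' (comul x ⊗ₜ comul y) :=
  TensorProduct.comul_tmul (R := k) (S := k) x y

/-- The tensor product of `R`-matrices. -/
theorem tensor {R : H ⊗[k] H} {Q : H' ⊗[k] H'} (hR : IsRMatrix k R) (hQ : IsRMatrix k Q) :
    IsRMatrix k (TensorProduct.tensorTensorTensorComm k H H H' H' (R ⊗ₜ Q)) := by
  set τ := TensorProduct.tensorTensorTensorComm k H H H' H' with hτ
  -- The 13, 12 and 23 embeddings of the tensor product are shuffles of those of the factors. As
  -- `shuffle` is an algebra map, the axioms can be verified factor by factor.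
  have e13 : ∀ (R : H ⊗[k] H) (Q : H' ⊗[k] H'),
      Algebra.TensorProduct.map (AlgHom.id k (H ⊗[k] H')) Algebra.TensorProduct.includeRight
        (τ (R ⊗ₜ Q)) = shuffle k H H'
      (Algebra.TensorProduct.map (AlgHom.id k H) Algebra.TensorProduct.includeRight R ⊗ₜ
        Algebra.TensorProduct.map (AlgHom.id k H') Algebra.TensorProduct.includeRight Q) := by
    intro R Q
    induction R, Q using tensor_induction₂
    · simp
    · simp
    · rename_i hx hy; simp only [map_add, add_tmul, hx, hy]
    · rename_i hx hy; simp only [map_add, tmul_add, hx, hy]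
    · simp [hτ, Algebra.TensorProduct.one_def]
  have e12 : ∀ (R : H ⊗[k] H) (Q : H' ⊗[k] H'),
      Algebra.TensorProduct.map (AlgHom.id k (H ⊗[k] H')) Algebra.TensorProduct.includeLeft
        (τ (R ⊗ₜ Q)) = shuffle k H H'
      (Algebra.TensorProduct.map (AlgHom.id k H) Algebra.TensorProduct.includeLeft R ⊗ₜ
        Algebra.TensorProduct.map (AlgHom.id k H') Algebra.TensorProduct.includeLeft Q) := by
    intro R Q
    induction R, Q using tensor_induction₂
    · simp
    · simp
    · rename_i hx hy; simp only [map_add, add_tmul, hx, hy]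
    · rename_i hx hy; simp only [map_add, tmul_add, hx, hy]
    · simp [hτ, Algebra.TensorProduct.one_def]
  have e23 : ∀ (R : H ⊗[k] H) (Q : H' ⊗[k] H'),
      Algebra.TensorProduct.includeRight (A := H ⊗[k] H')
        (τ (R ⊗ₜ Q)) = shuffle k H H'
      (Algebra.TensorProduct.includeRight (A := H) R ⊗ₜ
        Algebra.TensorProduct.includeRight (A := H') Q) := by
    intro R Q
    induction R, Q using tensor_induction₂
    · simp
    · simp
    · rename_i hx hy; simp only [map_add, add_tmul, hx, hy]
    · rename_i hx hy; simp only [map_add, tmul_add, hx, hy]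
    · simp [hτ, Algebra.TensorProduct.one_def]
  have ec : ∀ (R : H ⊗[k] H) (Q : H' ⊗[k] H'), TensorProduct.comm k _ _ (τ (R ⊗ₜ Q))
      = τ (TensorProduct.comm k H H R ⊗ₜ TensorProduct.comm k H' H' Q) := by
    intro R Q
    induction R, Q using tensor_induction₂
    · simp
    · simp
    · rename_i hx hy; simp only [map_add, add_tmul, hx, hy]
    · rename_i hx hy; simp only [map_add, tmul_add, hx, hy]
    · simp [hτ]
  refine ⟨?_, ?_, ?_, ?_⟩
  · obtain ⟨⟨R, R', h1, h2⟩, rfl⟩ := hR.isUnit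
    obtain ⟨⟨Q, Q', h3, h4⟩, rfl⟩ := hQ.isUnit
    have e1 : τ ((1 : H ⊗[k] H) ⊗ₜ (1 : H' ⊗[k] H')) = 1 := by
      simp [hτ, Algebra.TensorProduct.one_def]
    refine ⟨⟨τ (R ⊗ₜ Q), τ (R' ⊗ₜ Q'), ?_, ?_⟩, rfl⟩
    · rw [hτ, ← tensorTensorTensorComm_mul, h1, h3, ← hτ, e1]
    · rw [hτ, ← tensorTensorTensorComm_mul, h2, h4, ← hτ, e1]
  · rw [e13, e23, ← shuffle_mul, ← hR.comul_rTensor, ← hQ.comul_rTensor]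
    clear hR hQ
    induction R, Q using tensor_induction₂
    · simp
    · simp
    · rename_i hx hy; simp only [map_add, add_tmul, hx, hy]
    · rename_i hx hy; simp only [map_add, tmul_add, hx, hy]
    · rename_i x x' y y'
      simp only [hτ, TensorProduct.tensorTensorTensorComm_tmul, LinearMap.rTensor_tmul,
        comul_tmul_eq]
      generalize comul (R := k) x = R
      generalize comul (R := k) y = Q
      induction R, Q using tensor_induction₂
      · simp
      · simp
      · rename_i hx hy; simp only [map_add, add_tmul, hx, hy]
      · rename_i hx hy; simp only [map_add, tmul_add, add_tmul, hx, hy]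
      · simp
  · rw [e13, e12, ← shuffle_mul, ← hR.comul_lTensor, ← hQ.comul_lTensor]
    clear hR hQ
    induction R, Q using tensor_induction₂
    · simp
    · simp
    · rename_i hx hy; simp only [map_add, add_tmul, hx, hy]
    · rename_i hx hy; simp only [map_add, tmul_add, hx, hy]
    · rename_i x x' y y'
      simp only [hτ, TensorProduct.tensorTensorTensorComm_tmul, LinearMap.lTensor_tmul,
        comul_tmul_eq]
      generalize comul (R := k) x' = R
      generalize comul (R := k) y' = Q
      induction R, Q using tensor_induction₂
      · simp
      · simp
      · rename_i hx hy; simp only [map_add, tmul_add, add_tmul, hx, hy]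
      · rename_i hx hy; simp only [map_add, tmul_add, hx, hy]
      · simp
  · intro h
    induction h with
    | zero => simp
    | add x y hx hy => simp only [map_add, add_mul, mul_add, hx, hy]
    | tmul x y =>
      rw [comul_tmul_eq, ← hτ, ec, hτ, ← tensorTensorTensorComm_mul, ← tensorTensorTensorComm_mul,
        hR.comm_comul_mul, hQ.comm_comul_mul]

end Tensor

end IsRMatrix

/-! ### The canonical element of `A ⊗ A*` as the identity of `Hom(A, A)`. -/

namespace HDual

section Eval

variable (k A : Type*) [Field k] [Ring A] [Bialgebra k A]

/-- Evaluation `M ⊗ A* → M` of the second factor at `x`. -/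
def evalRight (M : Type*) [AddCommGroup M] [Module k M] (x : A) : M ⊗[k] HDual k A →ₗ[k] M :=
  (TensorProduct.rid k M).toLinearMap ∘ₗ (ev k A x).lTensor M

variable {k A}
variable {M N : Type*} [AddCommGroup M] [Module k M] [AddCommGroup N] [Module k N]

@[simp] lemma evalRight_tmul (x : A) (m : M) (p : HDual k A) :
    evalRight k A M x (m ⊗ₜ p) = p x • m := by
  simp [evalRight]

lemma evalRight_rTensor (f : M →ₗ[k] N) (x : A) (s : M ⊗[k] HDual k A) :
    evalRight k A N x (f.rTensor _ s) = f (evalRight k A M x s) := by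
  induction s with
  | zero => simp
  | add s t hs ht => simp only [map_add, hs, ht]
  | tmul m p => simp

lemma evalRight_lTensor_lhit (a x : A) (s : M ⊗[k] HDual k A) :
    evalRight k A M x ((lhit k A a).lTensor _ s) = evalRight k A M (x * a) s := by
  induction s with
  | zero => simp
  | add s t hs ht => simp only [map_add, hs, ht]
  | tmul m p => simp

lemma evalRight_lTensor_rhit (a x : A) (s : M ⊗[k] HDual k A) :
    evalRight k A M x ((rhit k A a).lTensor _ s) = evalRight k A M (a * x) s := by
  induction s with
  | zero => simp
  | add s t hs ht => simp only [map_add, hs, ht]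
  | tmul m p => simp

/-- For finite-dimensional `A` the space `M ⊗ A*` is `Hom(A, M)`. Identities about the canonical
element are proved by evaluating at points of `A`. -/
lemma ext_evalRight [Module.Finite k A] {s t : M ⊗[k] HDual k A}
    (h : ∀ x, evalRight k A M x s = evalRight k A M x t) : s = t := by
  apply (TensorProduct.comm k M (HDual k A)).injective
  apply ext_tensor
  have e : ∀ (x : A) (s : M ⊗[k] HDual k A), TensorProduct.lid k M ((ev k A x).rTensor M
      (TensorProduct.comm k M (HDual k A) s)) = evalRight k A M x s := by
    intro x s
    induction s with
    | zero => simp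
    | add s t hs ht => simp only [map_add, hs, ht]
    | tmul m p => simp
  intro x
  rw [e, e, h x]

section Algebra

variable {B : Type*} [Ring B] [Algebra k B]

/-- The algebra `B ⊗ A*` is the convolution algebra `Hom(A, B)`. -/
lemma evalRight_mul (s t : B ⊗[k] HDual k A) {x : A} {ι : Type*} (r : Coalgebra.Repr k x ι) :
    evalRight k A B x (s * t) = ∑ i ∈ r.index,
      evalRight k A B (r.left i) s * evalRight k A B (r.right i) t := by
  induction s with
  | zero => simp
  | add s s' hs ht => simp only [add_mul, map_add, hs, ht, Finset.sum_add_distrib]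
  | tmul b p =>
    induction t with
    | zero => simp
    | add s s' hs ht => simp only [mul_add, map_add, hs, ht, Finset.sum_add_distrib]
    | tmul c q =>
      simp [mul_apply_repr _ _ r, Finset.sum_smul, smul_smul, mul_comm]

lemma evalRight_one (x : A) :
    evalRight k A B x 1 = algebraMap k B (counit (R := k) x) := by
  rw [Algebra.TensorProduct.one_def]
  simp [Algebra.algebraMap_eq_smul_one]

lemma evalRight_includeLeft_mul (b : B) (s : B ⊗[k] HDual k A) (x : A) :
    evalRight k A B x (b ⊗ₜ 1 * s) = b * evalRight k A B x s := by
  induction s with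
  | zero => simp
  | add s t hs ht => simp only [mul_add, map_add, hs, ht]
  | tmul c p => simp

lemma evalRight_mul_includeLeft (b : B) (s : B ⊗[k] HDual k A) (x : A) :
    evalRight k A B x (s * b ⊗ₜ 1) = evalRight k A B x s * b := by
  induction s with
  | zero => simp
  | add s t hs ht => simp only [add_mul, map_add, hs, ht]
  | tmul c p => simp

end Algebra

end Eval

section Canonical

variable (k A : Type*) [Field k] [Ring A] [Bialgebra k A] [Module.Finite k A]

/-- The canonical element `∑ eᵢ ⊗ eⁱ` of `A ⊗ A*`. -/
def canonical : A ⊗[k] HDual k A :=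
  ∑ i, Module.finBasis k A i ⊗ₜ (toDual k A).symm ((Module.finBasis k A).coord i)

variable {k A}

-- The canonical element corresponds to the identity map of `A`; all properties below are read off
-- from this.
@[simp] lemma evalRight_canonical (x : A) : evalRight k A A x (canonical k A) = x := by
  simp only [canonical, map_sum, evalRight_tmul, toDual_symm_apply, Module.Basis.coord_apply]
  exact (Module.finBasis k A).sum_repr x

/-- At `x` both sides are `ax`. This and the three lemmas after it move a multiplication on one leg
of the canonical element to an action on the other leg. -/
lemma tmul_one_mul_canonical (a : A) :
    (a ⊗ₜ 1) * canonical k A = (rhit k A a).lTensor A (canonical k A) := by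
  apply ext_evalRight
  intro x
  rw [evalRight_includeLeft_mul, evalRight_lTensor_rhit]
  simp

lemma canonical_mul_tmul_one (a : A) :
    canonical k A * (a ⊗ₜ 1) = (lhit k A a).lTensor A (canonical k A) := by
  apply ext_evalRight
  intro x
  rw [evalRight_mul_includeLeft, evalRight_lTensor_lhit]
  simp

lemma one_tmul_mul_canonical (p : HDual k A) :
    (1 ⊗ₜ p) * canonical k A
      = (rightAct k A (MulOpposite.op p)).rTensor _ (canonical k A) := by
  apply ext_evalRight
  intro x
  rw [evalRight_mul _ _ (ℛ k x), evalRight_rTensor, evalRight_canonical,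
    rightAct_apply _ (ℛ k x)]
  simp

lemma canonical_mul_one_tmul (p : HDual k A) :
    canonical k A * (1 ⊗ₜ p) = (leftAct k A p).rTensor _ (canonical k A) := by
  apply ext_evalRight
  intro x
  rw [evalRight_mul _ _ (ℛ k x), evalRight_rTensor, evalRight_canonical,
    leftAct_apply _ (ℛ k x)]
  simp

/-- At `x` this says `Δ(x) = ∑ (x₁ ⊗ 1)(1 ⊗ x₂)`. -/
lemma comul_rTensor_canonical :
    (comul (R := k)).rTensor (HDual k A) (canonical k A)
      = Algebra.TensorProduct.map (Algebra.TensorProduct.includeLeft : A →ₐ[k] A ⊗[k] A)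
          (AlgHom.id k _) (canonical k A) *
        Algebra.TensorProduct.map Algebra.TensorProduct.includeRight (AlgHom.id k _)
          (canonical k A) := by
  apply ext_evalRight
  intro x
  have e : ∀ (f : A →ₐ[k] A ⊗[k] A) (y : A), evalRight k A (A ⊗[k] A) y
      (Algebra.TensorProduct.map f (AlgHom.id k _) (canonical k A)) = f y := by
    intro f y
    have := evalRight_rTensor f.toLinearMap y (canonical k A)
    rw [evalRight_canonical] at this
    exact this
  rw [evalRight_rTensor, evalRight_canonical, evalRight_mul _ _ (ℛ k x)]
  simp only [e]
  rw [← (ℛ k x).eq]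
  simp

/-- Evaluating the two dual legs at `x` and `y` gives `xy` on both sides, because the coproduct of
`A*` is dual to the product of `A`. The reassociation by `α` allows the last leg to be evaluated
first. -/
lemma comul_lTensor_canonical :
    (comul (R := k)).lTensor A (canonical k A)
      = Algebra.TensorProduct.map (AlgHom.id k _) Algebra.TensorProduct.includeLeft
          (canonical k A) *
        Algebra.TensorProduct.map (AlgHom.id k _) Algebra.TensorProduct.includeRight
          (canonical k A) := by
  let α := (Algebra.TensorProduct.assoc k k k A (HDual k A) (HDual k A)).symm
  apply α.injective
  rw [map_mul]
  have h1 : ∀ s : A ⊗[k] HDual k A, α (Algebra.TensorProduct.map (AlgHom.id k _)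
      Algebra.TensorProduct.includeLeft s) = s ⊗ₜ 1 := by
    intro s
    induction s with
    | zero => simp
    | add s t hs ht => simp only [map_add, add_tmul, hs, ht]
    | tmul a p => rfl
  have h2 : ∀ s : A ⊗[k] HDual k A, α (Algebra.TensorProduct.map (AlgHom.id k _)
      Algebra.TensorProduct.includeRight s)
      = (Algebra.TensorProduct.includeLeft :
          A →ₐ[k] A ⊗[k] HDual k A).toLinearMap.rTensor _ s := by
    intro s
    induction s with
    | zero => simp
    | add s t hs ht => simp only [map_add, hs, ht]
    | tmul a p => rfl
  have h3 : ∀ (x y : A) (s : A ⊗[k] HDual k A), evalRight k A A x (evalRight k A _ y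
      (α ((comul (R := k)).lTensor A s))) = evalRight k A A (x * y) s := by
    intro x y s
    induction s with
    | zero => simp
    | add s t hs ht => simp only [map_add, hs, ht]
    | tmul a p =>
      rw [evalRight_tmul, ← ev₂_comul, LinearMap.lTensor_tmul]
      generalize comul (R := k) p = t
      induction t with
      | zero => simp
      | add s t hs ht => simp only [tmul_add, map_add, add_smul, hs, ht]
      | tmul p q =>
        have : α (a ⊗ₜ (p ⊗ₜ q)) = (a ⊗ₜ p) ⊗ₜ q := rfl
        rw [this]
        simp [smul_smul, mul_comm]
  apply ext_evalRight
  intro y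
  apply ext_evalRight
  intro x
  rw [h3, h1, h2, evalRight_includeLeft_mul, evalRight_rTensor, evalRight_canonical]
  erw [evalRight_mul_includeLeft]
  rw [evalRight_canonical, evalRight_canonical]

end Canonical

section Inverse

variable {k A : Type*} [Field k] [Ring A] [HopfAlgebra k A] [Module.Finite k A]

/-- In `Hom(A, A)` the two factors are the identity and `S`, which are convolution inverses. -/
lemma canonical_mul_antipode_canonical :
    canonical k A * (antipode k).rTensor _ (canonical k A) = 1 := by
  apply ext_evalRight
  intro x
  rw [evalRight_mul _ _ (ℛ k x), evalRight_one]
  simp only [evalRight_rTensor, evalRight_canonical]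
  exact sum_mul_antipode_eq_algebraMap_counit (ℛ k x)

lemma antipode_canonical_mul_canonical :
    (antipode k).rTensor _ (canonical k A) * canonical k A = 1 := by
  apply ext_evalRight
  intro x
  rw [evalRight_mul _ _ (ℛ k x), evalRight_one]
  simp only [evalRight_rTensor, evalRight_canonical]
  exact sum_antipode_mul_eq_algebraMap_counit (ℛ k x)

end Inverse

end HDual

/-! ### The `R`-matrix of the Drinfeld double. -/

namespace DrinfeldDouble

variable {k A : Type*} [Field k] [Ring A] [HopfAlgebra k A] [Module.Finite k A]

variable (k A) in
/-- The algebra map `A ⊗ A* → D(A) ⊗ D(A)`. -/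
def inclTensor : A ⊗[k] HDual k A →ₐ[k] DrinfeldDouble k A ⊗[k] DrinfeldDouble k A :=
  Algebra.TensorProduct.map (inclA k A) (inclDual k A)

@[simp] lemma inclTensor_tmul (a : A) (p : HDual k A) :
    inclTensor k A (a ⊗ₜ p) = inclA k A a ⊗ₜ inclDual k A p := rfl

lemma rMatrix_eq : rMatrix k A = inclTensor k A (HDual.canonical k A) := by
  simp only [HDual.canonical, map_sum]
  rfl

variable (k A) in
/-- The inverse `∑ (ε ⊗ S(eᵢ)) ⊗ (eⁱ ⊗ 1)` of the `R`-matrix of `D(A)`. -/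
def rMatrixInv : DrinfeldDouble k A ⊗[k] DrinfeldDouble k A :=
  inclTensor k A ((antipode k).rTensor _ (HDual.canonical k A))

lemma rMatrix_mul_inv : rMatrix k A * rMatrixInv k A = 1 := by
  rw [rMatrix_eq, rMatrixInv, ← map_mul, HDual.canonical_mul_antipode_canonical, map_one]

lemma inv_mul_rMatrix : rMatrixInv k A * rMatrix k A = 1 := by
  rw [rMatrix_eq, rMatrixInv, ← map_mul, HDual.antipode_canonical_mul_canonical, map_one]

lemma isUnit_rMatrix : IsUnit (rMatrix k A) :=
  ⟨⟨_, _, rMatrix_mul_inv, inv_mul_rMatrix⟩, rfl⟩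

lemma inverse_rMatrix : Ring.inverse (rMatrix k A) = rMatrixInv k A :=
  Ring.inverse_unit ⟨_, _, rMatrix_mul_inv (k := k) (A := A), inv_mul_rMatrix⟩

/-- Moving the first-leg factors to the second leg turns the two sides into `∑ eᵢ ⊗ b₁(eⁱ ↼ b₂)` and
`∑ eᵢ ⊗ (b₁ ⇀ eⁱ)b₂`, which agree by the cross relation `crossL_comul` of `D(A)`. -/
lemma comul_inclA_mul_rMatrix (b : A) :
    TensorProduct.comm k _ _ (comul (R := k) (inclA k A b)) * rMatrix k A
      = rMatrix k A * comul (inclA k A b) := by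
  have hl : ∀ s : A ⊗[k] HDual k A, ∀ x y : A, (inclA k A y ⊗ₜ[k] inclA k A x) *
      inclTensor k A s = (1 ⊗ₜ inclA k A x) * inclTensor k A ((y ⊗ₜ 1) * s) := by
    intro s x y
    rw [map_mul, ← mul_assoc]
    simp
  have hr : ∀ s : A ⊗[k] HDual k A, ∀ x y : A,
      inclTensor k A s * (inclA k A x ⊗ₜ[k] inclA k A y)
        = inclTensor k A (s * (x ⊗ₜ 1)) * (1 ⊗ₜ inclA k A y) := by
    intro s x y
    rw [map_mul, mul_assoc]
    simp
  -- Once the factors have been moved, the canonical element plays no role and may be any tensor.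
  have key : ∀ s : A ⊗[k] HDual k A,
      ∑ i ∈ (ℛ k b).index, (1 ⊗ₜ inclA k A ((ℛ k b).left i)) *
        inclTensor k A ((HDual.rhit k A ((ℛ k b).right i)).lTensor A s)
      = ∑ i ∈ (ℛ k b).index, inclTensor k A ((HDual.lhit k A ((ℛ k b).left i)).lTensor A s) *
        (1 ⊗ₜ inclA k A ((ℛ k b).right i)) := by
    intro s
    induction s with
    | zero => simp
    | add s t hs ht => simp only [map_add, mul_add, add_mul, Finset.sum_add_distrib, hs, ht]
    | tmul a p =>
      have h := crossL_comul p b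
      rw [← (ℛ k b).eq] at h
      simp only [map_sum, crossL_tmul, crossR_tmul] at h
      simp only [LinearMap.lTensor_tmul, inclTensor_tmul, Algebra.TensorProduct.tmul_mul_tmul,
        one_mul, mul_one, ← tmul_sum, h]
  rw [rMatrix_eq, comul_inclA, ← (ℛ k b).eq]
  simp only [map_sum, map_tmul, AlgHom.toLinearMap_apply, TensorProduct.comm_tmul,
    Finset.sum_mul, Finset.mul_sum, hl, hr, HDual.tmul_one_mul_canonical,
    HDual.canonical_mul_tmul_one]
  exact key _

/-- The mirror argument: factors move from the second leg to the first, and what remains is `∑ p₁(a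
↼ p₂) = ∑ (p₁ ⇀ a)p₂` in `D(A)`. -/
lemma comul_inclDual_mul_rMatrix (p : HDual k A) :
    TensorProduct.comm k _ _ (comul (R := k) (inclDual k A p)) * rMatrix k A
      = rMatrix k A * comul (inclDual k A p) := by
  have hl : ∀ s : A ⊗[k] HDual k A, ∀ q q' : HDual k A,
      (inclDual k A q ⊗ₜ[k] inclDual k A q') * inclTensor k A s
        = (inclDual k A q ⊗ₜ 1) * inclTensor k A ((1 ⊗ₜ q') * s) := by
    intro s x y
    rw [map_mul, ← mul_assoc]
    simp
  have hr : ∀ s : A ⊗[k] HDual k A, ∀ q q' : HDual k A,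
      inclTensor k A s * (inclDual k A q' ⊗ₜ[k] inclDual k A q)
        = inclTensor k A (s * (1 ⊗ₜ q)) * (inclDual k A q' ⊗ₜ 1) := by
    intro s x y
    rw [map_mul, mul_assoc]
    simp
  -- Expressing the regular actions of `A` on `p` through `Δ(p)` identifies the remaining identity
  -- with `crossL_comul` again.
  have hlhit : ∀ x : A, ∑ i ∈ (ℛ k p).index, (ℛ k p).right i x • (ℛ k p).left i
      = HDual.lhit k A x p := by
    intro x
    ext y
    rw [HDual.lhit_apply, ← HDual.ev₂_comul, ← (ℛ k p).eq, ← HDual.ev_apply k A y]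
    simp [mul_comm]
  have hrhit : ∀ x : A, ∑ i ∈ (ℛ k p).index, (ℛ k p).left i x • (ℛ k p).right i
      = HDual.rhit k A x p := by
    intro x
    ext y
    rw [HDual.rhit_apply, ← HDual.ev₂_comul, ← (ℛ k p).eq, ← HDual.ev_apply k A y]
    simp
  have key : ∀ s : A ⊗[k] HDual k A,
      ∑ i ∈ (ℛ k p).index, (inclDual k A ((ℛ k p).left i) ⊗ₜ 1) *
        inclTensor k A
          ((HDual.rightAct k A (MulOpposite.op ((ℛ k p).right i))).rTensor _ s)
      = ∑ i ∈ (ℛ k p).index,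
        inclTensor k A ((HDual.leftAct k A ((ℛ k p).left i)).rTensor _ s) *
        (inclDual k A ((ℛ k p).right i) ⊗ₜ 1) := by
    intro s
    induction s with
    | zero => simp
    | add s t hs ht => simp only [map_add, mul_add, add_mul, Finset.sum_add_distrib, hs, ht]
    | tmul a q =>
      have h := crossL_comul p a
      rw [← (ℛ k a).eq] at h
      simp only [map_sum, crossL_tmul, crossR_tmul, ← hlhit, ← hrhit, map_smul,
        Finset.mul_sum, Finset.sum_mul, smul_mul_assoc, mul_smul_comm] at h
      simp only [LinearMap.rTensor_tmul, inclTensor_tmul, Algebra.TensorProduct.tmul_mul_tmul,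
        one_mul, mul_one, ← sum_tmul, HDual.rightAct_apply _ (ℛ k a),
        HDual.leftAct_apply _ (ℛ k a), map_sum, map_smul, Finset.mul_sum, Finset.sum_mul,
        smul_mul_assoc, mul_smul_comm]
      rw [Finset.sum_comm, ← h, Finset.sum_comm]
  rw [rMatrix_eq, comul_inclDual, ← (ℛ k p).eq]
  simp only [map_sum, map_tmul, AlgHom.toLinearMap_apply, TensorProduct.comm_tmul,
    Finset.sum_mul, Finset.mul_sum, hl, hr, HDual.one_tmul_mul_canonical,
    HDual.canonical_mul_one_tmul]
  exact key _

/-- `R` is an `R`-matrix of `D(A)`. -/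
theorem isRMatrix_rMatrix : IsRMatrix k (rMatrix k A) := by
  refine ⟨isUnit_rMatrix, ?_, ?_, ?_⟩
  · let α : (A ⊗[k] A) ⊗[k] HDual k A →ₐ[k]
        DrinfeldDouble k A ⊗[k] (DrinfeldDouble k A ⊗[k] DrinfeldDouble k A) :=
      (Algebra.TensorProduct.map (inclA k A) (inclTensor k A)).comp
        (Algebra.TensorProduct.assoc k k k A A (HDual k A)).toAlgHom
    have h0 : ∀ s : A ⊗[k] HDual k A, TensorProduct.assoc k _ _ _
        ((comul (R := k)).rTensor _ (inclTensor k A s)) = α (comul.rTensor _ s) := by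
      intro s
      induction s with
      | zero => simp
      | add s t hs ht => simp only [map_add, hs, ht]
      | tmul a p =>
        rw [inclTensor_tmul, LinearMap.rTensor_tmul, LinearMap.rTensor_tmul, comul_inclA]
        generalize comul (R := k) a = t
        induction t with
        | zero => simp
        | add s t hs ht => simp only [map_add, add_tmul, hs, ht]
        | tmul a b => rfl
    have h1 : ∀ s : A ⊗[k] HDual k A, α (Algebra.TensorProduct.map
        (Algebra.TensorProduct.includeLeft : A →ₐ[k] A ⊗[k] A) (AlgHom.id k _) s)
        = Algebra.TensorProduct.map (AlgHom.id k _) Algebra.TensorProduct.includeRight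
          (inclTensor k A s) := by
      intro s
      induction s with
      | zero => simp
      | add s t hs ht => simp only [map_add, hs, ht]
      | tmul a p => simp [α]
    have h2 : ∀ s : A ⊗[k] HDual k A, α (Algebra.TensorProduct.map
        Algebra.TensorProduct.includeRight (AlgHom.id k _) s)
        = Algebra.TensorProduct.includeRight (inclTensor k A s) := by
      intro s
      induction s with
      | zero => simp
      | add s t hs ht => simp only [map_add, hs, ht]
      | tmul a p => simp [α]
    rw [rMatrix_eq, h0, HDual.comul_rTensor_canonical, map_mul, h1, h2]
  -- The coproduct of `D(A)` is flipped on `A*`; the flip inside `α` turns the order 12, 13 of the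
  -- canonical element into 13, 12.
  · let α : A ⊗[k] (HDual k A ⊗[k] HDual k A) →ₐ[k]
        DrinfeldDouble k A ⊗[k] (DrinfeldDouble k A ⊗[k] DrinfeldDouble k A) :=
      Algebra.TensorProduct.map (inclA k A)
        ((Algebra.TensorProduct.map (inclDual k A) (inclDual k A)).comp
          (Algebra.TensorProduct.comm k (HDual k A) (HDual k A)).toAlgHom)
    have h0 : ∀ s : A ⊗[k] HDual k A,
        (comul (R := k)).lTensor _ (inclTensor k A s) = α (comul.lTensor _ s) := by
      intro s
      induction s with
      | zero => simp
      | add s t hs ht => simp only [map_add, hs, ht]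
      | tmul a p =>
        rw [inclTensor_tmul, LinearMap.lTensor_tmul, LinearMap.lTensor_tmul, comul_inclDual]
        rfl
    have h1 : ∀ s : A ⊗[k] HDual k A, α (Algebra.TensorProduct.map (AlgHom.id k _)
        Algebra.TensorProduct.includeLeft s)
        = Algebra.TensorProduct.map (AlgHom.id k _) Algebra.TensorProduct.includeRight
          (inclTensor k A s) := by
      intro s
      induction s with
      | zero => simp
      | add s t hs ht => simp only [map_add, hs, ht]
      | tmul a p => simp [α]
    have h2 : ∀ s : A ⊗[k] HDual k A, α (Algebra.TensorProduct.map (AlgHom.id k _)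
        Algebra.TensorProduct.includeRight s)
        = Algebra.TensorProduct.map (AlgHom.id k _) Algebra.TensorProduct.includeLeft
          (inclTensor k A s) := by
      intro s
      induction s with
      | zero => simp
      | add s t hs ht => simp only [map_add, hs, ht]
      | tmul a p => simp [α]
    rw [rMatrix_eq, h0, HDual.comul_lTensor_canonical, map_mul, h1, h2]
  · intro h
    obtain ⟨s, rfl⟩ := (ofTensor k A).surjective h
    induction s with
    | zero => simp
    | add s t hs ht => simp only [map_add, add_mul, mul_add, hs, ht]
    | tmul p a =>
      change TensorProduct.comm k _ _ (comul (R := k) (mk p a)) * rMatrix k A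
        = rMatrix k A * comul (mk p a)
      have hc : ∀ s t : DrinfeldDouble k A ⊗[k] DrinfeldDouble k A,
          TensorProduct.comm k _ _ (s * t)
            = TensorProduct.comm k _ _ s * TensorProduct.comm k _ _ t :=
        map_mul (Algebra.TensorProduct.comm k (DrinfeldDouble k A) (DrinfeldDouble k A))
      -- The commutation relation is multiplicative in `h`, and `p ⊗ a` is the product of `p` and
      -- `a`.
      rw [← inclDual_mul_inclA, Bialgebra.comul_mul, hc, mul_assoc, comul_inclA_mul_rMatrix,
        ← mul_assoc, comul_inclDual_mul_rMatrix, mul_assoc]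

end DrinfeldDouble

/-! ### The `R`-matrix of `D(A) ⊗ D(A)^{op cop}`. -/

namespace DoubleEnvelope

variable {k A : Type*} [Field k] [Ring A] [HopfAlgebra k A] [Module.Finite k A]

lemma rMatrix_eq : DoubleEnvelope.rMatrix k A =
    TensorProduct.tensorTensorTensorComm k _ _ _ _ (DrinfeldDouble.rMatrix k A ⊗ₜ
      map (toOpCop k A).toLinearMap (toOpCop k A).toLinearMap
        (TensorProduct.comm k _ _ (DrinfeldDouble.rMatrixInv k A))) := by
  rw [DoubleEnvelope.rMatrix, DrinfeldDouble.inverse_rMatrix]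

/-- It is the tensor product of `R` with the flipped inverse of `R`, which is an `R`-matrix of the
op-cop. -/
theorem isRMatrix_rMatrix : IsRMatrix k (DoubleEnvelope.rMatrix k A) := by
  rw [rMatrix_eq]
  exact IsRMatrix.tensor DrinfeldDouble.isRMatrix_rMatrix
    (IsRMatrix.opCop DrinfeldDouble.isRMatrix_rMatrix DrinfeldDouble.rMatrix_mul_inv
      DrinfeldDouble.inv_mul_rMatrix)

end DoubleEnvelope

/-! ### The Heisenberg double as the dual of `D(A)` with an `R`-twisted product. -/

namespace HDual

variable {k A : Type*} [Field k] [Ring A] [Bialgebra k A]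

lemma map_sum_apply {ι : Type*} (p : HDual k A) (s : Finset ι) (f : ι → A) :
    p (∑ i ∈ s, f i) = ∑ i ∈ s, p (f i) :=
  map_sum (toDual k A p) f s

lemma sum_repr_mul_apply [Module.Finite k A] {ι : Type*} {p : HDual k A}
    (r : Coalgebra.Repr k p ι) (x y : A) :
    ∑ i ∈ r.index, r.left i x * r.right i y = p (x * y) := by
  rw [← ev₂_comul, ← r.eq]
  simp

end HDual

namespace Heisenberg

variable {k A : Type*} [Field k] [Ring A] [HopfAlgebra k A] [Module.Finite k A]

/-- The linear form `v ⊗ w` on `D(A) ⊗ D(A)`. -/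
def pairing (v w : Heisenberg k A) : DrinfeldDouble k A ⊗[k] DrinfeldDouble k A →ₗ[k] k :=
  LinearMap.mul' k k ∘ₗ map (toDoubleDual k A v) (toDoubleDual k A w)

@[simp] lemma pairing_tmul (v w : Heisenberg k A) (x y : DrinfeldDouble k A) :
    pairing v w (x ⊗ₜ y) = toDoubleDual k A v x * toDoubleDual k A w y := rfl

lemma pairing_comm (v w : Heisenberg k A) (s : DrinfeldDouble k A ⊗[k] DrinfeldDouble k A) :
    pairing v w (TensorProduct.comm k _ _ s) = pairing w v s := by
  induction s with
  | zero => simp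
  | add s t hs ht => simp only [map_add, hs, ht]
  | tmul x y => simp [mul_comm]

@[elab_as_elim]
lemma induction_mk {P : Heisenberg k A → Prop} (v : Heisenberg k A) (h0 : P 0)
    (hadd : ∀ v w, P v → P w → P (v + w)) (hmk : ∀ a f, P (SmashProduct.mk a f)) : P v := by
  obtain ⟨s, rfl⟩ := (SmashProduct.ofTensor k A (HDual k A)).surjective v
  induction s with
  | zero => rw [map_zero]; exact h0
  | add s t hs ht => rw [map_add]; exact hadd _ _ hs ht
  | tmul a f => exact hmk a f

lemma toDoubleDual_one (z : DrinfeldDouble k A) :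
    toDoubleDual k A 1 z = counit (R := k) z := by
  obtain ⟨s, rfl⟩ := (DrinfeldDouble.ofTensor k A).surjective z
  induction s with
  | zero => simp
  | add s t hs ht => simp only [map_add, hs, ht]
  | tmul p x => exact (DrinfeldDouble.counit_mk p x).symm

/-- In each leg the factors from `A*` stand to the left of those from `A`, so the pairing can be
evaluated without the cross relation. -/
lemma pairing_mul_inclTensor_mul (a b x x' : A) (f g p p' : HDual k A) {ι : Type*}
    (r : Coalgebra.Repr k b ι) (s : A ⊗[k] HDual k A) :
    pairing (SmashProduct.mk a f) (SmashProduct.mk b g)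
      ((DrinfeldDouble.inclDual k A p ⊗ₜ DrinfeldDouble.inclDual k A p') *
        DrinfeldDouble.inclTensor k A s *
        (DrinfeldDouble.inclA k A x ⊗ₜ DrinfeldDouble.inclA k A x'))
      = ∑ j ∈ r.index, p a * p' (r.left j) *
          f (HDual.evalRight k A A (r.right j) s * x) * g x' := by
  induction s with
  | zero => simp
  | add s t hs ht =>
    simp only [map_add, mul_add, add_mul, hs, ht, HDual.map_add_apply, Finset.sum_add_distrib]
  | tmul c q =>
    simp only [DrinfeldDouble.inclTensor_tmul, Algebra.TensorProduct.tmul_mul_tmul]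
    rw [mul_assoc, ← map_mul, ← map_mul, DrinfeldDouble.inclDual_mul_inclA,
      DrinfeldDouble.inclDual_mul_inclA, pairing_tmul, toDoubleDual_mk, toDoubleDual_mk,
      HDual.mul_apply_repr _ _ r, Finset.sum_mul, Finset.mul_sum]
    refine Finset.sum_congr rfl fun j _ => ?_
    rw [HDual.evalRight_tmul, smul_mul_assoc, HDual.map_smul_apply]
    ring

/-- The product of `H(A)` is the coproduct of `D(A)` twisted by the `R`-matrix:
`⟨vw, z⟩ = ⟨v ⊗ w, R Δ(z)⟩`. -/
lemma toDoubleDual_mul (v w : Heisenberg k A) (z : DrinfeldDouble k A) :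
    toDoubleDual k A (v * w) z = pairing v w (DrinfeldDouble.rMatrix k A * comul z) := by
  have pairing_add_left : ∀ v v' w : Heisenberg k A,
      pairing (v + v') w = pairing v w + pairing v' w := by
    intro v v' w
    simp [pairing, map_add_left, LinearMap.comp_add]
  have pairing_add_right : ∀ v w w' : Heisenberg k A,
      pairing v (w + w') = pairing v w + pairing v w' := by
    intro v w w'
    simp [pairing, map_add_right, LinearMap.comp_add]
  obtain ⟨s, rfl⟩ := (DrinfeldDouble.ofTensor k A).surjective z
  induction s with
  | zero => simp
  | add s t hs ht => simp only [map_add, mul_add, hs, ht]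
  | tmul p x =>
  change toDoubleDual k A (v * w) (DrinfeldDouble.mk p x)
    = pairing v w (DrinfeldDouble.rMatrix k A * comul (DrinfeldDouble.mk p x))
  induction v using induction_mk with
  | h0 => simp [pairing]
  | hadd v v' h h' =>
    rw [add_mul, map_add, LinearMap.add_apply, h, h', pairing_add_left, LinearMap.add_apply]
  | hmk a f =>
  induction w using induction_mk with
  | h0 => simp [pairing]
  | hadd v v' h h' =>
    rw [mul_add, map_add, LinearMap.add_apply, h, h', pairing_add_right, LinearMap.add_apply]
  | hmk b g =>
  -- Rewriting `R Δ(p) Δ(x)` as `Δ^cop(p) R Δ(x)` puts every factor in normal order, so that the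
  -- pairing formula applies.
  have hR : DrinfeldDouble.rMatrix k A * comul (DrinfeldDouble.mk p x)
      = ∑ l ∈ (ℛ k x).index, ∑ m ∈ (ℛ k p).index,
        (DrinfeldDouble.inclDual k A ((ℛ k p).left m) ⊗ₜ
          DrinfeldDouble.inclDual k A ((ℛ k p).right m)) *
        DrinfeldDouble.inclTensor k A (HDual.canonical k A) *
        (DrinfeldDouble.inclA k A ((ℛ k x).left l) ⊗ₜ
          DrinfeldDouble.inclA k A ((ℛ k x).right l)) := by
    rw [← DrinfeldDouble.inclDual_mul_inclA, Bialgebra.comul_mul, ← mul_assoc,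
      ← DrinfeldDouble.comul_inclDual_mul_rMatrix, DrinfeldDouble.comul_inclDual,
      DrinfeldDouble.comul_inclA, ← (ℛ k p).eq, ← (ℛ k x).eq, DrinfeldDouble.rMatrix_eq]
    simp only [map_sum, map_tmul, AlgHom.toLinearMap_apply, TensorProduct.comm_tmul,
      Finset.sum_mul, Finset.mul_sum]
  rw [hR]
  simp only [map_sum, pairing_mul_inclTensor_mul _ _ _ _ _ _ _ _ (ℛ k b),
    HDual.evalRight_canonical]
  rw [SmashProduct.mk_mul_mk _ _ _ _ (ℛ k f)]
  simp only [map_sum, LinearMap.sum_apply, toDoubleDual_mk, HDual.smul_def,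
    HDual.leftAct_apply _ (ℛ k b), HDual.mul_apply_repr _ _ (ℛ k x), HDual.map_sum_apply,
    Finset.mul_sum, Finset.sum_mul, mul_smul_comm, HDual.map_smul_apply,
    ← HDual.sum_repr_mul_apply (ℛ k p), ← HDual.sum_repr_mul_apply (ℛ k f)]
  rw [Finset.sum_comm]
  refine Finset.sum_congr rfl fun l _ => ?_
  rw [Finset.sum_comm]
  refine Eq.trans (Finset.sum_congr rfl fun j _ => ?_) Finset.sum_comm
  rw [Finset.sum_comm]
  refine Finset.sum_congr rfl fun m _ => Finset.sum_congr rfl fun d _ => ?_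
  ring

/-- The legs `s` in `D(A)` multiply `R Δ(z)` on the right and the legs `t` in the op-cop on the
left. Statements about the action on products thus become identities in `D(A) ⊗ D(A)`. -/
lemma toDoubleDual_smulMul (v w : Heisenberg k A)
    (s t : DrinfeldDouble k A ⊗[k] DrinfeldDouble k A) (z : DrinfeldDouble k A) :
    toDoubleDual k A (smulMul k v w (TensorProduct.tensorTensorTensorComm k _ _ _ _
      (s ⊗ₜ map (toOpCop k A).toLinearMap (toOpCop k A).toLinearMap t))) z
      = pairing v w (t * (DrinfeldDouble.rMatrix k A * comul z) * s) := by
  induction s with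
  | zero => simp
  | add s s' hs ht => simp only [map_add, add_tmul, mul_add, LinearMap.add_apply, hs, ht]
  | tmul a b =>
  induction t with
  | zero => simp
  | add s s' hs ht =>
    simp only [map_add, tmul_add, add_mul, LinearMap.add_apply, hs, ht]
  | tmul c d =>
  rw [map_tmul, TensorProduct.tensorTensorTensorComm_tmul, smulMul_tmul, toDoubleDual_mul]
  generalize DrinfeldDouble.rMatrix k A * comul z = u
  induction u with
  | zero => simp
  | add s s' hs ht => simp only [map_add, mul_add, add_mul, hs, ht]
  | tmul y z =>
    rw [pairing_tmul]
    refine (congrArg₂ (· * ·) (toDoubleDual_smul k A a c v y)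
      (toDoubleDual_smul k A b d w z)).trans ?_
    simp

instance isModuleAlgebra_envelope : IsModuleAlgebra k (DoubleEnvelope k A) (Heisenberg k A) where
  smul_one' h := by
    induction h using TensorProduct.induction_on with
    | zero =>
      rw [map_zero, map_zero]
      exact zero_smul (DoubleEnvelope k A) (1 : Heisenberg k A)
    | add x y hx hy => simp only [add_smul, map_add, hx, hy]
    | tmul a c =>
      obtain ⟨c, rfl⟩ := (toOpCop k A).surjective c
      apply (toDoubleDual k A).injective
      ext z
      rw [toDoubleDual_smul, toDoubleDual_one, Algebra.algebraMap_eq_smul_one, map_smul,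
        LinearMap.smul_apply, toDoubleDual_one, Bialgebra.counit_mul, Bialgebra.counit_mul]
      have e : counit (R := k) (a ⊗ₜ[k] toOpCop k A c : DoubleEnvelope k A)
          = counit (R := k) c * counit (R := k) a :=
        TensorProduct.counit_tmul (R := k) (S := k) a (toOpCop k A c)
      rw [e, smul_eq_mul]
      ring
  smul_mul' h v w := by
    induction h using TensorProduct.induction_on with
    | zero =>
      rw [map_zero, map_zero]
      exact zero_smul (DoubleEnvelope k A) (v * w)
    | add x y hx hy => simp only [add_smul, map_add, hx, hy]
    | tmul a c =>
      obtain ⟨c, rfl⟩ := (toOpCop k A).surjective c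
      apply (toDoubleDual k A).injective
      ext z
      have e : comul (R := k) (toOpCop k A c) = map (toOpCop k A).toLinearMap
          (toOpCop k A).toLinearMap (TensorProduct.comm k _ _ (comul c)) :=
        IsRMatrix.comul_opCopEquiv c
      -- The two sides pair `v ⊗ w` with `R Δ(cza)` and `Δ^cop(c) R Δ(z) Δ(a)`. The op-cop structure
      -- is what produces `Δ^cop(c)` on the left of `R`.
      rw [toDoubleDual_smul, toDoubleDual_mul, IsRMatrix.comul_tmul_eq, e, toDoubleDual_smulMul,
        Bialgebra.comul_mul, Bialgebra.comul_mul, ← mul_assoc, ← mul_assoc, ← mul_assoc,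
        DrinfeldDouble.isRMatrix_rMatrix.comm_comul_mul]

/-- With `U = R⁻¹`, the right side pairs `w ⊗ v` with `U R Δ(z) R₂₁ = Δ(z) R₂₁`. Flipping gives `⟨v
⊗ w, Δ^cop(z) R⟩ = ⟨v ⊗ w, R Δ(z)⟩ = ⟨vw, z⟩`. -/
theorem isQuantumCommutative_envelope :
    IsQuantumCommutative k (DoubleEnvelope.rMatrix k A) (Heisenberg k A) := by
  intro v w
  have ec : ∀ s t : DrinfeldDouble k A ⊗[k] DrinfeldDouble k A,
      TensorProduct.comm k (DoubleEnvelope k A) (DoubleEnvelope k A)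
        (TensorProduct.tensorTensorTensorComm k _ _ _ _
        (s ⊗ₜ map (toOpCop k A).toLinearMap (toOpCop k A).toLinearMap t))
      = TensorProduct.tensorTensorTensorComm k _ _ _ _ (TensorProduct.comm k _ _ s ⊗ₜ
          map (toOpCop k A).toLinearMap (toOpCop k A).toLinearMap
            (TensorProduct.comm k _ _ t)) := by
    intro s t
    induction s with
    | zero => simp
    | add s s' hs ht => simp only [map_add, add_tmul, hs, ht]
    | tmul a b =>
    induction t with
    | zero => simp
    | add s s' hs ht => simp only [map_add, tmul_add, hs, ht]
    | tmul c d => simp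
  have hc : ∀ s t : DrinfeldDouble k A ⊗[k] DrinfeldDouble k A,
      TensorProduct.comm k _ _ (s * t)
        = TensorProduct.comm k _ _ s * TensorProduct.comm k _ _ t :=
    map_mul (Algebra.TensorProduct.comm k (DrinfeldDouble k A) (DrinfeldDouble k A))
  apply (toDoubleDual k A).injective
  ext z
  rw [DoubleEnvelope.rMatrix_eq, ec, toDoubleDual_smulMul, ← mul_assoc,
    TensorProduct.comm_comm, DrinfeldDouble.inv_mul_rMatrix, one_mul, ← pairing_comm, hc,
    TensorProduct.comm_comm, DrinfeldDouble.isRMatrix_rMatrix.comm_comul_mul, toDoubleDual_mul]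

end Heisenberg

/-! ### The Hopf algebra structure of `A ⊗ A*ᵒᵖ`. -/

section HopfInstances

variable {k : Type*} [Field k]

/-- The opposite of a finite-dimensional Hopf algebra, with antipode `S⁻¹`. -/
instance instHopfAlgebraOp {H : Type*} [Ring H] [HopfAlgebra k H] [Module.Finite k H] :
    HopfAlgebra k Hᵐᵒᵖ where
  toBialgebra := instBialgebraOp k H
  antipode := (MulOpposite.opLinearEquiv k).toLinearMap ∘ₗ antipodeInv k H ∘ₗ
    (MulOpposite.opLinearEquiv k).symm.toLinearMap
  mul_antipode_rTensor_comul := by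
    ext h
    -- In the opposite product the left antipode axiom reads `∑ h₂ S⁻¹(h₁) = ε(h)`.
    refine Eq.trans ?_ (congrArg MulOpposite.op (mul_lTensor_antipodeInv_comm_comul k h.unop))
    simp only [LinearMap.comp_apply, LinearEquiv.coe_coe, MulOpposite.comul_def,
      MulOpposite.coe_opLinearEquiv_symm]
    generalize comul (R := k) h.unop = s
    induction s with
    | zero => simp
    | add s t hs ht => simp only [map_add, MulOpposite.op_add, hs, ht]
    | tmul x y => simp
  mul_antipode_lTensor_comul := by
    ext h
    refine Eq.trans ?_ (congrArg MulOpposite.op (mul_antipodeInv_comm_comul k h.unop))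
    simp only [LinearMap.comp_apply, LinearEquiv.coe_coe, MulOpposite.comul_def,
      MulOpposite.coe_opLinearEquiv_symm]
    generalize comul (R := k) h.unop = s
    induction s with
    | zero => simp
    | add s t hs ht => simp only [map_add, MulOpposite.op_add, hs, ht]
    | tmul x y => simp

lemma antipode_op {H : Type*} [Ring H] [HopfAlgebra k H] [Module.Finite k H] (h : H) :
    antipode k (MulOpposite.op h) = MulOpposite.op (antipodeInv k H h) := rfl

variable {A : Type*} [Ring A] [HopfAlgebra k A]

variable (k A) in
/-- The transpose `p ↦ p ∘ S` of the antipode. -/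
def HDual.antipodeDual : HDual k A →ₗ[k] HDual k A :=
  (HDual.toDual k A).symm.toLinearMap ∘ₗ (HopfAlgebra.antipode k (A := A)).dualMap ∘ₗ
    (HDual.toDual k A).toLinearMap

@[simp] lemma HDual.antipodeDual_apply (p : HDual k A) (x : A) :
    HDual.antipodeDual k A p x = p (antipode k x) := rfl

variable [Module.Finite k A]

/-- The dual of a finite-dimensional Hopf algebra. -/
instance HDual.instHopfAlgebra : HopfAlgebra k (HDual k A) where
  antipode := HDual.antipodeDual k A
  mul_antipode_rTensor_comul := by
    apply LinearMap.ext
    intro p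
    ext x
    have e : ∀ s : HDual k A ⊗[k] HDual k A, LinearMap.mul' k (HDual k A)
        ((HDual.antipodeDual k A).rTensor _ s) x = ∑ i ∈ (ℛ k x).index,
          HDual.ev₂ k A (antipode k ((ℛ k x).left i)) ((ℛ k x).right i) s := by
      intro s
      induction s with
      | zero => simp
      | add s t hs ht => simp only [map_add, HDual.add_apply, Finset.sum_add_distrib, hs, ht]
      | tmul p q => simp [HDual.mul_apply_repr _ _ (ℛ k x)]
    simp only [LinearMap.comp_apply]
    rw [e]
    simp only [HDual.ev₂_comul]
    rw [← HDual.map_sum_apply, sum_antipode_mul_eq_algebraMap_counit (ℛ k x),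
      HDual.counit_apply, Algebra.linearMap_apply, Algebra.algebraMap_eq_smul_one,
      Algebra.algebraMap_eq_smul_one, HDual.map_smul_apply, HDual.smul_apply, HDual.one_apply,
      mul_comm]
  mul_antipode_lTensor_comul := by
    apply LinearMap.ext
    intro p
    ext x
    have e : ∀ s : HDual k A ⊗[k] HDual k A, LinearMap.mul' k (HDual k A)
        ((HDual.antipodeDual k A).lTensor _ s) x = ∑ i ∈ (ℛ k x).index,
          HDual.ev₂ k A ((ℛ k x).left i) (antipode k ((ℛ k x).right i)) s := by
      intro s
      induction s with
      | zero => simp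
      | add s t hs ht => simp only [map_add, HDual.add_apply, Finset.sum_add_distrib, hs, ht]
      | tmul p q => simp [HDual.mul_apply_repr _ _ (ℛ k x)]
    simp only [LinearMap.comp_apply]
    rw [e]
    simp only [HDual.ev₂_comul]
    rw [← HDual.map_sum_apply, sum_mul_antipode_eq_algebraMap_counit (ℛ k x),
      HDual.counit_apply, Algebra.linearMap_apply, Algebra.algebraMap_eq_smul_one,
      Algebra.algebraMap_eq_smul_one, HDual.map_smul_apply, HDual.smul_apply, HDual.one_apply,
      mul_comm]

/-- The antipode of `A*ᵒᵖ` is the inverse of the transpose of `S`, so the inverse of the antipode of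
`A ⊗ A*ᵒᵖ` has the transpose itself in the second leg. This matches the explicit formula with the
map used in the general construction. -/
lemma HeisenbergBase.antipodeInv_eq (l : HeisenbergBase k A) :
    HeisenbergBase.antipodeInv k A l = HopfDouble.antipodeInv k (HeisenbergBase k A) l := by
  apply (antipode_bijective k (HeisenbergBase k A)).1
  rw [antipode_antipodeInv]
  induction l using TensorProduct.induction_on with
  | zero => simp only [map_zero]
  | add x y hx hy => simp only [map_add, hx, hy]
  | tmul a p =>
    obtain ⟨p, rfl⟩ := MulOpposite.op_surjective p
    have h1 : HeisenbergBase.antipodeInv k A (a ⊗ₜ MulOpposite.op p)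
      = HopfDouble.antipodeInv k A a ⊗ₜ MulOpposite.op (antipode k p) := rfl
    have h2 : ∀ (a : A) (q : (HDual k A)ᵐᵒᵖ), antipode k (a ⊗ₜ[k] q : HeisenbergBase k A)
      = antipode k a ⊗ₜ antipode k q := fun _ _ => rfl
    rw [h1, h2, antipode_antipodeInv, antipode_op, antipodeInv_antipode]

end HopfInstances

/-! ### The sub-bialgebra `A ⊗ A*ᵒᵖ` and the first legs of the `R`-matrix. -/

namespace DrinfeldDouble

variable (k A : Type*) [Field k] [Ring A] [HopfAlgebra k A] [Module.Finite k A]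

/-- The projection `p ⊗ a ↦ p(1) a`. -/
def projA : DrinfeldDouble k A →ₗ[k] A :=
  (TensorProduct.lid k A).toLinearMap ∘ₗ (counit (R := k) (A := HDual k A)).rTensor A ∘ₗ
    (ofTensor k A).symm.toLinearMap

/-- The projection `p ⊗ a ↦ ε(a) p`. -/
def projDual : DrinfeldDouble k A →ₗ[k] HDual k A :=
  (TensorProduct.rid k _).toLinearMap ∘ₗ (counit (R := k) (A := A)).lTensor (HDual k A) ∘ₗ
    (ofTensor k A).symm.toLinearMap

variable {k A}

@[simp] lemma projA_inclA (a : A) : projA k A (inclA k A a) = a := by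
  have : projA k A (inclA k A a) = counit (R := k) (1 : HDual k A) • a := rfl
  rw [this, Bialgebra.counit_one, one_smul]

@[simp] lemma projDual_inclDual (p : HDual k A) : projDual k A (inclDual k A p) = p := by
  have : projDual k A (inclDual k A p) = counit (R := k) (1 : A) • p := rfl
  rw [this, Bialgebra.counit_one, one_smul]

end DrinfeldDouble

namespace HeisenbergBase

variable {k A : Type*} [Field k] [Ring A] [HopfAlgebra k A] [Module.Finite k A]

lemma incl_tmul_op (a : A) (p : HDual k A) : incl k A (a ⊗ₜ MulOpposite.op p)
    = DrinfeldDouble.inclA k A a ⊗ₜ toOpCop k A (DrinfeldDouble.inclDual k A p) := rfl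

/-- The counit projections of `D(A)` onto `A` and `A*` give an explicit left inverse. -/
lemma incl_injective : Function.Injective (incl k A) := by
  let ρ : DoubleEnvelope k A →ₗ[k] HeisenbergBase k A := map (DrinfeldDouble.projA k A)
    ((MulOpposite.opLinearEquiv k).toLinearMap ∘ₗ DrinfeldDouble.projDual k A ∘ₗ
      (toOpCop k A).symm.toLinearMap)
  refine Function.LeftInverse.injective (g := ρ) fun l => ?_
  induction l using TensorProduct.induction_on with
  | zero => simp only [map_zero]
  | add x y hx hy => simp only [map_add, hx, hy]
  | tmul a p =>
    obtain ⟨p, rfl⟩ := MulOpposite.op_surjective p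
    rw [incl_tmul_op]
    simp [ρ]

variable (k A) in
/-- The embedding `q ⊗ c ↦ (q ⊗ 1) ⊗ (ε ⊗ S(c))` of `A* ⊗ A` into `D(A) ⊗ D(A)^{op cop}`. -/
def complement : HDual k A ⊗[k] A →ₗ[k] DoubleEnvelope k A :=
  map (DrinfeldDouble.inclDual k A).toLinearMap
    ((toOpCop k A).toLinearMap ∘ₗ (DrinfeldDouble.inclA k A).toLinearMap ∘ₗ antipode k)

variable (k A) in
/-- The preimage `∑ (eᵢ ⊗ eʲ) ⊗ ((eⁱ ⊗ 1) ⊗ (ε ⊗ S(eⱼ)))` of the `R`-matrix under `ι ⊗ id`. -/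
def rMatrixLift : HeisenbergBase k A ⊗[k] DoubleEnvelope k A :=
  (complement k A).lTensor _ (TensorProduct.tensorTensorTensorComm k _ _ _ _
    (HDual.canonical k A ⊗ₜ map (MulOpposite.opLinearEquiv k).toLinearMap LinearMap.id
      (TensorProduct.comm k _ _ (HDual.canonical k A))))

/-- Since `U = ∑ S(eⱼ) ⊗ eʲ`, the first leg `R¹ ⊗ U²` is `eᵢ ⊗ eʲ` and the antipode sits entirely in
the second leg. This puts the `R`-matrix in `ι(A ⊗ A*ᵒᵖ) ⊗ E`, as the restriction theorem requires.
-/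
lemma incl_rTensor_rMatrixLift :
    (incl k A).toLinearMap.rTensor (DoubleEnvelope k A) (rMatrixLift k A)
      = DoubleEnvelope.rMatrix k A := by
  rw [rMatrixLift, DoubleEnvelope.rMatrix_eq, DrinfeldDouble.rMatrix_eq,
    DrinfeldDouble.rMatrixInv]
  generalize HDual.canonical k A = t
  -- The identity is bilinear in the two copies of the canonical element; separating them allows
  -- induction on each.
  suffices h : ∀ s : A ⊗[k] HDual k A, (incl k A).toLinearMap.rTensor (DoubleEnvelope k A)
      ((complement k A).lTensor _ (TensorProduct.tensorTensorTensorComm k _ _ _ _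
        (s ⊗ₜ map (MulOpposite.opLinearEquiv k).toLinearMap LinearMap.id
          (TensorProduct.comm k _ _ t))))
      = TensorProduct.tensorTensorTensorComm k _ _ _ _ (DrinfeldDouble.inclTensor k A s ⊗ₜ
        map (toOpCop k A).toLinearMap (toOpCop k A).toLinearMap (TensorProduct.comm k _ _
          (DrinfeldDouble.inclTensor k A ((antipode k).rTensor _ t)))) from h t
  intro s
  induction s with
  | zero => simp
  | add s t hs ht => simp only [map_add, add_tmul, hs, ht]
  | tmul a p =>
  induction t with
  | zero => simp
  | add s t hs ht => simp only [map_add, tmul_add, hs, ht]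
  | tmul b q => rfl

/-- Slicing the second leg commutes with `ι`, so the support is `ι` of the slices of `rMatrixLift`.
Up to the embedding `complement` of the second leg, that element is canonical for `A ⊗ A*ᵒᵖ` and its
dual, so its slices exhaust `A ⊗ A*ᵒᵖ`. -/
lemma range_incl : Set.range (incl k A) = leftSupport k (DoubleEnvelope.rMatrix k A) := by
  have hswap : ∀ (f : Module.Dual k (DoubleEnvelope k A))
      (z : HeisenbergBase k A ⊗[k] DoubleEnvelope k A),
      TensorProduct.rid k _ (f.lTensor _ ((incl k A).toLinearMap.rTensor _ z))
        = incl k A (TensorProduct.rid k _ (f.lTensor _ z)) := by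
    intro f z
    induction z with
    | zero => simp only [map_zero]
    | add s t hs ht => simp only [map_add, hs, ht]
    | tmul l x => simp
  let c : Module.Dual k (DoubleEnvelope k A) →ₗ[k] HeisenbergBase k A :=
    { toFun := fun f => TensorProduct.rid k _ (f.lTensor _ (rMatrixLift k A))
      map_add' := fun f g => by
        rw [LinearMap.lTensor_add, LinearMap.add_apply, map_add]
      map_smul' := fun a f => by
        rw [LinearMap.lTensor_smul, LinearMap.smul_apply, map_smul]
        rfl }
  have hc : ∀ l, ∃ f, c f = l := by
    intro l
    change l ∈ LinearMap.range c
    induction l using TensorProduct.induction_on with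
    | zero => exact zero_mem _
    | add x y hx hy => exact add_mem hx hy
    | tmul a p =>
      obtain ⟨p, rfl⟩ := MulOpposite.op_surjective p
      -- The functional chosen to slice out `a ⊗ p`: evaluation at `a` on the leg `A*`, and `p ∘
      -- S⁻¹` on the leg `A`, where `S⁻¹` undoes the antipode in `complement`.
      let f : Module.Dual k (DoubleEnvelope k A) := LinearMap.mul' k k ∘ₗ
        map (HDual.ev k A a ∘ₗ DrinfeldDouble.projDual k A)
          (HDual.toDual k A p ∘ₗ HopfDouble.antipodeInv k A ∘ₗ DrinfeldDouble.projA k A ∘ₗ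
            (toOpCop k A).symm.toLinearMap)
      have hf : ∀ (q : HDual k A) (b : A), f (complement k A (q ⊗ₜ b)) = q a * p b := by
        intro q b
        simp [f, complement, HDual.toDual_apply]
      refine ⟨f, ?_⟩
      have h : ∀ s t : A ⊗[k] HDual k A, TensorProduct.rid k _ (f.lTensor _
          ((complement k A).lTensor (HeisenbergBase k A)
            (TensorProduct.tensorTensorTensorComm k _ _ _ _
            (s ⊗ₜ map (MulOpposite.opLinearEquiv k).toLinearMap LinearMap.id
              (TensorProduct.comm k _ _ t)))))
          = HDual.evalRight k A A a s ⊗ₜ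
            MulOpposite.op (TensorProduct.lid k _ ((HDual.toDual k A p).rTensor _ t)) := by
        intro s t
        induction s with
        | zero => simp
        | add s s' hs ht => simp only [map_add, add_tmul, hs, ht]
        | tmul a' q =>
        induction t with
        | zero => simp
        | add s s' hs ht => simp only [map_add, tmul_add, MulOpposite.op_add, hs, ht]
        | tmul b q' =>
          simp only [TensorProduct.comm_tmul, map_tmul,
            TensorProduct.tensorTensorTensorComm_tmul, LinearMap.lTensor_tmul, hf,
            TensorProduct.rid_tmul, LinearMap.rTensor_tmul, TensorProduct.lid_tmul,
            HDual.evalRight_tmul, HDual.toDual_apply, MulOpposite.op_smul]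
          rw [smul_tmul_smul]
          rfl
      have hp : TensorProduct.lid k _ ((HDual.toDual k A p).rTensor _
          (HDual.canonical k A)) = p := by
        ext x
        have e : ∀ t : A ⊗[k] HDual k A, (TensorProduct.lid k _
            ((HDual.toDual k A p).rTensor _ t)) x = p (HDual.evalRight k A A x t) := by
          intro t
          induction t with
          | zero => simp
          | add s t hs ht => simp only [map_add, HDual.add_apply, HDual.map_add_apply, hs, ht]
          | tmul b q => simp [HDual.toDual_apply, mul_comm]
        rw [e, HDual.evalRight_canonical]
      refine (h _ _).trans ?_
      rw [hp, HDual.evalRight_canonical]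
  rw [leftSupport, ← incl_rTensor_rMatrixLift]
  ext x
  constructor
  · rintro ⟨l, rfl⟩
    obtain ⟨f, rfl⟩ := hc l
    exact ⟨f, hswap f _⟩
  · rintro ⟨f, rfl⟩
    exact ⟨_, (hswap f _).symm⟩

/-- The coproduct of `A*` is flipped once in `D(A)` and once more in the op-cop, so the two flips
cancel. -/
lemma comul_incl (x : HeisenbergBase k A) : comul (R := k) (incl k A x)
    = map (incl k A).toLinearMap (incl k A).toLinearMap (comul x) := by
  induction x using TensorProduct.induction_on with
  | zero => simp only [map_zero]
  | add x y hx hy => simp only [map_add, hx, hy]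
  | tmul a p =>
    obtain ⟨p, rfl⟩ := MulOpposite.op_surjective p
    have e : ∀ h, comul (R := k) (toOpCop k A h) = map (toOpCop k A).toLinearMap
        (toOpCop k A).toLinearMap (TensorProduct.comm k _ _ (comul h)) :=
      IsRMatrix.comul_opCopEquiv
    have e' : comul (R := k) (MulOpposite.op p) = map (MulOpposite.opLinearEquiv k).toLinearMap
        (MulOpposite.opLinearEquiv k).toLinearMap (comul (R := k) p) := rfl
    rw [incl_tmul_op, IsRMatrix.comul_tmul_eq, IsRMatrix.comul_tmul_eq, e,
      DrinfeldDouble.comul_inclDual, DrinfeldDouble.comul_inclA, e']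
    generalize comul (R := k) a = s
    generalize comul (R := k) p = t
    induction s with
    | zero => simp
    | add s t hs ht => simp only [map_add, add_tmul, hs, ht]
    | tmul a b =>
    induction t with
    | zero => simp
    | add s t hs ht => simp only [map_add, tmul_add, hs, ht]
    | tmul p q => rfl

lemma counit_incl (x : HeisenbergBase k A) :
    counit (R := k) (incl k A x) = counit (R := k) x := by
  induction x using TensorProduct.induction_on with
  | zero => simp only [map_zero]
  | add x y hx hy => simp only [map_add, hx, hy]
  | tmul a p =>
    obtain ⟨p, rfl⟩ := MulOpposite.op_surjective p
    have h1 : counit (R := k) (incl k A (a ⊗ₜ MulOpposite.op p))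
        = counit (R := k) (DrinfeldDouble.mk p (1 : A))
          * counit (R := k) (DrinfeldDouble.mk (1 : HDual k A) a) :=
      TensorProduct.counit_tmul (R := k) (S := k) _ _
    have h2 : counit (R := k) (a ⊗ₜ[k] MulOpposite.op p : HeisenbergBase k A)
        = p 1 * counit (R := k) a :=
      TensorProduct.counit_tmul (R := k) (S := k) _ _
    rw [h1, h2, DrinfeldDouble.counit_mk, DrinfeldDouble.counit_mk]
    simp

/-- The element `(p ⊗ 1)(r ⊗ y)(ε ⊗ a) = pr ⊗ ya` needs no cross relation, and pairing it with `b #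
q` separates into the two one-sided actions. -/
lemma incl_smul (x : HeisenbergBase k A) (v : Heisenberg k A) : incl k A x • v = x • v := by
  induction x using TensorProduct.induction_on with
  | zero =>
    rw [map_zero]
    exact (zero_smul (DoubleEnvelope k A) v).trans (zero_smul (HeisenbergBase k A) v).symm
  | add x y hx hy => rw [map_add, add_smul, add_smul, hx, hy]
  | tmul a p =>
    obtain ⟨p, rfl⟩ := MulOpposite.op_surjective p
    induction v using Heisenberg.induction_mk with
    | h0 => rw [smul_zero, smul_zero]
    | hadd v w hv hw => rw [smul_add, smul_add, hv, hw]
    | hmk b q =>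
      apply (Heisenberg.toDoubleDual k A).injective
      ext z
      obtain ⟨s, rfl⟩ := (DrinfeldDouble.ofTensor k A).surjective z
      induction s with
      | zero => simp only [map_zero]
      | add s t hs ht => simp only [map_add, hs, ht]
      | tmul r y =>
        rw [incl_tmul, Heisenberg.toDoubleDual_smul, Heisenberg.base_smul_mk]
        change Heisenberg.toDoubleDual k A (SmashProduct.mk b q)
            (DrinfeldDouble.mk p 1 * DrinfeldDouble.mk r y * DrinfeldDouble.mk 1 a)
          = Heisenberg.toDoubleDual k A (SmashProduct.mk _ _) (DrinfeldDouble.mk r y)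
        rw [DrinfeldDouble.mk_one_mul_mk, DrinfeldDouble.mk_mul_mk_one,
          Heisenberg.toDoubleDual_mk, Heisenberg.toDoubleDual_mk, HDual.lhit_apply,
          HDual.rightAct_apply _ (ℛ k b), HDual.mul_apply_repr _ _ (ℛ k b),
          HDual.map_sum_apply]
        simp only [HDual.map_smul_apply]

end HeisenbergBase

/-! ### The target map of `H(A) # (A ⊗ A*ᵒᵖ)`. -/

namespace HeisenbergGroupoid

variable {k A : Type*} [Field k] [Ring A] [HopfAlgebra k A] [Module.Finite k A]

instance : Module.Finite k (Heisenberg k A) := inferInstanceAs (Module.Finite k (A ⊗[k] HDual k A))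

instance : Module.Finite k (HeisenbergBase k A) := inferInstance

/-- The target map exists over all of `E` by quantum commutativity, and restricts because the first
legs of the `R`-matrix lie in the image of `ι`. -/
theorem isBraidedTarget :
    SmashProduct.IsBraidedTarget
      (SmashProduct.targetOf (V := Heisenberg k A) (HeisenbergBase.rMatrixLift k A)) :=
  SmashProduct.isBraidedTarget_targetOf_of_injective (HeisenbergBase.incl k A)
    HeisenbergBase.incl_injective HeisenbergBase.comul_incl HeisenbergBase.counit_incl
    HeisenbergBase.incl_smul HeisenbergBase.incl_rTensor_rMatrixLift
    (SmashProduct.isBraidedTarget_targetOf DoubleEnvelope.isRMatrix_rMatrix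
      Heisenberg.isQuantumCommutative_envelope)

end HeisenbergGroupoid

end HopfDouble

end

/-! ### The main theorem. -/

/-- Let `A` be a finite-dimensional Hopf algebra over a field `k`. -/
theorem corollary5p10 (k A : Type*) [Field k] [Ring A] [HopfAlgebra k A] [Module.Finite k A] :
    -- `H(A)` is a quantum commutative left `D(A) ⊗ D(A)^{op cop}`-module algebra
    (IsRMatrix k (DrinfeldDouble.rMatrix k A) ∧
      IsRMatrix k (DoubleEnvelope.rMatrix k A) ∧
      IsModuleAlgebra k (DoubleEnvelope k A) (Heisenberg k A) ∧
      IsQuantumCommutative k (DoubleEnvelope.rMatrix k A)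
        (Heisenberg k A)) ∧
    -- `A ⊗ A*ᵒᵖ` is embedded as a sub-bialgebra, compatibly with the actions on `H(A)`
    (Function.Injective (HeisenbergBase.incl k A) ∧
      Set.range (HeisenbergBase.incl k A)
        = leftSupport k (DoubleEnvelope.rMatrix k A) ∧
      (∀ x : HeisenbergBase k A,
        Coalgebra.comul (R := k) (HeisenbergBase.incl k A x)
          = TensorProduct.map (HeisenbergBase.incl k A).toLinearMap
              (HeisenbergBase.incl k A).toLinearMap (Coalgebra.comul x)) ∧
      (∀ x : HeisenbergBase k A,
        Coalgebra.counit (R := k) (HeisenbergBase.incl k A x)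
          = Coalgebra.counit (R := k) x) ∧
      (∀ (x : HeisenbergBase k A) (v : Heisenberg k A),
        HeisenbergBase.incl k A x • v = x • v)) ∧
    -- `H(A) # (A ⊗ A*ᵒᵖ)` is a Hopf algebroid over `H(A)`, with the following structure maps
    ∃ 𝓗 : HopfAlgebroid k (Heisenberg k A)
        (HeisenbergGroupoid k A),
      (∀ v : Heisenberg k A, 𝓗.source v = SmashProduct.mk v 1) ∧
      (∀ v : Heisenberg k A,
        (HeisenbergBase.incl k A).toLinearMap.lTensor (Heisenberg k A)
          ((SmashProduct.ofTensor k (Heisenberg k A)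
            (HeisenbergBase k A)).symm (𝓗.tgt v))
          = (smulAt k v).rTensor (DoubleEnvelope k A)
            (TensorProduct.comm k (DoubleEnvelope k A) (DoubleEnvelope k A)
              (DoubleEnvelope.rMatrix k A))) ∧
      (∀ (v : Heisenberg k A) (l : HeisenbergBase k A),
        𝓗.comul (SmashProduct.mk v l)
          = 𝓗.proj (TensorProduct.map (SmashProduct.mkHom v)
            (SmashProduct.mkHom 1) (Coalgebra.comul l))) ∧
      (∀ (v : Heisenberg k A) (l : HeisenbergBase k A),
        𝓗.counit (SmashProduct.mk v l) = Coalgebra.counit (R := k) l • v) ∧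
      (∀ (v : Heisenberg k A) (l : HeisenbergBase k A),
        𝓗.antipode (SmashProduct.mk 1 (HeisenbergBase.antipodeInv k A l)
            * 𝓗.tgt v)
          = MulOpposite.op (SmashProduct.mk v l)) := by
  refine ⟨⟨DrinfeldDouble.isRMatrix_rMatrix, DoubleEnvelope.isRMatrix_rMatrix,
    Heisenberg.isModuleAlgebra_envelope, Heisenberg.isQuantumCommutative_envelope⟩,
    ⟨HeisenbergBase.incl_injective, HeisenbergBase.range_incl, HeisenbergBase.comul_incl,
      HeisenbergBase.counit_incl, HeisenbergBase.incl_smul⟩,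
    HeisenbergGroupoid.isBraidedTarget.hopfAlgebroid, fun _ => rfl, fun v => ?_, fun v l => ?_,
    fun v l => SmashProduct.counitMap_mk v l, fun v l => ?_⟩
  · change (HeisenbergBase.incl k A).toLinearMap.lTensor (Heisenberg k A)
      ((SmashProduct.ofTensor k (Heisenberg k A) (HeisenbergBase k A)).symm
        (SmashProduct.targetOf (HeisenbergBase.rMatrixLift k A) v)) = _
    rw [SmashProduct.targetOf_apply, LinearEquiv.symm_apply_apply,
      ← HeisenbergBase.incl_rTensor_rMatrixLift]
    generalize HeisenbergBase.rMatrixLift k A = K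
    induction K using TensorProduct.induction_on with
    | zero => simp only [map_zero]
    | add x y hx hy => simp only [map_add, hx, hy]
    | tmul l x => rfl
  · exact congrArg HeisenbergGroupoid.isBraidedTarget.sourceTarget.proj
      (SmashProduct.comulHom_mk v l)
  -- The antipode was constructed as the inverse of `v # l ↦ S⁻¹(l)β(v)`, so only the explicit
  -- formula for `S⁻¹` has to be substituted.
  · have h := HeisenbergGroupoid.isBraidedTarget.antipodeEquiv_unop_antipodeInvHom
      (SmashProduct.mk v l : HeisenbergGroupoid k A)
    rw [SmashProduct.IsBraidedTarget.antipodeInvHom_mk, ← HeisenbergBase.antipodeInv_eq] at h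
    exact h
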